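/- **Setting.** Let $\mathcal X\subset\mathbb R^{d_x}$, $\mathcal Y\subset\mathbb R^{d_y}$ be nonempty, convex and compact, $A\in\mathbb R^{p\times d_x}$, $B\in\mathbb R^{p\times d_y}$, $c\in\mathbb R^p$, let $\zeta\sim D$ be a random variable, $g(x,y)=\mathbb E[G(x,y,\zeta)]$, and consider $$\min_{x\in\mathcal X}\ \max_{y\in\mathcal Y,\ Ax+By\unlhd c} g(x,y),$$ where $\unlhd$ is $\le$ or $=$. Let $\Lambda=\mathbb R^p_+$ if $\unlhd$ is $\le$ and $\Lambda=\mathbb R^p$ if $\unlhd$ is $=$, $\mathcal L(x,y,\lambda)=g(x,y)-\lambda^\top(Ax+By-c)$, $\Phi(x,\lambda)=\max_{y\in\mathcal Y}\mathcal L(x,y,\lambda)$, and let $y^*(x,\lambda)$ be the maximizer. $\mathcal P_Z$ denotes the Euclidean projection onto $Z$, $\|\cdot\|$ the Euclidean norm and its induced matrix norm. For a function $h$ and $\theta>0$ let $\widehat\nabla^\theta h(u)=\sum_i\frac{h(u+\theta e_i)-h(u)}{\theta}e_i$. For $\alpha,\beta,\gamma>0$ let $\nabla\mathcal G^{\alpha,\beta,\gamma}(x,y,\lambda)$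 be the vector with blocks $\frac1\alpha\bigl(x-\mathcal P_{\mathcal X}(x-\alpha\nabla_x\mathcal L)\bigr)$, $\frac1\beta\bigl(y-\mathcal P_{\mathcal Y}(y+\beta\nabla_y\mathcal L)\bigr)$, $\frac1\gamma\bigl(\lambda-\mathcal P_\Lambda(\lambda-\gamma\nabla_\lambda\mathcal L)\bigr)$. **Assumptions.** (i) If $\unlhd$ is $\le$, for every $x\in\mathcal X$ there is $y\in\operatorname{relint}\mathcal Y$ with $Ax+By\le c$; if $\unlhd$ is $=$, for every $x\in\mathcal X$ there is $y\in\mathcal Y$ with $Ax+By=c$. (ii) There are $l>0$ and open sets $U\supseteq\mathcal X$, $V\supseteq\mathcal Y$ containing all the segments $[x,x+\theta_{1,k}e_i]$ ($x\in\mathcal X$) and $[y,y+\theta_{2,k}e_i]$ ($y\in\mathcal Y$), $k\ge1$, such that $G(x,y,\cdot)$ is measurable and integrable for $(x,y)\in U\times V$ and, for every $\zeta$, the partial gradients $\nabla_xG(\cdot,\cdot,\zeta)$, $\nabla_yG(\cdot,\cdot,\zeta)$ exist on $U\times V$ and are each $l$-Lipschitz in $x$ and $l$-Lipschitz in $y$.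 (iii) There is $\delta>0$ such that for all $k\ge 1$, $x\in\mathcal X$, $y\in\mathcal Y$: $\mathbb E\|\widehat\nabla_x^{\theta_{1,k}}G(x,y,\zeta)-\widehat\nabla_x^{\theta_{1,k}}g(x,y)\|^2\le\delta^2$ and $\mathbb E\|\widehat\nabla_y^{\theta_{2,k}}G(x,y,\zeta)-\widehat\nabla_y^{\theta_{2,k}}g(x,y)\|^2\le\delta^2$. (iv) $G(x,\cdot,\zeta)$ is $\mu$-strongly concave on $\mathcal Y$ for all $x\in\mathcal X$ and all $\zeta$, where $0<\mu\le L:=\max\{l,\|A\|,\|B\|\}$ (the last inequality is automatic unless $\mathcal Y$ is a single point). **Algorithm (ZO-RMPDPG).** Start at deterministic $x_1\in\mathcal X$, $y_1\in\mathcal Y$, $\lambda_1\in\Lambda$, with $\varrho_0=\iota_0=1$ and i.i.d. mini-batches $I_k=\{\zeta^k_1,\dots,\zeta^k_b\}$, $b\ge1$, of samples of $D$. With $\widehat\nabla_x\mathcal L_k(x,y,\lambda;I)=\frac1b\sum_{\zeta\in I}\widehat\nabla_x^{\theta_{1,k}}G(x,y,\zeta)-A^\top\lambda$, $\widehat\nabla_y\mathcal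 L_k(x,y,\lambda;I)=\frac1b\sum_{\zeta\in I}\widehat\nabla_y^{\theta_{2,k}}G(x,y,\zeta)-B^\top\lambda$ and $z_k=(x_k,y_k,\lambda_k)$, for $k\ge1$: $$v_k=\widehat\nabla_x\mathcal L_k(z_k;I_k)+(1-\varrho_{k-1})[v_{k-1}-\widehat\nabla_x\mathcal L_{k-1}(z_{k-1};I_k)],\quad w_k=\widehat\nabla_y\mathcal L_k(z_k;I_k)+(1-\iota_{k-1})[w_{k-1}-\widehat\nabla_y\mathcal L_{k-1}(z_{k-1};I_k)],$$ $$x_{k+1}=x_k+\eta_k(\mathcal P_{\mathcal X}(x_k-\tilde\alpha v_k)-x_k),\quad y_{k+1}=y_k+\eta_k(\mathcal P_{\mathcal Y}(y_k+\tilde\beta w_k)-y_k),$$ $$\lambda_{k+1}=\lambda_k+\eta_k\bigl(\mathcal P_\Lambda(\lambda_k+\tilde\gamma(Ax_{k+1}+By_{k+1}-c))-\lambda_k\bigr).$$ **Parameters.** Let $0<\tilde\beta\le\frac1{6L}$, $0<\tilde\alpha\le\frac{\mu^2\tilde\beta}{64L^2}$, $0<\tilde\gamma\le\frac{\mu^4\tilde\beta^2}{1280L^4\tilde\alpha}$,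 $\tilde\gamma\|B\|^2\le2\tilde\alpha L^2$; $0<A_1,A_2\le\min\{\frac b{72\tilde\alpha L^2},\frac{11\tilde\alpha b}{9\mu\tilde\beta},\frac b{144\tilde\gamma L^2}\}$, $0<A_3\le\min\{1,\frac\mu{8\tilde\alpha L^2},\frac\mu{4\tilde\gamma L^2}\}$, $A_4\ge\frac{3A_3^2\tilde\alpha+A_1}{A_1}$, $A_5\ge\frac{480A_3^2\tilde\alpha L^2+A_2\mu^2}{A_2\mu^2}$; $$D_1=\frac{\min\{\frac1{4\tilde\alpha},\frac{2\tilde\alpha L^2}{\mu\tilde\beta},\frac1{4\tilde\gamma},\frac{A_1A_4}{3A_3^2},\frac{A_2A_5}{3A_3^2}\}}{\max\{\frac3{\tilde\alpha^2}+3\|A\|^2,\frac3{\tilde\beta^2}+3\|B\|^2,\frac3{\tilde\gamma^2},3\}},$$ and for $\varepsilon>0$ take $\eta_k=\frac{A_3}{(k+2)^{1/3}}$ and, for $k\ge1$, $\varrho_k=\frac{A_4}{(k+2)^{2/3}}\le1$, $\iota_k=\frac{A_5}{(k+2)^{2/3}}\le1$, $$\theta_{1,k}=\frac{\varepsilon}{L(k+2)^{1/3}}\sqrt{\frac{D_1}{d_x(3D_1+4\tilde\alpha+\frac{12A_1}{bA_3^2})}},\qquad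 \theta_{2,k}=\frac{\varepsilon}{L(k+2)^{1/3}}\sqrt{\frac{D_1}{d_y(3D_1+\frac{12A_2}{bA_3^2}+\frac{320\tilde\alpha L^2}{\mu^2})}}.$$ For random vectors $(x,y,\lambda)$ put $$S_k(x,y,\lambda)=\mathbb E\Bigl[\Phi(x,\lambda)+\tfrac{32\tilde\alpha L^2}{\tilde\beta\mu}\|y-y^*(x,\lambda)\|^2+\tfrac{A_1}{\eta_{k-1}}\|\widehat\nabla_x^{\theta_{1,k}}g(x,y)-A^\top\lambda-v_k\|^2+\tfrac{A_2}{\eta_{k-1}}\|\widehat\nabla_y^{\theta_{2,k}}g(x,y)-B^\top\lambda-w_k\|^2\Bigr]-4\eta_{k-1}\tilde\alpha L^2\,\mathbb E\|y-y^*(x,\lambda)\|^2,$$ let $\underline S$ be the infimum of $S_k(x,y,\lambda)$ over $k\ge2$ and all square-integrable random vectors $x,y,\lambda$ with values in $\mathcal X,\mathcal Y,\Lambda$, and let $\sigma_y=\max_{y\in\mathcal Y}\|y\|$, $C_1=S_2(x_2,y_2,\lambda_2)-\underline S+16\tilde\alpha L^2\eta_1\sigma_y^2$, $C_2=\frac{2\delta^2(A_4^2A_1+A_5^2A_2)}{bA_3}$.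 **Theorem.** For every $\varepsilon>0$, $\underline S$ is finite, $\|\nabla\mathcal G^{\tilde\alpha,\tilde\beta,\tilde\gamma}(x_k,y_k,\lambda_k)\|^2$ is integrable for all $k\ge1$, and the index $$T_2(\varepsilon)=\min\{k\ge1:\ \mathbb E\|\nabla\mathcal G^{\tilde\alpha,\tilde\beta,\tilde\gamma}(x_k,y_k,\lambda_k)\|^2\le\varepsilon^2\}$$ exists. If $T_2(\varepsilon)\ge3$, then $$\frac{\varepsilon^2}4\le\frac{C_1+C_2\ln(T_2(\varepsilon)+2)}{D_1A_3\bigl(\frac32(T_2(\varepsilon)+3)^{2/3}-\frac{3\cdot4^{2/3}}2\bigr)}.$$ In particular $T_2(\varepsilon)=\tilde{\mathcal O}(\varepsilon^{-3})$: there is a constant $K$, depending only on the problem, the constants $l,\mu,\delta$, the sets $U,V$, the parameters $b,\tilde\alpha,\tilde\beta,\tilde\gamma,A_1,\dots,A_5$ and the starting point, but not on $\varepsilon$, such that $T_2(\varepsilon)\le K\varepsilon^{-3}(\ln\frac1\varepsilon)^{3/2}$ whenever $\varepsilon\le\frac12$ and the assumptions hold for that $\varepsilon$. Moreover, the constraint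 violation at $k=T_2(\varepsilon)$ is at most $\varepsilon$ in root mean square, and hence in expectation: for every $i\in\{1,\dots,p\}$, $$\mathbb E\bigl[\max\{0,[Ax_k+By_k-c]_i\}^2\bigr]\le\varepsilon^2,\qquad \mathbb E\bigl[\max\{0,[Ax_k+By_k-c]_i\}\bigr]\le\varepsilon .$$ -/

import Mathlib

open MeasureTheory ProbabilityTheory

noncomputable section

namespace ZORMPDPG

/-- Euclidean space of dimension `n`. -/
abbrev Vec (n : ℕ) := EuclideanSpace ℝ (Fin n)

/-- Euclidean projection onto `Z`: a point of `Z` nearest to `u` (unique and existing when `Z` is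
nonempty, closed and convex). -/
def proj {n : ℕ} (Z : Set (Vec n)) (u : Vec n) : Vec n :=
  Classical.epsilon fun z => z ∈ Z ∧ ∀ z' ∈ Z, ‖z - u‖ ≤ ‖z' - u‖

/-- Coordinate-wise forward finite-difference gradient estimator of `h` at `u`, with smoothing
parameter `θ`. -/
def fdGrad {n : ℕ} (θ : ℝ) (h : Vec n → ℝ) (u : Vec n) : Vec n :=
  ∑ i : Fin n, ((h (u + θ • EuclideanSpace.single i (1 : ℝ)) - h u) / θ) •
    EuclideanSpace.single i (1 : ℝ)

/-- The kind of the coupled linear constraints: `A x + B y ≤ c` or `A x + B y = c`. -/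
inductive ConstraintKind where
  | le
  | eq

/-- The data of the stochastic minimax problem
`min_{x ∈ X} max_{y ∈ Y, A x + B y ⊴ c} E_{ζ ∼ D} G(x, y, ζ)`.
The `p × dx` and `p × dy` matrices are given as linear maps between Euclidean spaces, so that their
norm is the induced one. -/
structure Problem (dx dy p : ℕ) (Ξ : Type*) [MeasurableSpace Ξ] where
  X : Set (Vec dx)
  Y : Set (Vec dy)
  A : Vec dx →L[ℝ] Vec p
  B : Vec dy →L[ℝ] Vec p
  c : Vec p
  kind : ConstraintKind
  G : Vec dx → Vec dy → Ξ → ℝ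
  D : Measure Ξ
  X_nonempty : X.Nonempty
  X_convex : Convex ℝ X
  X_compact : IsCompact X
  Y_nonempty : Y.Nonempty
  Y_convex : Convex ℝ Y
  Y_compact : IsCompact Y
  D_prob : IsProbabilityMeasure D

namespace Problem

variable {dx dy p : ℕ} {Ξ : Type*} [MeasurableSpace Ξ] (Q : Problem dx dy p Ξ)

/-- The expected objective `g(x, y) = E G(x, y, ζ)`. -/
def g (x : Vec dx) (y : Vec dy) : ℝ := ∫ z, Q.G x y z ∂Q.D

/-- The constraint residual `A x + B y - c`. -/
def resid (x : Vec dx) (y : Vec dy) : Vec p := Q.A x + Q.B y - Q.c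

/-- The multiplier set: the nonnegative orthant for `≤`, the whole space for `=`. -/
def mult : Set (Vec p) :=
  match Q.kind with
  | .le => {lam | ∀ i, 0 ≤ lam i}
  | .eq => Set.univ

/-- The Lagrangian `g(x, y) - λᵀ (A x + B y - c)`. -/
def lagr (x : Vec dx) (y : Vec dy) (lam : Vec p) : ℝ := Q.g x y - inner ℝ lam (Q.resid x y)

/-- `Φ(x, λ) = max_{y ∈ Y} lagr(x, y, λ)`. -/
def Phi (x : Vec dx) (lam : Vec p) : ℝ := sSup ((fun y => Q.lagr x y lam) '' Q.Y)

/-- `y*(x, λ)`, the maximizer of `lagr(x, ·, λ)` over `Y`. -/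
def yStar (x : Vec dx) (lam : Vec p) : Vec dy :=
  Classical.epsilon fun y => y ∈ Q.Y ∧ ∀ y' ∈ Q.Y, Q.lagr x y' lam ≤ Q.lagr x y lam

/-- The constant `L = max {l, ‖A‖, ‖B‖}`. -/
def lip (l : ℝ) : ℝ := max l (max ‖Q.A‖ ‖Q.B‖)

/-- The stationarity gap `∇𝒢^{α,β,γ}(x, y, λ)`, a vector of the Euclidean space
`ℝ^dx × ℝ^dy × ℝ^p`. -/
def gap (α β γ : ℝ) (x : Vec dx) (y : Vec dy) (lam : Vec p) :
    WithLp 2 (Vec dx × WithLp 2 (Vec dy × Vec p)) :=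
  WithLp.toLp 2
    ((1 / α) • (x - proj Q.X (x - α • gradient (fun x' => Q.lagr x' y lam) x)),
      WithLp.toLp 2
        ((1 / β) • (y - proj Q.Y (y + β • gradient (fun y' => Q.lagr x y' lam) y)),
          (1 / γ) • (lam - proj Q.mult (lam - γ • gradient (fun lam' => Q.lagr x y lam') lam))))

/-- Feasibility. For `≤`: every `x ∈ X` admits a feasible point in the relative interior of `Y`.
For `=`: every `x ∈ X` admits a feasible point in `Y`, i.e. the inner maximum is over a nonempty
set. -/
def Feasible : Prop :=
  match Q.kind with
  | .le => ∀ x ∈ Q.X, ∃ y ∈ intrinsicInterior ℝ Q.Y, ∀ i, Q.resid x y i ≤ 0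
  | .eq => ∀ x ∈ Q.X, ∃ y ∈ Q.Y, Q.resid x y = 0

/-- Lipschitz partial gradients of `G(·, ·, ζ)`, with constant `l` for every `ζ`, on the product
of two open sets `U ⊇ X` and `V ⊇ Y`; on this product `g = E G` is well defined. -/
structure Smooth (U : Set (Vec dx)) (V : Set (Vec dy)) (l : ℝ) : Prop where
  U_open : IsOpen U
  V_open : IsOpen V
  X_sub : Q.X ⊆ U
  Y_sub : Q.Y ⊆ V
  meas : ∀ x ∈ U, ∀ y ∈ V, Measurable (Q.G x y)
  integrable : ∀ x ∈ U, ∀ y ∈ V, Integrable (Q.G x y) Q.D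
  diff_x : ∀ z, ∀ x ∈ U, ∀ y ∈ V, DifferentiableAt ℝ (fun x' => Q.G x' y z) x
  diff_y : ∀ z, ∀ x ∈ U, ∀ y ∈ V, DifferentiableAt ℝ (fun y' => Q.G x y' z) y
  lip_xx : ∀ z, ∀ x₁ ∈ U, ∀ x₂ ∈ U, ∀ y ∈ V,
    ‖gradient (fun x' => Q.G x' y z) x₁ - gradient (fun x' => Q.G x' y z) x₂‖ ≤ l * ‖x₁ - x₂‖
  lip_xy : ∀ z, ∀ x ∈ U, ∀ y₁ ∈ V, ∀ y₂ ∈ V,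
    ‖gradient (fun x' => Q.G x' y₁ z) x - gradient (fun x' => Q.G x' y₂ z) x‖ ≤ l * ‖y₁ - y₂‖
  lip_yy : ∀ z, ∀ x ∈ U, ∀ y₁ ∈ V, ∀ y₂ ∈ V,
    ‖gradient (fun y' => Q.G x y' z) y₁ - gradient (fun y' => Q.G x y' z) y₂‖ ≤ l * ‖y₁ - y₂‖
  lip_yx : ∀ z, ∀ x₁ ∈ U, ∀ x₂ ∈ U, ∀ y ∈ V,
    ‖gradient (fun y' => Q.G x₁ y' z) y - gradient (fun y' => Q.G x₂ y' z) y‖ ≤ l * ‖x₁ - x₂‖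

/-- `G(x, ·, ζ)` is `μ`-strongly concave on `Y`, for every `x ∈ X` and every `ζ`. -/
def StronglyConcave (μ : ℝ) : Prop :=
  ∀ z, ∀ x ∈ Q.X, ∀ y ∈ Q.Y, ∀ y' ∈ Q.Y,
    Q.G x y' z ≤ Q.G x y z + inner ℝ (gradient (fun y'' => Q.G x y'' z) y) (y' - y)
      - μ / 2 * ‖y' - y‖ ^ 2

/-- The finite-difference segments that start in `X` (in `Y`) stay in `U` (in `V`). -/
structure Stencil (U : Set (Vec dx)) (V : Set (Vec dy)) (θ₁ θ₂ : ℕ → ℝ) : Prop where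
  seg_x : ∀ k, 1 ≤ k → ∀ x ∈ Q.X, ∀ i : Fin dx,
    segment ℝ x (x + θ₁ k • EuclideanSpace.single i (1 : ℝ)) ⊆ U
  seg_y : ∀ k, 1 ≤ k → ∀ y ∈ Q.Y, ∀ i : Fin dy,
    segment ℝ y (y + θ₂ k • EuclideanSpace.single i (1 : ℝ)) ⊆ V

/-- The zeroth-order gradient estimators of `G(·, ·, ζ)` have variance at most `δ²` on `X × Y`. -/
structure BoundedVariance (δ : ℝ) (θ₁ θ₂ : ℕ → ℝ) : Prop where
  int_x : ∀ k, 1 ≤ k → ∀ x ∈ Q.X, ∀ y ∈ Q.Y, Integrable (fun z =>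
    ‖fdGrad (θ₁ k) (fun x' => Q.G x' y z) x - fdGrad (θ₁ k) (fun x' => Q.g x' y) x‖ ^ 2) Q.D
  var_x : ∀ k, 1 ≤ k → ∀ x ∈ Q.X, ∀ y ∈ Q.Y,
    ∫ z, ‖fdGrad (θ₁ k) (fun x' => Q.G x' y z) x - fdGrad (θ₁ k) (fun x' => Q.g x' y) x‖ ^ 2 ∂Q.D
      ≤ δ ^ 2
  int_y : ∀ k, 1 ≤ k → ∀ x ∈ Q.X, ∀ y ∈ Q.Y, Integrable (fun z =>
    ‖fdGrad (θ₂ k) (fun y' => Q.G x y' z) y - fdGrad (θ₂ k) (fun y' => Q.g x y') y‖ ^ 2) Q.D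
  var_y : ∀ k, 1 ≤ k → ∀ x ∈ Q.X, ∀ y ∈ Q.Y,
    ∫ z, ‖fdGrad (θ₂ k) (fun y' => Q.G x y' z) y - fdGrad (θ₂ k) (fun y' => Q.g x y') y‖ ^ 2 ∂Q.D
      ≤ δ ^ 2

/-- Mini-batch zeroth-order estimator of the `x`-gradient of the Lagrangian. -/
def batchX {b : ℕ} (θ : ℝ) (x : Vec dx) (y : Vec dy) (lam : Vec p) (I : Fin b → Ξ) : Vec dx :=
  (1 / (b : ℝ)) • ∑ j, (fdGrad θ (fun x' => Q.G x' y (I j)) x - Q.A.adjoint lam)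

/-- Mini-batch zeroth-order estimator of the `y`-gradient of the Lagrangian. -/
def batchY {b : ℕ} (θ : ℝ) (x : Vec dx) (y : Vec dy) (lam : Vec p) (I : Fin b → Ξ) : Vec dy :=
  (1 / (b : ℝ)) • ∑ j, (fdGrad θ (fun y' => Q.G x y' (I j)) y - Q.B.adjoint lam)

/-- Zeroth-order estimator of the `x`-gradient of the expected Lagrangian. -/
def popX (θ : ℝ) (x : Vec dx) (y : Vec dy) (lam : Vec p) : Vec dx :=
  fdGrad θ (fun x' => Q.g x' y) x - Q.A.adjoint lam

/-- Zeroth-order estimator of the `y`-gradient of the expected Lagrangian. -/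
def popY (θ : ℝ) (x : Vec dx) (y : Vec dy) (lam : Vec p) : Vec dy :=
  fdGrad θ (fun y' => Q.g x y') y - Q.B.adjoint lam

/-- `σ_y = max {‖y‖ : y ∈ Y}`. -/
def sigmaY : ℝ := sSup ((fun y => ‖y‖) '' Q.Y)

end Problem

/-- The batch size `b`, the step sizes `α̃, β̃, γ̃` and the constants `A₁, …, A₅`. -/
structure Params where
  b : ℕ
  α : ℝ
  β : ℝ
  γ : ℝ
  A₁ : ℝ
  A₂ : ℝ
  A₃ : ℝ
  A₄ : ℝ
  A₅ : ℝ

namespace Params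

variable (c : Params)

/-- `η_k = A₃ / (k + 2)^{1/3}`. -/
def eta (k : ℕ) : ℝ := c.A₃ / ((k : ℝ) + 2) ^ (1 / 3 : ℝ)

/-- `ϱ_0 = 1` and `ϱ_k = A₄ / (k + 2)^{2/3}` for `k ≥ 1`. -/
def varrho (k : ℕ) : ℝ := if k = 0 then 1 else c.A₄ / ((k : ℝ) + 2) ^ (2 / 3 : ℝ)

/-- `ι_0 = 1` and `ι_k = A₅ / (k + 2)^{2/3}` for `k ≥ 1`. -/
def iota (k : ℕ) : ℝ := if k = 0 then 1 else c.A₅ / ((k : ℝ) + 2) ^ (2 / 3 : ℝ)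

variable {dx dy p : ℕ} {Ξ : Type*} [MeasurableSpace Ξ] (Q : Problem dx dy p Ξ) (l μ : ℝ)

/-- The constant `D₁`. -/
def D₁ : ℝ :=
  (min (1 / (4 * c.α)) (min (2 * c.α * Q.lip l ^ 2 / (μ * c.β)) (min (1 / (4 * c.γ))
      (min (c.A₁ * c.A₄ / (3 * c.A₃ ^ 2)) (c.A₂ * c.A₅ / (3 * c.A₃ ^ 2)))))) /
    (max (3 / c.α ^ 2 + 3 * ‖Q.A‖ ^ 2) (max (3 / c.β ^ 2 + 3 * ‖Q.B‖ ^ 2) (max (3 / c.γ ^ 2) 3)))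

/-- The smoothing parameters `θ_{1,k}`. -/
def theta₁ (ε : ℝ) (k : ℕ) : ℝ :=
  ε / (Q.lip l * ((k : ℝ) + 2) ^ (1 / 3 : ℝ)) *
    √(c.D₁ Q l μ / ((dx : ℝ) * (3 * c.D₁ Q l μ + 4 * c.α + 12 * c.A₁ / (c.b * c.A₃ ^ 2))))

/-- The smoothing parameters `θ_{2,k}`. -/
def theta₂ (ε : ℝ) (k : ℕ) : ℝ :=
  ε / (Q.lip l * ((k : ℝ) + 2) ^ (1 / 3 : ℝ)) *
    √(c.D₁ Q l μ / ((dy : ℝ) * (3 * c.D₁ Q l μ + 12 * c.A₂ / (c.b * c.A₃ ^ 2)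
      + 320 * c.α * Q.lip l ^ 2 / μ ^ 2)))

/-- The common upper bound for `A₁` and `A₂`. -/
def bound₁₂ : ℝ :=
  min (c.b / (72 * c.α * Q.lip l ^ 2)) (min (11 * c.α * c.b / (9 * μ * c.β))
    (c.b / (144 * c.γ * Q.lip l ^ 2)))

/-- The requirements on the parameters. The bound `γ̃ ≤ 2 α̃ L² / ‖B‖²` is written without the
quotient, so that it is void when `B = 0`. -/
structure Admissible : Prop where
  b_pos : 0 < c.b
  β_pos : 0 < c.β
  β_le : c.β ≤ 1 / (6 * Q.lip l)
  α_pos : 0 < c.α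
  α_le : c.α ≤ μ ^ 2 * c.β / (64 * Q.lip l ^ 2)
  γ_pos : 0 < c.γ
  γ_le_B : c.γ * ‖Q.B‖ ^ 2 ≤ 2 * c.α * Q.lip l ^ 2
  γ_le : c.γ ≤ μ ^ 4 * c.β ^ 2 / (1280 * Q.lip l ^ 4 * c.α)
  A₁_pos : 0 < c.A₁
  A₁_le : c.A₁ ≤ c.bound₁₂ Q l μ
  A₂_pos : 0 < c.A₂
  A₂_le : c.A₂ ≤ c.bound₁₂ Q l μ
  A₃_pos : 0 < c.A₃
  A₃_le : c.A₃ ≤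
    min 1 (min (μ / (8 * c.α * Q.lip l ^ 2)) (μ / (4 * c.γ * Q.lip l ^ 2)))
  A₄_ge : (3 * c.A₃ ^ 2 * c.α + c.A₁) / c.A₁ ≤ c.A₄
  A₅_ge : (480 * c.A₃ ^ 2 * c.α * Q.lip l ^ 2 + c.A₂ * μ ^ 2) / (c.A₂ * μ ^ 2) ≤ c.A₅
  varrho_le : ∀ k, 1 ≤ k → c.varrho k ≤ 1
  iota_le : ∀ k, 1 ≤ k → c.iota k ≤ 1

end Params

/-- The random sequences produced by the algorithm: the iterates `x_k, y_k, λ_k` and the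
variance-reduced estimators `v_k, w_k`. Only indices `k ≥ 1` matter. -/
structure Iterates (dx dy p : ℕ) (Ω : Type*) where
  x : ℕ → Ω → Vec dx
  y : ℕ → Ω → Vec dy
  lam : ℕ → Ω → Vec p
  v : ℕ → Ω → Vec dx
  w : ℕ → Ω → Vec dy

/-- `ζ k j` is the `j`-th element of the mini-batch `I_{k+1}`; all samples are i.i.d. with law
`D`. -/
structure IsSample {Ξ Ω : Type*} [MeasurableSpace Ξ] [MeasurableSpace Ω] (D : Measure Ξ)
    (P : Measure Ω) {b : ℕ} (ζ : ℕ → Fin b → Ω → Ξ) : Prop where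
  meas : ∀ k j, Measurable (ζ k j)
  law : ∀ k j, P.map (ζ k j) = D
  indep : iIndepFun (fun q : ℕ × Fin b => ζ q.1 q.2) P

section Algorithm

variable {dx dy p : ℕ} {Ξ : Type*} [MeasurableSpace Ξ] {Ω : Type*}

/-- The sequences `it` are generated by the zeroth-order regularized momentum primal-dual projected
gradient algorithm (with regularization `ρ_k = 0` and constant `α̃_k, γ̃_k`), started at
`(x₁, y₁, λ₁)`. The mini-batch `I_{k+1}` is `ζ k`, and `v_1, w_1` do not depend on the data at
index `0` since `ϱ_0 = ι_0 = 1`. -/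
structure IsGenerated (Q : Problem dx dy p Ξ) (c : Params) (θ₁ θ₂ : ℕ → ℝ)
    (ζ : ℕ → Fin c.b → Ω → Ξ) (x₁ : Vec dx) (y₁ : Vec dy) (lam₁ : Vec p)
    (it : Iterates dx dy p Ω) : Prop where
  init_x : ∀ ω, it.x 1 ω = x₁
  init_y : ∀ ω, it.y 1 ω = y₁
  init_lam : ∀ ω, it.lam 1 ω = lam₁
  upd_v : ∀ k ω, it.v (k + 1) ω =
    Q.batchX (θ₁ (k + 1)) (it.x (k + 1) ω) (it.y (k + 1) ω) (it.lam (k + 1) ω) (fun j => ζ k j ω)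
      + (1 - c.varrho k) • (it.v k ω -
        Q.batchX (θ₁ k) (it.x k ω) (it.y k ω) (it.lam k ω) (fun j => ζ k j ω))
  upd_w : ∀ k ω, it.w (k + 1) ω =
    Q.batchY (θ₂ (k + 1)) (it.x (k + 1) ω) (it.y (k + 1) ω) (it.lam (k + 1) ω) (fun j => ζ k j ω)
      + (1 - c.iota k) • (it.w k ω -
        Q.batchY (θ₂ k) (it.x k ω) (it.y k ω) (it.lam k ω) (fun j => ζ k j ω))
  upd_x : ∀ k, 1 ≤ k → ∀ ω, it.x (k + 1) ω =
    it.x k ω + c.eta k • (proj Q.X (it.x k ω - c.α • it.v k ω) - it.x k ω)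
  upd_y : ∀ k, 1 ≤ k → ∀ ω, it.y (k + 1) ω =
    it.y k ω + c.eta k • (proj Q.Y (it.y k ω + c.β • it.w k ω) - it.y k ω)
  upd_lam : ∀ k, 1 ≤ k → ∀ ω, it.lam (k + 1) ω =
    it.lam k ω + c.eta k •
      (proj Q.mult (it.lam k ω + c.γ • Q.resid (it.x (k + 1) ω) (it.y (k + 1) ω)) - it.lam k ω)

variable [MeasurableSpace Ω]

/-- `E ‖∇𝒢(x_k, y_k, λ_k)‖²`. -/
def meanSqGap (Q : Problem dx dy p Ξ) (c : Params) (P : Measure Ω) (it : Iterates dx dy p Ω)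
    (k : ℕ) : ℝ :=
  ∫ ω, ‖Q.gap c.α c.β c.γ (it.x k ω) (it.y k ω) (it.lam k ω)‖ ^ 2 ∂P

/-- The indices `k ≥ 1` with `E ‖∇𝒢(x_k, y_k, λ_k)‖² ≤ ε²`. -/
def hitSet (Q : Problem dx dy p Ξ) (c : Params) (P : Measure Ω) (it : Iterates dx dy p Ω)
    (ε : ℝ) : Set ℕ :=
  {k | 1 ≤ k ∧ meanSqGap Q c P it k ≤ ε ^ 2}

/-- `T₂(ε)`, the first index of `hitSet`. -/
def T₂ (Q : Problem dx dy p Ξ) (c : Params) (P : Measure Ω) (it : Iterates dx dy p Ω)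
    (ε : ℝ) : ℕ :=
  sInf (hitSet Q c P it ε)

/-- The potential `S_k(x, y, λ)`, for random vectors `x, y, λ`; it also depends on the estimators
`v_k, w_k` of the algorithm. -/
def potential (Q : Problem dx dy p Ξ) (c : Params) (l μ ε : ℝ) (P : Measure Ω)
    (it : Iterates dx dy p Ω) (k : ℕ) (x : Ω → Vec dx) (y : Ω → Vec dy) (lam : Ω → Vec p) : ℝ :=
  (∫ ω, (Q.Phi (x ω) (lam ω)
      + 32 * c.α * Q.lip l ^ 2 / (c.β * μ) * ‖y ω - Q.yStar (x ω) (lam ω)‖ ^ 2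
      + c.A₁ / c.eta (k - 1) *
        ‖Q.popX (c.theta₁ Q l μ ε k) (x ω) (y ω) (lam ω) - it.v k ω‖ ^ 2
      + c.A₂ / c.eta (k - 1) *
        ‖Q.popY (c.theta₂ Q l μ ε k) (x ω) (y ω) (lam ω) - it.w k ω‖ ^ 2) ∂P)
    - 4 * c.eta (k - 1) * c.α * Q.lip l ^ 2 * ∫ ω, ‖y ω - Q.yStar (x ω) (lam ω)‖ ^ 2 ∂P

/-- The values `S_k(x, y, λ)`, over all `k ≥ 2` and all square-integrable random vectors `x, y, λ`
with values in `X`, `Y` and `Λ`. -/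
def potentialValues (Q : Problem dx dy p Ξ) (c : Params) (l μ ε : ℝ) (P : Measure Ω)
    (it : Iterates dx dy p Ω) : Set ℝ :=
  {s | ∃ k, 2 ≤ k ∧ ∃ (x : Ω → Vec dx) (y : Ω → Vec dy) (lam : Ω → Vec p),
    Measurable x ∧ Measurable y ∧ Measurable lam ∧ MemLp lam 2 P ∧
    (∀ ω, x ω ∈ Q.X) ∧ (∀ ω, y ω ∈ Q.Y) ∧ (∀ ω, lam ω ∈ Q.mult) ∧
    s = potential Q c l μ ε P it k x y lam}

/-- `C₁ = S_2(x_2, y_2, λ_2) - S̲ + 16 α̃ L² η_1 σ_y²`, where `S̲` is the infimum of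
`potentialValues`. -/
def C₁ (Q : Problem dx dy p Ξ) (c : Params) (l μ ε : ℝ) (P : Measure Ω)
    (it : Iterates dx dy p Ω) : ℝ :=
  potential Q c l μ ε P it 2 (it.x 2) (it.y 2) (it.lam 2)
    - sInf (potentialValues Q c l μ ε P it)
    + 16 * c.α * Q.lip l ^ 2 * c.eta 1 * Q.sigmaY ^ 2

end Algorithm

/-- `C₂ = 2 δ² (A₄² A₁ + A₅² A₂) / (b A₃)`. -/
def C₂ (c : Params) (δ : ℝ) : ℝ :=
  2 * δ ^ 2 * (c.A₄ ^ 2 * c.A₁ + c.A₅ ^ 2 * c.A₂) / (c.b * c.A₃)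

end ZORMPDPG

end

namespace ZORMPDPG

/-! ### Euclidean projection -/

/-! The proof is a Lyapunov argument: the potential `S_k` decreases along the iterates by a multiple
of the expected squared gap, up to errors whose sum is small.

Outer steps. Strong concavity of the inner problem gives `Φ(·, λ)` a quadratic upper model with
curvature of order `L² / μ` (`Phi_sub_le_x`). The algorithm uses the `x`-gradient at `y_k` instead
of at the maximizer, which costs a multiple of the tracking error `‖y_k - y*(x_k, λ_k)‖²`. In `λ`
the function `Φ` is a maximum of affine functions, so linearizing at the new multiplier
(`Phi_sub_le_lam`) needs no smoothness, but it costs the tracking error at the new point. The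
negative term `-4 η α̃ L² ‖y - y*‖²` in the potential is there to absorb that cost.

Inner step. A relaxed projected ascent step contracts the distance to a fixed maximizer
(`norm_ascent_step_le`), and the maximizer moves in a Lipschitz way (`norm_yStar_sub_le`).
`descent_combination` balances both against the outer steps, leaving negative multiples of the three
squared displacements.

Gradient estimators. The error of a momentum estimator is `1 - ϱ` times the old error plus an
average of noise that is centered given the past. The noise splits into `ϱ` times a fresh sampling
error and `1 - ϱ` times the noise of a difference of two estimators, which the Lipschitz gradients
bound by the displacement and the smoothing error (`integral_norm_error_sq_le`). In the potential
the squared errors carry the weights `A_i / η_{k-1}`; these grow so slowly that the contraction,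
with `ϱ` of order `η²`, wins (`momentum_term_le`).

The gap is bounded by the displacements, the estimator errors and the smoothing errors
(`norm_gap_sq_le`), and `D₁` is the exchange rate between this bound and the available decrease. The
result, `potential_succ_le`, is in essence `S_{k+1} ≤ S_k - η_k D₁ (E‖∇𝒢_k‖² - ε²/2) + C₂ / (k + 2)`
plus a telescoping term.

Before the first hit every step gains at least `η_k D₁ ε² / 2`. Since `η_k` is of order `k^{-1/3}`,
summing gives `ε² T^{2/3}` of order at most `C₁ + C₂ log T`, because feasibility bounds the
potential from below (`le_of_mem_potentialValues`). This yields both the existence of the index and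
the explicit inequality. The rate follows by inverting the growth (`exists_cube_le`), with `C₁`
bounded independently of `ε` (`C₁_le`). The constraint violation is read off the multiplier block of
the gap (`max_resid_sq_le`). -/

theorem proj_spec {n : ℕ} {Z : Set (Vec n)} (hne : Z.Nonempty) (hcl : IsClosed Z) (u : Vec n) :
    proj Z u ∈ Z ∧ ∀ z' ∈ Z, ‖proj Z u - u‖ ≤ ‖z' - u‖ := by
  obtain ⟨y, hy, hd⟩ := hcl.exists_infDist_eq_dist hne u
  refine Classical.epsilon_spec (p := fun z => z ∈ Z ∧ ∀ z' ∈ Z, ‖z - u‖ ≤ ‖z' - u‖)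
    ⟨y, hy, fun z' hz' => ?_⟩
  rw [← dist_eq_norm, ← dist_eq_norm, dist_comm, ← hd, dist_comm]
  exact Metric.infDist_le_dist_of_mem hz'

theorem inner_proj_le {n : ℕ} {Z : Set (Vec n)} (hne : Z.Nonempty) (hcl : IsClosed Z)
    (hco : Convex ℝ Z) (u : Vec n) {z : Vec n} (hz : z ∈ Z) :
    inner ℝ (u - proj Z u) (z - proj Z u) ≤ 0 := by
  obtain ⟨hm, hmin⟩ := proj_spec hne hcl u
  refine (norm_eq_iInf_iff_real_inner_le_zero hco hm).1 ?_ z hz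
  have : Nonempty Z := hne.to_subtype
  refine le_antisymm (le_ciInf fun w => ?_) (ciInf_le (f := fun w : Z => ‖u - w‖)
    ⟨0, by rintro _ ⟨w, rfl⟩; exact norm_nonneg _⟩ ⟨_, hm⟩)
  rw [norm_sub_rev, norm_sub_rev u]
  exact hmin w w.2

theorem norm_proj_sub_proj_le {n : ℕ} {Z : Set (Vec n)} (hne : Z.Nonempty) (hcl : IsClosed Z)
    (hco : Convex ℝ Z) (u u' : Vec n) : ‖proj Z u - proj Z u'‖ ≤ ‖u - u'‖ := by
  have h1 := inner_proj_le hne hcl hco u (proj_spec hne hcl u').1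
  have h2 := inner_proj_le hne hcl hco u' (proj_spec hne hcl u).1
  have h3 : inner ℝ (proj Z u - proj Z u') (proj Z u - proj Z u') ≤
      inner ℝ (u - u') (proj Z u - proj Z u') := by
    simp only [inner_sub_left, inner_sub_right] at h1 h2 ⊢
    linarith
  rw [real_inner_self_eq_norm_sq] at h3
  have h4 := h3.trans (real_inner_le_norm _ _)
  by_contra! h5
  nlinarith [norm_nonneg (proj Z u - proj Z u'), norm_nonneg (u - u')]

theorem continuous_proj {n : ℕ} {Z : Set (Vec n)} (hne : Z.Nonempty) (hcl : IsClosed Z)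
    (hco : Convex ℝ Z) : Continuous (proj Z) :=
  (LipschitzWith.of_dist_le_mul (K := 1) fun u u' => by
    simpa [dist_eq_norm] using norm_proj_sub_proj_le hne hcl hco u u').continuous

theorem proj_eq_self {n : ℕ} {Z : Set (Vec n)} (hne : Z.Nonempty) (hcl : IsClosed Z) {u : Vec n}
    (hu : u ∈ Z) : proj Z u = u := by
  have h := (proj_spec hne hcl u).2 u hu
  simpa [sub_eq_zero] using h

/-! ### Functions with Lipschitz gradients -/

/-- Monotonicity replaces integration of `φ'`: for each sign `s`, the function `s (φ t - t φ' 0) - C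
t² / 2` has nonpositive derivative on the interval. The two signs give the two sides of the absolute
value. -/
theorem abs_sub_sub_deriv_le {φ φ' : ℝ → ℝ} {C : ℝ}
    (hd : ∀ t ∈ Set.Icc (0 : ℝ) 1, HasDerivAt φ (φ' t) t)
    (hb : ∀ t ∈ Set.Icc (0 : ℝ) 1, |φ' t - φ' 0| ≤ C * t) :
    |φ 1 - φ 0 - φ' 0| ≤ C / 2 := by
  have key : ∀ s : ℝ, |s| = 1 → s * (φ 1 - φ 0 - φ' 0) ≤ C / 2 := by
    intro s hs
    have hd' : ∀ t ∈ Set.Icc (0 : ℝ) 1, HasDerivAt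
        (fun t => s * (φ t - t * φ' 0) - C / 2 * t ^ 2) (s * (φ' t - φ' 0) - C * t) t := by
      intro t ht
      have := (((hd t ht).sub ((hasDerivAt_id t).mul_const (φ' 0))).const_mul s).sub
        (((hasDerivAt_id t).pow 2).const_mul (C / 2))
      exact this.congr_deriv (by simp; ring)
    have hanti : AntitoneOn (fun t => s * (φ t - t * φ' 0) - C / 2 * t ^ 2) (Set.Icc 0 1) := by
      refine antitoneOn_of_deriv_nonpos (convex_Icc 0 1)
        (fun t ht => (hd' t ht).continuousAt.continuousWithinAt) ?_ ?_
      · intro t ht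
        rw [interior_Icc] at ht
        exact (hd' t (Set.Ioo_subset_Icc_self ht)).differentiableAt.differentiableWithinAt
      · intro t ht
        rw [interior_Icc] at ht
        have ht' := Set.Ioo_subset_Icc_self ht
        rw [(hd' t ht').deriv]
        have h1 := hb t ht'
        have h2 : s * (φ' t - φ' 0) ≤ |φ' t - φ' 0| := by
          calc _ ≤ |s * (φ' t - φ' 0)| := le_abs_self _
            _ = _ := by rw [abs_mul, hs, one_mul]
        linarith
    have := hanti (Set.left_mem_Icc.2 zero_le_one) (Set.right_mem_Icc.2 zero_le_one) zero_le_one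
    simp at this
    linarith
  rw [abs_le]
  constructor
  · have := key (-1) (by simp); linarith
  · have := key 1 (by simp); linarith

theorem abs_sub_sub_inner_gradient_le {n : ℕ} {f : Vec n → ℝ} {W : Set (Vec n)} {l : ℝ}
    (hd : ∀ x ∈ W, DifferentiableAt ℝ f x)
    (hl : ∀ x ∈ W, ∀ x' ∈ W, ‖gradient f x - gradient f x'‖ ≤ l * ‖x - x'‖)
    {x x' : Vec n} (hs : segment ℝ x x' ⊆ W) :
    |f x' - f x - inner ℝ (gradient f x) (x' - x)| ≤ l / 2 * ‖x' - x‖ ^ 2 := by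
  have hmem : ∀ t ∈ Set.Icc (0 : ℝ) 1, x + t • (x' - x) ∈ W := fun t ht =>
    hs (by rw [segment_eq_image']; exact ⟨t, ht, rfl⟩)
  have h := abs_sub_sub_deriv_le (φ := fun t => f (x + t • (x' - x)))
    (φ' := fun t => inner ℝ (gradient f (x + t • (x' - x))) (x' - x)) (C := l * ‖x' - x‖ ^ 2) ?_ ?_
  · simp only [one_smul, zero_smul, add_zero, add_sub_cancel] at h
    linarith
  · intro t ht
    have h1 := (hd _ (hmem t ht)).hasGradientAt.hasFDerivAt
    have h2 : HasDerivAt (fun t : ℝ => x + t • (x' - x)) (x' - x) t := by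
      simpa using ((hasDerivAt_id t).smul_const (x' - x)).const_add x
    have h3 := h1.comp_hasDerivAt t h2
    rw [InnerProductSpace.toDual_apply_apply] at h3
    exact h3
  · intro t ht
    have h0 : x ∈ W := hs (left_mem_segment ℝ x x')
    simp only [zero_smul, add_zero]
    rw [← inner_sub_left]
    refine (abs_real_inner_le_norm _ _).trans ?_
    have h1 := hl _ (hmem t ht) _ h0
    rw [add_sub_cancel_left, norm_smul, Real.norm_of_nonneg ht.1] at h1
    nlinarith [norm_nonneg (x' - x)]

/-- The partial gradients of `H` exist on the product of the open sets `U`, `V` and are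
`l`-Lipschitz in each of the two arguments. -/
structure SmoothFun {m n : ℕ} (U : Set (Vec m)) (V : Set (Vec n)) (l : ℝ)
    (H : Vec m → Vec n → ℝ) : Prop where
  U_open : IsOpen U
  V_open : IsOpen V
  diff_x : ∀ x ∈ U, ∀ y ∈ V, DifferentiableAt ℝ (fun x' => H x' y) x
  diff_y : ∀ x ∈ U, ∀ y ∈ V, DifferentiableAt ℝ (fun y' => H x y') y
  lip_xx : ∀ x₁ ∈ U, ∀ x₂ ∈ U, ∀ y ∈ V,
    ‖gradient (fun x' => H x' y) x₁ - gradient (fun x' => H x' y) x₂‖ ≤ l * ‖x₁ - x₂‖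
  lip_xy : ∀ x ∈ U, ∀ y₁ ∈ V, ∀ y₂ ∈ V,
    ‖gradient (fun x' => H x' y₁) x - gradient (fun x' => H x' y₂) x‖ ≤ l * ‖y₁ - y₂‖
  lip_yy : ∀ x ∈ U, ∀ y₁ ∈ V, ∀ y₂ ∈ V,
    ‖gradient (fun y' => H x y') y₁ - gradient (fun y' => H x y') y₂‖ ≤ l * ‖y₁ - y₂‖
  lip_yx : ∀ x₁ ∈ U, ∀ x₂ ∈ U, ∀ y ∈ V,
    ‖gradient (fun y' => H x₁ y') y - gradient (fun y' => H x₂ y') y‖ ≤ l * ‖x₁ - x₂‖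

namespace SmoothFun

variable {m n : ℕ} {U : Set (Vec m)} {V : Set (Vec n)} {l : ℝ} {H : Vec m → Vec n → ℝ}

/-- The conditions are symmetric in the two arguments, so statements proved for the first slot serve
the second. The `y`-estimators are handled this way. -/
theorem flip (h : SmoothFun U V l H) : SmoothFun V U l (fun y x => H x y) where
  U_open := h.V_open
  V_open := h.U_open
  diff_x := fun y hy x hx => h.diff_y x hx y hy
  diff_y := fun y hy x hx => h.diff_x x hx y hy
  lip_xx := fun y₁ hy₁ y₂ hy₂ x hx => h.lip_yy x hx y₁ hy₁ y₂ hy₂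
  lip_xy := fun y hy x₁ hx₁ x₂ hx₂ => h.lip_yx x₁ hx₁ x₂ hx₂ y hy
  lip_yy := fun y hy x₁ hx₁ x₂ hx₂ => h.lip_xx x₁ hx₁ x₂ hx₂ y hy
  lip_yx := fun y₁ hy₁ y₂ hy₂ x hx => h.lip_xy x hx y₁ hy₁ y₂ hy₂

theorem norm_gradient_sub_le (h : SmoothFun U V l H) {x₁ x₂ : Vec m} (hx₁ : x₁ ∈ U)
    (hx₂ : x₂ ∈ U) {y₁ y₂ : Vec n} (hy₁ : y₁ ∈ V) (hy₂ : y₂ ∈ V) :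
    ‖gradient (fun x' => H x' y₁) x₁ - gradient (fun x' => H x' y₂) x₂‖ ≤
      l * ‖x₁ - x₂‖ + l * ‖y₁ - y₂‖ :=
  (norm_sub_le_norm_sub_add_norm_sub _ (gradient (fun x' => H x' y₁) x₂) _).trans
    (add_le_add (h.lip_xx _ hx₁ _ hx₂ _ hy₁) (h.lip_xy _ hx₂ _ hy₁ _ hy₂))

theorem continuousOn_gradient (h : SmoothFun U V l H) : ContinuousOn
    (fun q : Vec m × Vec n => gradient (fun x' => H x' q.2) q.1) (U ×ˢ V) := by
  intro q hq
  rw [ContinuousWithinAt, tendsto_iff_norm_sub_tendsto_zero]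
  have hlim : Filter.Tendsto (fun q' : Vec m × Vec n => l * ‖q'.1 - q.1‖ + l * ‖q'.2 - q.2‖)
      (nhdsWithin q (U ×ˢ V)) (nhds 0) := by
    have : Continuous (fun q' : Vec m × Vec n => l * ‖q'.1 - q.1‖ + l * ‖q'.2 - q.2‖) := by
      fun_prop
    simpa using (this.tendsto q).mono_left nhdsWithin_le_nhds
  refine squeeze_zero' (Filter.Eventually.of_forall fun _ => norm_nonneg _) ?_ hlim
  filter_upwards [self_mem_nhdsWithin] with q' hq'
  exact h.norm_gradient_sub_le hq'.1 hq.1 hq'.2 hq.2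

/-- Separate differentiability alone would not give joint continuity. Here the increment in `x` at
the moving second argument is bounded by `‖∇_x H(x, y')‖ ‖x' - x‖` plus a quadratic term, and that
gradient is jointly continuous; the increment in `y` at fixed `x` is ordinary continuity. -/
theorem continuousOn (h : SmoothFun U V l H) :
    ContinuousOn (fun q : Vec m × Vec n => H q.1 q.2) (U ×ˢ V) := by
  rintro ⟨x, y⟩ ⟨hx, hy⟩
  obtain ⟨r, hr, hrU⟩ := Metric.isOpen_iff.1 h.U_open x hx
  have hnear : ∀ᶠ q : Vec m × Vec n in nhdsWithin (x, y) (U ×ˢ V),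
      q.1 ∈ Metric.ball x r ∧ q.2 ∈ V := by
    have h1 : ∀ᶠ q : Vec m × Vec n in nhds (x, y), q.1 ∈ Metric.ball x r :=
      (continuous_fst.tendsto (x, y)).eventually (Metric.ball_mem_nhds x hr)
    filter_upwards [nhdsWithin_le_nhds h1, self_mem_nhdsWithin] with q hq hq'
    exact ⟨hq, hq'.2⟩
  have hg := h.continuousOn_gradient (x, y) ⟨hx, hy⟩
  have hcy : ContinuousWithinAt (fun q : Vec m × Vec n => H x q.2) (U ×ˢ V) (x, y) := by
    have : ContinuousAt (fun y' => H x y') y := (h.diff_y x hx y hy).continuousAt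
    exact (ContinuousAt.comp (f := Prod.snd) (x := (x, y)) this
      continuous_snd.continuousAt).continuousWithinAt
  have hdiff : Filter.Tendsto (fun q : Vec m × Vec n => H q.1 q.2 - H x q.2)
      (nhdsWithin (x, y) (U ×ˢ V)) (nhds 0) := by
    have hgx : ContinuousWithinAt (fun q : Vec m × Vec n =>
        ‖gradient (fun x' => H x' q.2) x‖ * ‖q.1 - x‖ + l / 2 * ‖q.1 - x‖ ^ 2)
        (U ×ˢ V) (x, y) := by
      have h1 : ContinuousWithinAt (fun q : Vec m × Vec n => gradient (fun x' => H x' q.2) x)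
          (U ×ˢ V) (x, y) := by
        refine ContinuousWithinAt.comp (t := U ×ˢ V) (f := fun q : Vec m × Vec n => (x, q.2))
          (x := (x, y)) hg (by fun_prop) ?_
        exact fun q hq => ⟨hx, hq.2⟩
      have h2 : ContinuousWithinAt (fun q : Vec m × Vec n => q.1 - x) (U ×ˢ V) (x, y) := by
        fun_prop
      exact (h1.norm.mul h2.norm).add ((h2.norm.pow 2).const_mul _)
    have hgx' : Filter.Tendsto (fun q : Vec m × Vec n =>
        ‖gradient (fun x' => H x' q.2) x‖ * ‖q.1 - x‖ + l / 2 * ‖q.1 - x‖ ^ 2)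
        (nhdsWithin (x, y) (U ×ˢ V)) (nhds 0) := by
      simpa [ContinuousWithinAt] using hgx
    refine squeeze_zero_norm' ?_ hgx'
    filter_upwards [hnear] with q hq
    have hseg : segment ℝ x q.1 ⊆ U :=
      ((convex_ball x r).segment_subset (Metric.mem_ball_self hr) hq.1).trans hrU
    have h1 := abs_sub_sub_inner_gradient_le (fun x' hx' => h.diff_x x' hx' q.2 hq.2)
      (fun x' hx' x'' hx'' => h.lip_xx x' hx' x'' hx'' q.2 hq.2) hseg
    have h2 := abs_real_inner_le_norm (gradient (fun x' => H x' q.2) x) (q.1 - x)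
    rw [Real.norm_eq_abs]
    calc |H q.1 q.2 - H x q.2| = |(H q.1 q.2 - H x q.2
          - inner ℝ (gradient (fun x' => H x' q.2) x) (q.1 - x))
          + inner ℝ (gradient (fun x' => H x' q.2) x) (q.1 - x)| := by rw [sub_add_cancel]
      _ ≤ _ := (abs_add_le _ _).trans (by linarith)
  have := hdiff.add hcy
  simpa [ContinuousWithinAt] using this

end SmoothFun

/-! ### Finite differences -/

theorem fdGrad_apply {n : ℕ} (θ : ℝ) (h : Vec n → ℝ) (u : Vec n) (i : Fin n) :
    fdGrad θ h u i = (h (u + θ • EuclideanSpace.single i (1 : ℝ)) - h u) / θ := by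
  simp only [fdGrad, WithLp.ofLp_sum, Finset.sum_apply, PiLp.smul_apply, smul_eq_mul]
  rw [Finset.sum_eq_single i]
  · simp
  · intro j _ hj
    simp [hj.symm]
  · simp

theorem norm_le_sqrt_mul_of_abs_le {n : ℕ} {v : Vec n} {C : ℝ} (hC : 0 ≤ C)
    (h : ∀ i, |v i| ≤ C) : ‖v‖ ≤ √n * C := by
  rw [EuclideanSpace.norm_eq]
  calc √(∑ i, ‖v i‖ ^ 2) ≤ √(∑ _i : Fin n, C ^ 2) := by
        refine Real.sqrt_le_sqrt (Finset.sum_le_sum fun i _ => ?_)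
        have := h i
        rw [Real.norm_eq_abs]
        gcongr
    _ = √n * C := by
        simp [Real.sqrt_sq hC]

/-- Each coordinate carries the quadratic Taylor remainder divided by `θ`. Positivity of `θ` is
asked only for `0 < n`: the smoothing parameters have the dimension in a denominator, so they are
`0` in dimension zero. -/
theorem norm_fdGrad_sub_gradient_le {n : ℕ} {f : Vec n → ℝ} {W : Set (Vec n)} {l θ : ℝ}
    (hl0 : 0 ≤ l) (hθ : 0 ≤ θ) (hθn : 0 < n → 0 < θ)
    (hd : ∀ x ∈ W, DifferentiableAt ℝ f x)
    (hl : ∀ x ∈ W, ∀ x' ∈ W, ‖gradient f x - gradient f x'‖ ≤ l * ‖x - x'‖) {x : Vec n}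
    (hs : ∀ i : Fin n, segment ℝ x (x + θ • EuclideanSpace.single i (1 : ℝ)) ⊆ W) :
    ‖fdGrad θ f x - gradient f x‖ ≤ √n * (l * θ / 2) := by
  refine norm_le_sqrt_mul_of_abs_le (by positivity) fun i => ?_
  have hpos : 0 < θ := hθn (Fin.pos i)
  have h := abs_sub_sub_inner_gradient_le hd hl (hs i)
  rw [PiLp.sub_apply, fdGrad_apply]
  rw [add_sub_cancel_left, inner_smul_right, norm_smul, EuclideanSpace.inner_single_right] at h
  simp only [PiLp.norm_single, norm_one, mul_one, one_mul, conj_trivial,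
    Real.norm_of_nonneg hθ] at h
  have : (f (x + θ • EuclideanSpace.single i (1 : ℝ)) - f x) / θ - gradient f x i =
      (f (x + θ • EuclideanSpace.single i (1 : ℝ)) - f x - θ * gradient f x i) / θ := by
    field_simp
  rw [this, abs_div, abs_of_pos hpos, div_le_iff₀ hpos]
  linarith


/-! ### Expectations of functions with Lipschitz gradients -/

section Integral

variable {n : ℕ} {Ξ : Type*} [MeasurableSpace Ξ] {D : Measure Ξ}

theorem integrable_fdGrad {F : Vec n → Ξ → ℝ} {θ : ℝ} {u : Vec n} (hu : Integrable (F u) D)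
    (hs : ∀ i : Fin n, Integrable (F (u + θ • EuclideanSpace.single i (1 : ℝ))) D) :
    Integrable (fun z => fdGrad θ (fun u' => F u' z) u) D :=
  integrable_finsetSum _ fun i _ => (((hs i).sub hu).div_const θ).smul_const _

theorem integral_fdGrad {F : Vec n → Ξ → ℝ} {θ : ℝ} {u : Vec n} (hu : Integrable (F u) D)
    (hs : ∀ i : Fin n, Integrable (F (u + θ • EuclideanSpace.single i (1 : ℝ))) D) :
    ∫ z, fdGrad θ (fun u' => F u' z) u ∂D = fdGrad θ (fun u' => ∫ z, F u' z ∂D) u := by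
  unfold fdGrad
  have hi : ∀ i ∈ (Finset.univ : Finset (Fin n)), Integrable (fun z =>
      ((F (u + θ • EuclideanSpace.single i (1 : ℝ)) z - F u z) / θ) •
        EuclideanSpace.single i (1 : ℝ)) D :=
    fun i _ => (((hs i).sub hu).div_const θ).smul_const _
  rw [integral_finsetSum _ hi]
  refine Finset.sum_congr rfl fun i _ => ?_
  rw [integral_smul_const, integral_div, integral_sub (hs i) hu]

variable [IsProbabilityMeasure D] {F : Vec n → Ξ → ℝ} {W : Set (Vec n)} {l : ℝ}

/-- The gradient is the limit of finite-difference quotients, uniformly in the sample. The limit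
gives measurability, and a bounded distance to one integrable quotient gives integrability. -/
theorem integrable_gradient (hl0 : 0 ≤ l) (hW : IsOpen W) (hint : ∀ u ∈ W, Integrable (F u) D)
    (hd : ∀ z, ∀ u ∈ W, DifferentiableAt ℝ (fun u' => F u' z) u)
    (hl : ∀ z, ∀ u ∈ W, ∀ u' ∈ W,
      ‖gradient (fun u' => F u' z) u - gradient (fun u' => F u' z) u'‖ ≤ l * ‖u - u'‖)
    {u : Vec n} (hu : u ∈ W) : Integrable (fun z => gradient (fun u' => F u' z) u) D := by
  obtain ⟨r, hr, hrW⟩ := Metric.isOpen_iff.1 hW u hu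
  -- Step lengths tending to `0` that stay strictly below `r`, so that every stencil lies in the
  -- ball.
  have hθ : ∀ k : ℕ, 0 < r / (k + 2) ∧ r / (k + 2) < r := fun k => by
    refine ⟨by positivity, ?_⟩
    rw [div_lt_iff₀ (by positivity)]
    nlinarith [(Nat.cast_nonneg k : (0 : ℝ) ≤ k)]
  have hmem : ∀ (k : ℕ) (i : Fin n),
      u + (r / (k + 2)) • EuclideanSpace.single i (1 : ℝ) ∈ Metric.ball u r := fun k i => by
    rw [mem_ball_iff_norm, add_sub_cancel_left, norm_smul, PiLp.norm_single, norm_one, mul_one,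
      Real.norm_of_nonneg (hθ k).1.le]
    exact (hθ k).2
  have hbound : ∀ (k : ℕ) (z : Ξ), ‖fdGrad (r / (k + 2)) (fun u' => F u' z) u -
      gradient (fun u' => F u' z) u‖ ≤ √n * (l * (r / (k + 2)) / 2) := fun k z =>
    norm_fdGrad_sub_gradient_le hl0 (hθ k).1.le (fun _ => (hθ k).1) (hd z) (hl z) fun i =>
      ((convex_ball u r).segment_subset (Metric.mem_ball_self hr) (hmem k i)).trans hrW
  have hfd : ∀ k : ℕ, Integrable (fun z => fdGrad (r / (k + 2)) (fun u' => F u' z) u) D :=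
    fun k => integrable_fdGrad (hint u hu) fun i => hint _ (hrW (hmem k i))
  have hlim : Filter.Tendsto (fun k : ℕ => √n * (l * (r / (k + 2)) / 2)) Filter.atTop
      (nhds 0) := by
    have h1 : Filter.Tendsto (fun k : ℕ => r / ((k : ℝ) + 2)) Filter.atTop (nhds 0) :=
      Filter.Tendsto.const_div_atTop
        (Filter.tendsto_atTop_add_const_right _ _ tendsto_natCast_atTop_atTop) r
    simpa using ((h1.const_mul l).div_const 2).const_mul √n
  have hmeas : AEStronglyMeasurable (fun z => gradient (fun u' => F u' z) u) D := by
    refine aestronglyMeasurable_of_tendsto_ae (u := Filter.atTop)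
      (fun k => (hfd k).aestronglyMeasurable) (Filter.Eventually.of_forall fun z => ?_)
    rw [tendsto_iff_norm_sub_tendsto_zero]
    exact squeeze_zero (fun _ => norm_nonneg _) (fun k => hbound k z) hlim
  have h0 : Integrable (fun z => fdGrad (r / ((0 : ℕ) + 2)) (fun u' => F u' z) u -
      gradient (fun u' => F u' z) u) D :=
    Integrable.of_bound ((hfd 0).aestronglyMeasurable.sub hmeas) _
      (Filter.Eventually.of_forall (hbound 0))
  refine ((hfd 0).sub h0).congr (Filter.Eventually.of_forall fun z => ?_)
  simp

/-- The Taylor remainder is at most `l / 2 ‖u' - u‖²` for every sample, hence also after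
integration. This is already `o(‖u' - u‖)`, so no dominated convergence is needed. -/
theorem hasGradientAt_integral (hl0 : 0 ≤ l) (hW : IsOpen W)
    (hint : ∀ u ∈ W, Integrable (F u) D)
    (hd : ∀ z, ∀ u ∈ W, DifferentiableAt ℝ (fun u' => F u' z) u)
    (hl : ∀ z, ∀ u ∈ W, ∀ u' ∈ W,
      ‖gradient (fun u' => F u' z) u - gradient (fun u' => F u' z) u'‖ ≤ l * ‖u - u'‖)
    {u : Vec n} (hu : u ∈ W) : HasGradientAt (fun u' => ∫ z, F u' z ∂D)
      (∫ z, gradient (fun u' => F u' z) u ∂D) u := by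
  obtain ⟨r, hr, hrW⟩ := Metric.isOpen_iff.1 hW u hu
  have hgi := integrable_gradient hl0 hW hint hd hl hu
  have key : ∀ u' ∈ Metric.ball u r, ‖∫ z, F u' z ∂D - ∫ z, F u z ∂D -
      inner ℝ (∫ z, gradient (fun u' => F u' z) u ∂D) (u' - u)‖ ≤ l / 2 * ‖u' - u‖ ^ 2 := by
    intro u' hu'
    have e1 : inner ℝ (∫ z, gradient (fun u' => F u' z) u ∂D) (u' - u) =
        ∫ z, inner ℝ (gradient (fun u' => F u' z) u) (u' - u) ∂D := by
      rw [real_inner_comm, ← integral_inner hgi]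
      simp_rw [real_inner_comm]
    have hsub : Integrable (fun z => F u' z - F u z) D := (hint u' (hrW hu')).sub (hint u hu)
    rw [e1, ← integral_sub (hint u' (hrW hu')) (hint u hu),
      ← integral_sub hsub (hgi.inner_const _)]
    refine (norm_integral_le_of_norm_le_const (C := l / 2 * ‖u' - u‖ ^ 2)
      (Filter.Eventually.of_forall fun z => ?_)).trans (by simp)
    exact abs_sub_sub_inner_gradient_le (hd z) (hl z)
      (((convex_ball u r).segment_subset (Metric.mem_ball_self hr) hu').trans hrW)
  rw [hasGradientAt_iff_isLittleO]
  have hO : (fun u' => ∫ z, F u' z ∂D - ∫ z, F u z ∂D -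
      inner ℝ (∫ z, gradient (fun u' => F u' z) u ∂D) (u' - u)) =O[nhds u]
      fun u' => ‖u' - u‖ ^ 2 := by
    refine Asymptotics.IsBigO.of_bound (l / 2) ?_
    filter_upwards [Metric.ball_mem_nhds u hr] with u' hu'
    simpa using key u' hu'
  refine hO.trans_isLittleO ?_
  have h1 : (fun u' : Vec n => ‖u' - u‖ ^ 2) =o[nhds u] fun u' => ‖u' - u‖ := by
    have h2 := Asymptotics.isLittleO_pow_id (𝕜 := ℝ) (n := 2) (by norm_num)
    refine h2.comp_tendsto (k := fun u' : Vec n => ‖u' - u‖) ?_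
    have : Continuous fun u' : Vec n => ‖u' - u‖ := by fun_prop
    simpa using this.tendsto u
  exact h1.trans_isBigO (Asymptotics.isBigO_norm_left.2 (Asymptotics.isBigO_refl _ _))

end Integral

/-! ### From the samples `G` to the expectation `g` -/

namespace Problem

variable {dx dy p : ℕ} {Ξ : Type*} [MeasurableSpace Ξ] {Q : Problem dx dy p Ξ}
  {U : Set (Vec dx)} {V : Set (Vec dy)} {l μ : ℝ}

theorem Smooth.smoothFun_G (h : Q.Smooth U V l) (z : Ξ) :
    SmoothFun U V l (fun x y => Q.G x y z) where
  U_open := h.U_open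
  V_open := h.V_open
  diff_x := h.diff_x z
  diff_y := h.diff_y z
  lip_xx := h.lip_xx z
  lip_xy := h.lip_xy z
  lip_yy := h.lip_yy z
  lip_yx := h.lip_yx z

theorem Smooth.integrable_gradient_x (h : Q.Smooth U V l) (hl : 0 ≤ l) {x : Vec dx} (hx : x ∈ U)
    {y : Vec dy} (hy : y ∈ V) : Integrable (fun z => gradient (fun x' => Q.G x' y z) x) Q.D :=
  have := Q.D_prob
  integrable_gradient (F := fun x' z => Q.G x' y z) hl h.U_open
    (fun u hu => h.integrable u hu y hy) (fun z u hu => h.diff_x z u hu y hy)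
    (fun z u hu u' hu' => h.lip_xx z u hu u' hu' y hy) hx

theorem Smooth.integrable_gradient_y (h : Q.Smooth U V l) (hl : 0 ≤ l) {x : Vec dx} (hx : x ∈ U)
    {y : Vec dy} (hy : y ∈ V) : Integrable (fun z => gradient (fun y' => Q.G x y' z) y) Q.D :=
  have := Q.D_prob
  integrable_gradient (F := fun y' z => Q.G x y' z) hl h.V_open
    (fun u hu => h.integrable x hx u hu) (fun z u hu => h.diff_y z x hx u hu)
    (fun z u hu u' hu' => h.lip_yy z x hx u hu u' hu') hy

theorem Smooth.hasGradientAt_x (h : Q.Smooth U V l) (hl : 0 ≤ l) {x : Vec dx} (hx : x ∈ U)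
    {y : Vec dy} (hy : y ∈ V) : HasGradientAt (fun x' => Q.g x' y)
      (∫ z, gradient (fun x' => Q.G x' y z) x ∂Q.D) x :=
  have := Q.D_prob
  hasGradientAt_integral (F := fun x' z => Q.G x' y z) hl h.U_open
    (fun u hu => h.integrable u hu y hy) (fun z u hu => h.diff_x z u hu y hy)
    (fun z u hu u' hu' => h.lip_xx z u hu u' hu' y hy) hx

theorem Smooth.hasGradientAt_y (h : Q.Smooth U V l) (hl : 0 ≤ l) {x : Vec dx} (hx : x ∈ U)
    {y : Vec dy} (hy : y ∈ V) : HasGradientAt (fun y' => Q.g x y')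
      (∫ z, gradient (fun y' => Q.G x y' z) y ∂Q.D) y :=
  have := Q.D_prob
  hasGradientAt_integral (F := fun y' z => Q.G x y' z) hl h.V_open
    (fun u hu => h.integrable x hx u hu) (fun z u hu => h.diff_y z x hx u hu)
    (fun z u hu u' hu' => h.lip_yy z x hx u hu u' hu') hy

theorem norm_integral_sub_integral_le {E Ξ : Type*} [NormedAddCommGroup E] [NormedSpace ℝ E]
    [MeasurableSpace Ξ] {D : Measure Ξ} [IsProbabilityMeasure D] {f f' : Ξ → E} {C : ℝ}
    (hf : Integrable f D) (hf' : Integrable f' D) (h : ∀ z, ‖f z - f' z‖ ≤ C) :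
    ‖∫ z, f z ∂D - ∫ z, f' z ∂D‖ ≤ C := by
  rw [← integral_sub hf hf']
  simpa using norm_integral_le_of_norm_le_const (μ := D) (Filter.Eventually.of_forall h)

theorem Smooth.smoothFun_g (h : Q.Smooth U V l) (hl : 0 ≤ l) : SmoothFun U V l Q.g where
  U_open := h.U_open
  V_open := h.V_open
  diff_x := fun _ hx _ hy => (h.hasGradientAt_x hl hx hy).differentiableAt
  diff_y := fun _ hx _ hy => (h.hasGradientAt_y hl hx hy).differentiableAt
  lip_xx := fun x₁ hx₁ x₂ hx₂ y hy => by
    have := Q.D_prob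
    rw [(h.hasGradientAt_x hl hx₁ hy).gradient, (h.hasGradientAt_x hl hx₂ hy).gradient]
    exact norm_integral_sub_integral_le (h.integrable_gradient_x hl hx₁ hy)
      (h.integrable_gradient_x hl hx₂ hy) fun z => h.lip_xx z _ hx₁ _ hx₂ _ hy
  lip_xy := fun x hx y₁ hy₁ y₂ hy₂ => by
    have := Q.D_prob
    rw [(h.hasGradientAt_x hl hx hy₁).gradient, (h.hasGradientAt_x hl hx hy₂).gradient]
    exact norm_integral_sub_integral_le (h.integrable_gradient_x hl hx hy₁)
      (h.integrable_gradient_x hl hx hy₂) fun z => h.lip_xy z _ hx _ hy₁ _ hy₂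
  lip_yy := fun x hx y₁ hy₁ y₂ hy₂ => by
    have := Q.D_prob
    rw [(h.hasGradientAt_y hl hx hy₁).gradient, (h.hasGradientAt_y hl hx hy₂).gradient]
    exact norm_integral_sub_integral_le (h.integrable_gradient_y hl hx hy₁)
      (h.integrable_gradient_y hl hx hy₂) fun z => h.lip_yy z _ hx _ hy₁ _ hy₂
  lip_yx := fun x₁ hx₁ x₂ hx₂ y hy => by
    have := Q.D_prob
    rw [(h.hasGradientAt_y hl hx₁ hy).gradient, (h.hasGradientAt_y hl hx₂ hy).gradient]
    exact norm_integral_sub_integral_le (h.integrable_gradient_y hl hx₁ hy)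
      (h.integrable_gradient_y hl hx₂ hy) fun z => h.lip_yx z _ hx₁ _ hx₂ _ hy

/-- The properties of the expected objective that enter the descent estimates. -/
structure Regular (Q : Problem dx dy p Ξ) (U : Set (Vec dx)) (V : Set (Vec dy)) (l μ : ℝ) :
    Prop where
  l_pos : 0 < l
  μ_pos : 0 < μ
  μ_le : μ ≤ Q.lip l
  X_sub : Q.X ⊆ U
  Y_sub : Q.Y ⊆ V
  sm : SmoothFun U V l Q.g
  conc : ∀ x ∈ Q.X, ∀ y ∈ Q.Y, ∀ y' ∈ Q.Y, Q.g x y' ≤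
    Q.g x y + inner ℝ (gradient (fun y'' => Q.g x y'') y) (y' - y) - μ / 2 * ‖y' - y‖ ^ 2

theorem Smooth.regular (h : Q.Smooth U V l) (hl : 0 < l) (hμ : 0 < μ) (hμL : μ ≤ Q.lip l)
    (hconc : Q.StronglyConcave μ) : Q.Regular U V l μ where
  l_pos := hl
  μ_pos := hμ
  μ_le := hμL
  X_sub := h.X_sub
  Y_sub := h.Y_sub
  sm := h.smoothFun_g hl.le
  conc := fun x hx y hy y' hy' => by
    have := Q.D_prob
    have hx' := h.X_sub hx
    have hyV := h.Y_sub hy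
    have hgi := h.integrable_gradient_y hl.le hx' hyV
    have e1 : inner ℝ (gradient (fun y'' => Q.g x y'') y) (y' - y) =
        ∫ z, inner ℝ (gradient (fun y'' => Q.G x y'' z) y) (y' - y) ∂Q.D := by
      rw [(h.hasGradientAt_y hl.le hx' hyV).gradient, real_inner_comm, ← integral_inner hgi]
      simp_rw [real_inner_comm]
    have hi : Integrable (fun z => Q.G x y z +
        inner ℝ (gradient (fun y'' => Q.G x y'' z) y) (y' - y)) Q.D :=
      (h.integrable x hx' y hyV).add (hgi.inner_const (y' - y))
    have e2 : ∫ z, (Q.G x y z + inner ℝ (gradient (fun y'' => Q.G x y'' z) y) (y' - y)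
        - μ / 2 * ‖y' - y‖ ^ 2) ∂Q.D = Q.g x y +
        inner ℝ (gradient (fun y'' => Q.g x y'') y) (y' - y) - μ / 2 * ‖y' - y‖ ^ 2 := by
      rw [integral_sub hi (integrable_const _), integral_add (h.integrable x hx' y hyV)
        (hgi.inner_const _), e1]
      simp [Problem.g]
    rw [← e2]
    exact integral_mono (h.integrable x hx' y' (h.Y_sub hy')) (hi.sub (integrable_const _))
      fun z => hconc z x hx y hy y' hy'

end Problem


namespace Problem

variable {dx dy p : ℕ} {Ξ : Type*} [MeasurableSpace Ξ] {Q : Problem dx dy p Ξ}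
  {U : Set (Vec dx)} {V : Set (Vec dy)} {l μ : ℝ}

/-! ### The Lagrangian -/

/-- The `x`-gradient of the Lagrangian. -/
noncomputable def lagrX (Q : Problem dx dy p Ξ) (x : Vec dx) (y : Vec dy) (lam : Vec p) : Vec dx :=
  gradient (fun x' => Q.g x' y) x - Q.A.adjoint lam

/-- The `y`-gradient of the Lagrangian. -/
noncomputable def lagrY (Q : Problem dx dy p Ξ) (x : Vec dx) (y : Vec dy) (lam : Vec p) : Vec dy :=
  gradient (fun y' => Q.g x y') y - Q.B.adjoint lam

theorem hasGradientAt_sub_inner {m n : ℕ} {f : Vec m → ℝ} {x f' : Vec m}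
    (hf : HasGradientAt f f' x) (T : Vec m →L[ℝ] Vec n) (lam e : Vec n) :
    HasGradientAt (fun x' => f x' - inner ℝ lam (T x' + e)) (f' - T.adjoint lam) x := by
  rw [hasGradientAt_iff_hasFDerivAt] at hf ⊢
  have h : HasFDerivAt (fun x' => inner ℝ lam (T x' + e)) ((innerSL ℝ lam).comp T) x :=
    (innerSL ℝ lam).hasFDerivAt.comp x (T.hasFDerivAt.add_const e)
  refine (hf.sub h).congr_fderiv ?_
  ext v
  simp [ContinuousLinearMap.adjoint_inner_left]

theorem gradient_lagr_x (hQ : SmoothFun U V l Q.g) {x : Vec dx} {y : Vec dy} (hx : x ∈ U)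
    (hy : y ∈ V) (lam : Vec p) :
    gradient (fun x' => Q.lagr x' y lam) x = Q.lagrX x y lam := by
  have h := hasGradientAt_sub_inner (hQ.diff_x x hx y hy).hasGradientAt Q.A lam (Q.B y - Q.c)
  simp only [← add_sub_assoc] at h
  exact h.gradient

theorem gradient_lagr_y (hQ : SmoothFun U V l Q.g) {x : Vec dx} {y : Vec dy} (hx : x ∈ U)
    (hy : y ∈ V) (lam : Vec p) :
    gradient (fun y' => Q.lagr x y' lam) y = Q.lagrY x y lam := by
  have h := hasGradientAt_sub_inner (hQ.diff_y x hx y hy).hasGradientAt Q.B lam (Q.A x - Q.c)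
  have e : ∀ y', Q.B y' + (Q.A x - Q.c) = Q.A x + Q.B y' - Q.c := fun y' => by abel
  simp only [e] at h
  exact h.gradient

theorem gradient_lagr_lam (Q : Problem dx dy p Ξ) (x : Vec dx) (y : Vec dy) (lam : Vec p) :
    gradient (fun lam' => Q.lagr x y lam') lam = -Q.resid x y := by
  refine HasGradientAt.gradient ?_
  rw [hasGradientAt_iff_hasFDerivAt]
  have h := ((innerSL ℝ (Q.resid x y)).hasFDerivAt (x := lam)).const_sub (Q.g x y)
  have e : (fun lam' => Q.lagr x y lam') = fun lam' => Q.g x y - innerSL ℝ (Q.resid x y) lam' := by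
    funext lam'
    simp only [lagr, innerSL_apply_apply]
    rw [real_inner_comm]
  rw [e]
  refine h.congr_fderiv ?_
  ext v
  simp

theorem inner_resid_sub (Q : Problem dx dy p Ξ) (x x' : Vec dx) (y y' : Vec dy) (lam : Vec p) :
    inner ℝ lam (Q.resid x' y') - inner ℝ lam (Q.resid x y) =
      inner ℝ (Q.A.adjoint lam) (x' - x) + inner ℝ (Q.B.adjoint lam) (y' - y) := by
  simp only [ContinuousLinearMap.adjoint_inner_left, resid, inner_sub_right,
    inner_add_right]
  ring

theorem l_le (Q : Problem dx dy p Ξ) (l : ℝ) : l ≤ Q.lip l := by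
  simp [lip]

theorem norm_B_le (Q : Problem dx dy p Ξ) (l : ℝ) : ‖Q.B‖ ≤ Q.lip l := by
  simp [lip]

namespace Regular

variable (h : Q.Regular U V l μ)
include h

/-- The multiplier term is affine in `x`, so it only shifts the gradient and the quadratic bound for
`g` carries over. The same holds in `y` for the next two bounds. -/
theorem lagr_sub_le_x {x x' : Vec dx} {y : Vec dy} (hx : x ∈ Q.X) (hx' : x' ∈ Q.X) (hy : y ∈ Q.Y)
    (lam : Vec p) : Q.lagr x' y lam - Q.lagr x y lam ≤
      inner ℝ (Q.lagrX x y lam) (x' - x) + l / 2 * ‖x' - x‖ ^ 2 := by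
  have h1 := abs_sub_sub_inner_gradient_le
    (fun x' hx' => h.sm.diff_x x' hx' y (h.Y_sub hy))
    (fun x' hx' x'' hx'' => h.sm.lip_xx x' hx' x'' hx'' y (h.Y_sub hy))
    ((Q.X_convex.segment_subset hx hx').trans h.X_sub)
  have h2 := Q.inner_resid_sub x x' y y lam
  simp only [sub_self, inner_zero_right, add_zero] at h2
  simp only [lagr, lagrX, inner_sub_left]
  linarith [(abs_le.1 h1).2]

theorem le_lagr_sub_y {x : Vec dx} {y y' : Vec dy} (hx : x ∈ Q.X) (hy : y ∈ Q.Y) (hy' : y' ∈ Q.Y)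
    (lam : Vec p) : inner ℝ (Q.lagrY x y lam) (y' - y) - l / 2 * ‖y' - y‖ ^ 2 ≤
      Q.lagr x y' lam - Q.lagr x y lam := by
  have h1 := abs_sub_sub_inner_gradient_le
    (fun y' hy' => h.sm.diff_y x (h.X_sub hx) y' hy')
    (fun y' hy' y'' hy'' => h.sm.lip_yy x (h.X_sub hx) y' hy' y'' hy'')
    ((Q.Y_convex.segment_subset hy hy').trans h.Y_sub)
  have h2 := Q.inner_resid_sub x x y y' lam
  simp only [sub_self, inner_zero_right, zero_add] at h2
  simp only [lagr, lagrY, inner_sub_left]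
  linarith [(abs_le.1 h1).1]

theorem lagr_sub_le_y {x : Vec dx} {y y' : Vec dy} (hx : x ∈ Q.X) (hy : y ∈ Q.Y) (hy' : y' ∈ Q.Y)
    (lam : Vec p) : Q.lagr x y' lam - Q.lagr x y lam ≤
      inner ℝ (Q.lagrY x y lam) (y' - y) - μ / 2 * ‖y' - y‖ ^ 2 := by
  have h1 := h.conc x hx y hy y' hy'
  have h2 := Q.inner_resid_sub x x y y' lam
  simp only [sub_self, inner_zero_right, zero_add] at h2
  simp only [lagr, lagrY, inner_sub_left]
  linarith

theorem norm_lagrX_sub_le {x x' : Vec dx} {y y' : Vec dy} (hx : x ∈ Q.X) (hx' : x' ∈ Q.X)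
    (hy : y ∈ Q.Y) (hy' : y' ∈ Q.Y) (lam : Vec p) :
    ‖Q.lagrX x y lam - Q.lagrX x' y' lam‖ ≤ l * ‖x - x'‖ + l * ‖y - y'‖ := by
  simp only [lagrX, sub_sub_sub_cancel_right]
  exact h.sm.norm_gradient_sub_le (h.X_sub hx) (h.X_sub hx') (h.Y_sub hy) (h.Y_sub hy')

theorem norm_lagrY_sub_le {x x' : Vec dx} {y : Vec dy} (hx : x ∈ Q.X) (hx' : x' ∈ Q.X)
    (hy : y ∈ Q.Y) (lam lam' : Vec p) :
    ‖Q.lagrY x y lam - Q.lagrY x' y lam'‖ ≤ l * ‖x - x'‖ + ‖Q.B‖ * ‖lam - lam'‖ := by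
  have e : Q.lagrY x y lam - Q.lagrY x' y lam' =
      (gradient (fun y' => Q.g x y') y - gradient (fun y' => Q.g x' y') y)
        - Q.B.adjoint (lam - lam') := by
    simp only [lagrY, map_sub]
    abel
  rw [e]
  refine (norm_sub_le _ _).trans (add_le_add
    (h.sm.lip_yx _ (h.X_sub hx) _ (h.X_sub hx') _ (h.Y_sub hy)) ?_)
  refine (ContinuousLinearMap.le_opNorm _ _).trans_eq ?_
  rw [LinearIsometryEquiv.norm_map]

theorem continuousOn_g : ContinuousOn (fun q : Vec dx × Vec dy => Q.g q.1 q.2) (Q.X ×ˢ Q.Y) :=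
  h.sm.continuousOn.mono (Set.prod_mono h.X_sub h.Y_sub)

/-! ### The maximizer and the maximum over `Y` -/

theorem yStar_spec {x : Vec dx} (hx : x ∈ Q.X) (lam : Vec p) :
    Q.yStar x lam ∈ Q.Y ∧ ∀ y' ∈ Q.Y, Q.lagr x y' lam ≤ Q.lagr x (Q.yStar x lam) lam := by
  refine Classical.epsilon_spec
    (p := fun y => y ∈ Q.Y ∧ ∀ y' ∈ Q.Y, Q.lagr x y' lam ≤ Q.lagr x y lam) ?_
  have hc : ContinuousOn (fun y => Q.lagr x y lam) Q.Y := by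
    have h1 : ContinuousOn (fun y => Q.g x y) Q.Y :=
      h.continuousOn_g.comp (f := fun y => (x, y)) (by fun_prop) fun y hy => ⟨hx, hy⟩
    unfold lagr resid
    fun_prop
  obtain ⟨y, hy, hmax⟩ := Q.Y_compact.exists_isMaxOn Q.Y_nonempty hc
  exact ⟨y, hy, fun y' hy' => hmax hy'⟩

theorem yStar_mem {x : Vec dx} (hx : x ∈ Q.X) (lam : Vec p) : Q.yStar x lam ∈ Q.Y :=
  (h.yStar_spec hx lam).1

theorem Phi_eq {x : Vec dx} (hx : x ∈ Q.X) (lam : Vec p) :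
    Q.Phi x lam = Q.lagr x (Q.yStar x lam) lam := by
  obtain ⟨h1, h2⟩ := h.yStar_spec hx lam
  exact IsGreatest.csSup_eq ⟨⟨_, h1, rfl⟩, by rintro _ ⟨y, hy, rfl⟩; exact h2 y hy⟩

theorem lagr_le_Phi {x : Vec dx} (hx : x ∈ Q.X) {y : Vec dy} (hy : y ∈ Q.Y) (lam : Vec p) :
    Q.lagr x y lam ≤ Q.Phi x lam := by
  rw [h.Phi_eq hx]
  exact (h.yStar_spec hx lam).2 y hy

/-- First-order optimality: moving a fraction `t` from the maximizer towards `y` gains at least `t a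
- O(t²)`, which cannot be positive. Hence `a ≤ t C` for all small `t`. -/
theorem inner_lagrY_yStar_le {x : Vec dx} (hx : x ∈ Q.X) {y : Vec dy} (hy : y ∈ Q.Y)
    (lam : Vec p) : inner ℝ (Q.lagrY x (Q.yStar x lam) lam) (y - Q.yStar x lam) ≤ 0 := by
  obtain ⟨hs, hmax⟩ := h.yStar_spec hx lam
  set s := Q.yStar x lam
  by_contra! hpos
  set a := inner ℝ (Q.lagrY x s lam) (y - s)
  have key : ∀ t : ℝ, 0 < t → t ≤ 1 → a ≤ t * (l / 2 * ‖y - s‖ ^ 2) := by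
    intro t ht ht1
    have hm : s + t • (y - s) ∈ Q.Y := by
      have := Q.Y_convex hs hy (sub_nonneg.2 ht1) ht.le (by ring)
      convert this using 1
      module
    have h1 := h.le_lagr_sub_y hx hs hm lam
    have h2 := hmax _ hm
    rw [add_sub_cancel_left, inner_smul_right, norm_smul, Real.norm_of_nonneg ht.le] at h1
    have h3 : t * a ≤ t * (t * (l / 2 * ‖y - s‖ ^ 2)) := by
      change t * a - _ ≤ _ at h1
      nlinarith
    exact le_of_mul_le_mul_left h3 ht
  set C := l / 2 * ‖y - s‖ ^ 2
  have hC : 0 ≤ C := by have := h.l_pos; positivity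
  -- A fraction small enough that `t C < a`; the `+ 1` avoids a division by zero when `C = 0`.
  have h4 := key (min 1 (a / (2 * (C + 1)))) (by positivity) (min_le_left _ _)
  have h5 : min 1 (a / (2 * (C + 1))) * C ≤ a / (2 * (C + 1)) * C := by
    gcongr
    exact min_le_right _ _
  have h6 : a / (2 * (C + 1)) * C < a := by
    rw [div_mul_eq_mul_div, div_lt_iff₀ (by positivity)]
    nlinarith
  linarith

/-- Strong concavity in both directions between the two maximizers, together with the optimality of
each, bounds `μ ‖s - s'‖²` by the pairing of `s - s'` with a difference of two gradients at the same
point `s'`. That difference depends only on the change of `x` and `λ`. -/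
theorem norm_yStar_sub_le {x x' : Vec dx} (hx : x ∈ Q.X) (hx' : x' ∈ Q.X) (lam lam' : Vec p) :
    μ * ‖Q.yStar x lam - Q.yStar x' lam'‖ ≤ l * ‖x - x'‖ + ‖Q.B‖ * ‖lam - lam'‖ := by
  have hs := h.yStar_mem hx lam
  have hs' := h.yStar_mem hx' lam'
  have o1 := h.inner_lagrY_yStar_le hx hs' lam
  have o2 := h.inner_lagrY_yStar_le hx' hs lam'
  have c1 := h.lagr_sub_le_y hx hs hs' lam
  have c2 := h.lagr_sub_le_y hx hs' hs lam
  have b := h.norm_lagrY_sub_le hx hx' hs' lam lam'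
  set s := Q.yStar x lam
  set s' := Q.yStar x' lam'
  have h1 : μ * ‖s - s'‖ ^ 2 ≤ inner ℝ (Q.lagrY x s' lam - Q.lagrY x' s' lam') (s - s') := by
    rw [inner_sub_left]
    rw [norm_sub_rev s' s] at c1
    linarith
  have h2 := h1.trans ((real_inner_le_norm _ _).trans
    (mul_le_mul_of_nonneg_right b (norm_nonneg _)))
  rcases (norm_nonneg (s - s')).eq_or_lt with h0 | h0
  · rw [← h0, mul_zero]
    have := h.l_pos
    positivity
  · refine le_of_mul_le_mul_right ?_ h0
    linarith

/-- The change of the maximum splits into a move in `x` at the new maximizer and a move from the old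
to the new maximizer at the old `x`. The first produces the cross term `l ‖s' - s‖ ‖x' - x‖`; the
second contributes `-μ/2 ‖s' - s‖²`, which absorbs it. Neither differentiability of `Φ` nor the
Lipschitz bound for the maximizer is used. -/
theorem Phi_sub_le_x {x x' : Vec dx} (hx : x ∈ Q.X) (hx' : x' ∈ Q.X) (lam : Vec p) :
    Q.Phi x' lam - Q.Phi x lam ≤ inner ℝ (Q.lagrX x (Q.yStar x lam) lam) (x' - x)
      + (l / 2 + l ^ 2 / (2 * μ)) * ‖x' - x‖ ^ 2 := by
  have hs := h.yStar_mem hx lam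
  have hs' := h.yStar_mem hx' lam
  have hμ := h.μ_pos
  rw [h.Phi_eq hx, h.Phi_eq hx']
  have h1 := h.lagr_sub_le_x hx hx' hs' lam
  have h2 := h.lagr_sub_le_y hx hs hs' lam
  have h3 := h.inner_lagrY_yStar_le hx hs' lam
  have h4 := h.norm_lagrX_sub_le hx hx hs' hs lam
  set s := Q.yStar x lam
  set s' := Q.yStar x' lam
  rw [sub_self, norm_zero, mul_zero, zero_add] at h4
  have h5 : inner ℝ (Q.lagrX x s' lam) (x' - x) ≤ inner ℝ (Q.lagrX x s lam) (x' - x)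
      + l * ‖s' - s‖ * ‖x' - x‖ := by
    have := (real_inner_le_norm (Q.lagrX x s' lam - Q.lagrX x s lam) (x' - x)).trans
      (mul_le_mul_of_nonneg_right h4 (norm_nonneg _))
    rw [inner_sub_left] at this
    linarith
  have h6 : l * ‖s' - s‖ * ‖x' - x‖ ≤ μ / 2 * ‖s' - s‖ ^ 2
      + l ^ 2 / (2 * μ) * ‖x' - x‖ ^ 2 := by
    have : μ / 2 * ‖s' - s‖ ^ 2 + l ^ 2 / (2 * μ) * ‖x' - x‖ ^ 2 - l * ‖s' - s‖ * ‖x' - x‖ =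
        (μ * ‖s' - s‖ - l * ‖x' - x‖) ^ 2 / (2 * μ) := by
      field_simp
      ring
    have h7 : 0 ≤ (μ * ‖s' - s‖ - l * ‖x' - x‖) ^ 2 / (2 * μ) := by positivity
    linarith
  linarith

/-- Convexity of `Φ(x, ·)` with the subgradient taken at the new multiplier: no second-order term
appears, but the maximizer belongs to `lam'`. -/
theorem Phi_sub_le_lam {x : Vec dx} (hx : x ∈ Q.X) (lam lam' : Vec p) :
    Q.Phi x lam' - Q.Phi x lam ≤ -inner ℝ (lam' - lam) (Q.resid x (Q.yStar x lam')) := by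
  have h1 := h.lagr_le_Phi hx (h.yStar_mem hx lam') lam
  rw [h.Phi_eq hx lam']
  simp only [lagr, inner_sub_left] at h1 ⊢
  linarith

/-- One relaxed projected ascent step in `y` contracts the distance to the maximizer. -/
theorem norm_ascent_step_le {x : Vec dx} (hx : x ∈ Q.X) {y : Vec dy} (hy : y ∈ Q.Y) (lam : Vec p)
    (w : Vec dy) {β η : ℝ} (hβ : 0 < β) (hβL : β ≤ 1 / (6 * Q.lip l)) (hη : 0 ≤ η) (hη1 : η ≤ 1) :
    ‖y + η • (proj Q.Y (y + β • w) - y) - Q.yStar x lam‖ ^ 2 ≤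
      (1 - η * μ * β / 2) * ‖y - Q.yStar x lam‖ ^ 2
      - 3 * η / 4 * ‖proj Q.Y (y + β • w) - y‖ ^ 2
      + 4 * η * β / μ * ‖Q.lagrY x y lam - w‖ ^ 2 := by
  have hs := h.yStar_mem hx lam
  have hμ := h.μ_pos
  have hl := h.l_pos
  have hL : 0 < Q.lip l := hl.trans_le (Q.l_le l)
  have hYc := Q.Y_compact.isClosed
  have ht := (proj_spec Q.Y_nonempty hYc (y + β • w)).1
  have hp := inner_proj_le Q.Y_nonempty hYc Q.Y_convex (y + β • w) hs
  have hmax := (h.yStar_spec hx lam).2 _ ht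
  have c1 := h.lagr_sub_le_y hx hy hs lam
  have c2 := h.le_lagr_sub_y hx hy ht lam
  set s := Q.yStar x lam
  set t := proj Q.Y (y + β • w)
  set G := Q.lagrY x y lam
  have hβL' : β * Q.lip l ≤ 1 / 6 := by
    rw [le_div_iff₀ (by positivity)] at hβL
    linarith
  have hβl : β * l ≤ 1 / 6 := le_trans (by gcongr; exact (Q.l_le l)) hβL'
  have hβμ : β * μ ≤ 1 / 6 := le_trans (by gcongr; exact h.μ_le) hβL'
  have e0 : y + η • (t - y) - s = (y - s) + η • (t - y) := by abel
  rw [e0, norm_add_sq_real, inner_smul_right, norm_smul, Real.norm_of_nonneg hη]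
  -- all vectors in terms of `a = t - y`, `d = s - y`
  have e1 : y + β • w - t = β • w - (t - y) := by abel
  have e2 : s - t = (s - y) - (t - y) := by abel
  have e3 : y - s = -(s - y) := by abel
  rw [e1, e2] at hp
  rw [e3, norm_neg, inner_neg_left]
  set a := t - y
  set d := s - y
  simp only [inner_sub_left, inner_sub_right, inner_smul_left, conj_trivial,
    real_inner_self_eq_norm_sq] at hp
  have y1 : 2 * inner ℝ (G - w) d ≤ μ / 2 * ‖d‖ ^ 2 + 2 / μ * ‖G - w‖ ^ 2 := by
    have h1 := real_inner_le_norm (G - w) d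
    have h2 : μ / 2 * ‖d‖ ^ 2 + 2 / μ * ‖G - w‖ ^ 2 - 2 * (‖G - w‖ * ‖d‖) =
      (μ * ‖d‖ - 2 * ‖G - w‖) ^ 2 / (2 * μ) := by field_simp; ring
    have h3 : 0 ≤ (μ * ‖d‖ - 2 * ‖G - w‖) ^ 2 / (2 * μ) := by positivity
    linarith
  have y2 : -(2 * inner ℝ (G - w) a) ≤ μ / 2 * ‖a‖ ^ 2 + 2 / μ * ‖G - w‖ ^ 2 := by
    have h1 := (abs_le.1 (abs_real_inner_le_norm (G - w) a)).1
    have h2 : μ / 2 * ‖a‖ ^ 2 + 2 / μ * ‖G - w‖ ^ 2 - 2 * (‖G - w‖ * ‖a‖) =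
      (μ * ‖a‖ - 2 * ‖G - w‖) ^ 2 / (2 * μ) := by field_simp; ring
    have h3 : 0 ≤ (μ * ‖a‖ - 2 * ‖G - w‖) ^ 2 / (2 * μ) := by positivity
    linarith
  simp only [inner_sub_left] at y1 y2
  rw [real_inner_comm a d]
  have key : -(2 * inner ℝ a d) ≤ -(β * μ / 2) * ‖d‖ ^ 2 - (2 - β * l - β * μ / 2) * ‖a‖ ^ 2
      + 4 * β / μ * ‖G - w‖ ^ 2 := by
    -- Strong concavity towards the maximizer, smoothness towards the projected point, and the fact
    -- that the Lagrangian is larger at the maximizer; the function values cancel.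
    have h1 : 0 ≤ inner ℝ G d - inner ℝ G a - μ / 2 * ‖d‖ ^ 2 + l / 2 * ‖a‖ ^ 2 := by linarith
    have h2 := mul_nonneg hβ.le h1
    have h3 := mul_le_mul_of_nonneg_left (add_le_add y1 y2) hβ.le
    have e4 : 4 * β / μ * ‖G - w‖ ^ 2 = β * (2 / μ * ‖G - w‖ ^ 2 + 2 / μ * ‖G - w‖ ^ 2) := by
      ring
    rw [e4]
    linarith
  have h4 := mul_le_mul_of_nonneg_left key hη
  -- The coefficient of `‖a‖²` becomes at most `-η (2 - 1/4) + η = -3η/4`: the expanded square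
  -- contributes `η² ≤ η`, and `β l + β μ / 2 ≤ 1/4`.
  have h5 : η ^ 2 * ‖a‖ ^ 2 ≤ η * ‖a‖ ^ 2 := by
    gcongr
    nlinarith
  have h6 : η * ‖a‖ ^ 2 * (β * l + β * μ / 2) ≤ η * ‖a‖ ^ 2 * (1 / 4) := by
    gcongr
    linarith
  have e5 : 4 * η * β / μ * ‖G - w‖ ^ 2 = η * (4 * β / μ * ‖G - w‖ ^ 2) := by ring
  rw [e5, mul_pow]
  linarith

end Regular

end Problem


/-! ### Elementary quadratic inequalities -/

theorem inner_le_young {n : ℕ} (u a : Vec n) {c : ℝ} (hc : 0 < c) :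
    inner ℝ u a ≤ c * ‖u‖ ^ 2 + 1 / (4 * c) * ‖a‖ ^ 2 := by
  have h1 := real_inner_le_norm u a
  have h2 : c * ‖u‖ ^ 2 + 1 / (4 * c) * ‖a‖ ^ 2 - ‖u‖ * ‖a‖ =
      (2 * c * ‖u‖ - ‖a‖) ^ 2 / (4 * c) := by
    field_simp
    ring
  have h3 : 0 ≤ (2 * c * ‖u‖ - ‖a‖) ^ 2 / (4 * c) := by positivity
  linarith

theorem add_sq_le_young {a b t : ℝ} (ht : 0 < t) :
    (a + b) ^ 2 ≤ (1 + t) * a ^ 2 + (1 + 1 / t) * b ^ 2 := by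
  have h2 : (1 + t) * a ^ 2 + (1 + 1 / t) * b ^ 2 - (a + b) ^ 2 = (t * a - b) ^ 2 / t := by
    field_simp
    ring
  have h3 : 0 ≤ (t * a - b) ^ 2 / t := by positivity
  linarith

theorem add_three_sq_le (a b c : ℝ) : (a + b + c) ^ 2 ≤ 3 * (a ^ 2 + b ^ 2 + c ^ 2) := by
  nlinarith [sq_nonneg (a - b), sq_nonneg (b - c), sq_nonneg (a - c)]

namespace Problem

variable {dx dy p : ℕ} {Ξ : Type*} [MeasurableSpace Ξ] {Q : Problem dx dy p Ξ}
  {U : Set (Vec dx)} {V : Set (Vec dy)} {l μ : ℝ}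

/-! ### The multiplier set and the one-step decrease -/

theorem mult_nonempty (Q : Problem dx dy p Ξ) : Q.mult.Nonempty := by
  refine ⟨0, ?_⟩
  unfold mult
  split <;> simp

theorem mult_convex (Q : Problem dx dy p Ξ) : Convex ℝ Q.mult := by
  unfold mult
  split
  · intro a ha b hb s t hs ht _ i
    have h1 := mul_nonneg hs (ha i)
    have h2 := mul_nonneg ht (hb i)
    simpa using add_nonneg h1 h2
  · exact convex_univ

theorem mult_isClosed (Q : Problem dx dy p Ξ) : IsClosed Q.mult := by
  unfold mult
  split
  · have : {lam : Vec p | ∀ i, 0 ≤ lam i} = ⋂ i, {lam : Vec p | 0 ≤ lam i} := by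
      ext
      simp
    rw [this]
    exact isClosed_iInter fun i => isClosed_le continuous_const (by fun_prop)
  · exact isClosed_univ

theorem add_smul_proj_mem {n : ℕ} {Z : Set (Vec n)} (hne : Z.Nonempty) (hcl : IsClosed Z)
    (hco : Convex ℝ Z) {x : Vec n} (hx : x ∈ Z) (u : Vec n) {η : ℝ} (hη : 0 ≤ η) (hη1 : η ≤ 1) :
    x + η • (proj Z u - x) ∈ Z :=
  hco.add_smul_sub_mem hx (proj_spec hne hcl u).1 ⟨hη, hη1⟩

namespace Regular

variable (h : Q.Regular U V l μ)
include h

/-- Decrease of `Φ(·, λ)` along one relaxed projected descent step in `x`. -/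
theorem Phi_step_x {x : Vec dx} (hx : x ∈ Q.X) {y : Vec dy} (hy : y ∈ Q.Y) (lam : Vec p)
    (v q : Vec dx) {α η s : ℝ} (hα : 0 < α) (hη : 0 ≤ η) (hη1 : η ≤ 1)
    (hs : ‖Q.lagrX x y lam - q‖ ≤ s) :
    Q.Phi (x + η • (proj Q.X (x - α • v) - x)) lam - Q.Phi x lam ≤
      η * (-(3 / (4 * α)) * ‖proj Q.X (x - α • v) - x‖ ^ 2
        + 4 * α * Q.lip l ^ 2 * ‖y - Q.yStar x lam‖ ^ 2 + 2 * α * ‖q - v‖ ^ 2 + 4 * α * s ^ 2)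
      + η ^ 2 * (Q.lip l ^ 2 / μ) * ‖proj Q.X (x - α • v) - x‖ ^ 2 := by
  have hμ := h.μ_pos
  have hl := h.l_pos
  have hlL := Q.l_le l
  have hXc := Q.X_compact.isClosed
  have hx' := add_smul_proj_mem Q.X_nonempty hXc Q.X_convex hx (x - α • v) hη hη1
  have h1 := h.Phi_sub_le_x hx hx' lam
  have hp := inner_proj_le Q.X_nonempty hXc Q.X_convex (x - α • v) hx
  have hd := h.norm_lagrX_sub_le hx hx (h.yStar_mem hx lam) hy lam
  rw [sub_self, norm_zero, mul_zero, zero_add, norm_sub_rev _ y] at hd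
  set t := proj Q.X (x - α • v)
  rw [add_sub_cancel_left, inner_smul_right, norm_smul, Real.norm_of_nonneg hη] at h1
  have e1 : x - α • v - t = -(t - x) - α • v := by abel
  have e2 : x - t = -(t - x) := by abel
  rw [e1, e2] at hp
  set a := t - x
  set ys := Q.yStar x lam
  simp only [inner_sub_left, inner_neg_right, inner_neg_left, inner_smul_left, conj_trivial,
    real_inner_self_eq_norm_sq] at hp
  have hv : inner ℝ v a ≤ -(1 / α) * ‖a‖ ^ 2 := by
    rw [neg_mul, div_mul_eq_mul_div, one_mul, le_neg, div_le_iff₀ hα]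
    linarith
  -- The projection yields `-1/α ‖a‖²`. The Young weights `4α`, `4α`, `2α` for the tracking,
  -- smoothing and estimator errors give back `1/16 + 1/16 + 1/8 = 1/4` of it, so `3/4` remains.
  have y1 := inner_le_young (Q.lagrX x ys lam - Q.lagrX x y lam) a (c := 4 * α) (by positivity)
  have y2 := inner_le_young (Q.lagrX x y lam - q) a (c := 4 * α) (by positivity)
  have y3 := inner_le_young (q - v) a (c := 2 * α) (by positivity)
  have hd2 : ‖Q.lagrX x ys lam - Q.lagrX x y lam‖ ^ 2 ≤ Q.lip l ^ 2 * ‖y - ys‖ ^ 2 := by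
    rw [← mul_pow]
    gcongr
    exact hd.trans (by gcongr)
  have hs2 : ‖Q.lagrX x y lam - q‖ ^ 2 ≤ s ^ 2 := by gcongr
  have e3 : inner ℝ (Q.lagrX x ys lam) a = inner ℝ (Q.lagrX x ys lam - Q.lagrX x y lam) a
      + inner ℝ (Q.lagrX x y lam - q) a + inner ℝ (q - v) a + inner ℝ v a := by
    simp only [inner_sub_left]
    ring
  have key : inner ℝ (Q.lagrX x ys lam) a ≤ -(3 / (4 * α)) * ‖a‖ ^ 2
      + 4 * α * Q.lip l ^ 2 * ‖y - ys‖ ^ 2 + 2 * α * ‖q - v‖ ^ 2 + 4 * α * s ^ 2 := by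
    have h2 := mul_le_mul_of_nonneg_left hd2 (by positivity : 0 ≤ 4 * α)
    have h3 := mul_le_mul_of_nonneg_left hs2 (by positivity : 0 ≤ 4 * α)
    have e4 : -(1 / α) * ‖a‖ ^ 2 + 1 / (4 * (2 * α)) * ‖a‖ ^ 2 + 1 / (4 * (4 * α)) * ‖a‖ ^ 2
        + 1 / (4 * (4 * α)) * ‖a‖ ^ 2 = -(3 / (4 * α)) * ‖a‖ ^ 2 := by
      field_simp
      ring
    linarith
  -- The curvature of `Φ(·, λ)` is at most twice `L² / μ`; the first summand needs `μ ≤ L`.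
  have hC : l / 2 + l ^ 2 / (2 * μ) ≤ Q.lip l ^ 2 / μ := by
    have h2 : l / 2 ≤ Q.lip l ^ 2 / (2 * μ) := by
      rw [div_le_div_iff₀ two_pos (by positivity)]
      nlinarith [h.μ_le]
    have h3 : l ^ 2 / (2 * μ) ≤ Q.lip l ^ 2 / (2 * μ) := by gcongr
    have e5 : Q.lip l ^ 2 / μ = Q.lip l ^ 2 / (2 * μ) + Q.lip l ^ 2 / (2 * μ) := by
      field_simp
      ring
    linarith
  have h4 := mul_le_mul_of_nonneg_left key hη
  have h5 : (l / 2 + l ^ 2 / (2 * μ)) * (η * ‖a‖) ^ 2 ≤ Q.lip l ^ 2 / μ * (η * ‖a‖) ^ 2 := by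
    gcongr
  have e6 : η ^ 2 * (Q.lip l ^ 2 / μ) * ‖a‖ ^ 2 = Q.lip l ^ 2 / μ * (η * ‖a‖) ^ 2 := by ring
  linarith

/-- Decrease of `Φ(x, ·)` along one relaxed projected descent step in `λ`. -/
theorem Phi_step_lam {x : Vec dx} (hx : x ∈ Q.X) (y : Vec dy) {lam : Vec p}
    (hlam : lam ∈ Q.mult) {γ η : ℝ} (hγ : 0 < γ) (hη : 0 ≤ η) {lam' : Vec p}
    (hlam' : lam' = lam + η • (proj Q.mult (lam + γ • Q.resid x y) - lam)) :
    Q.Phi x lam' - Q.Phi x lam ≤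
      η * (-(3 / (4 * γ)) * ‖proj Q.mult (lam + γ • Q.resid x y) - lam‖ ^ 2
        + γ * ‖Q.B‖ ^ 2 * ‖y - Q.yStar x lam'‖ ^ 2) := by
  have h1 := h.Phi_sub_le_lam hx lam lam'
  have hp := inner_proj_le Q.mult_nonempty Q.mult_isClosed Q.mult_convex
    (lam + γ • Q.resid x y) hlam
  set ys := Q.yStar x lam'
  set t := proj Q.mult (lam + γ • Q.resid x y)
  have e0 : lam' - lam = η • (t - lam) := by rw [hlam', add_sub_cancel_left]
  rw [e0, inner_smul_left, conj_trivial] at h1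
  have e1 : lam + γ • Q.resid x y - t = -(t - lam) + γ • Q.resid x y := by abel
  have e2 : lam - t = -(t - lam) := by abel
  rw [e1, e2] at hp
  set a := t - lam
  simp only [inner_add_left, inner_neg_right, inner_neg_left, inner_smul_left, conj_trivial,
    real_inner_self_eq_norm_sq] at hp
  have hv : -inner ℝ (Q.resid x y) a ≤ -(1 / γ) * ‖a‖ ^ 2 := by
    rw [neg_mul, neg_le_neg_iff, div_mul_eq_mul_div, one_mul, div_le_iff₀ hγ]
    linarith
  have y1 := inner_le_young (Q.B (y - ys)) a (c := γ) hγ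
  have hB : ‖Q.B (y - ys)‖ ^ 2 ≤ ‖Q.B‖ ^ 2 * ‖y - ys‖ ^ 2 := by
    rw [← mul_pow]
    gcongr
    exact Q.B.le_opNorm _
  -- The step follows the residual at `y`, convexity asks for the one at the maximizer of `lam'`.
  -- They differ by `B (y - ys)`, and Young spends a quarter of `1/γ ‖a‖²` on the difference.
  have e3 : Q.resid x ys = Q.resid x y - Q.B (y - ys) := by
    simp only [resid, map_sub]
    abel
  have key : -inner ℝ a (Q.resid x ys) ≤ -(3 / (4 * γ)) * ‖a‖ ^ 2
      + γ * ‖Q.B‖ ^ 2 * ‖y - ys‖ ^ 2 := by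
    have h2 := mul_le_mul_of_nonneg_left hB hγ.le
    have e4 : -(1 / γ) * ‖a‖ ^ 2 + 1 / (4 * γ) * ‖a‖ ^ 2 = -(3 / (4 * γ)) * ‖a‖ ^ 2 := by
      field_simp
      ring
    rw [e3, inner_sub_right, real_inner_comm, real_inner_comm _ a]
    linarith
  have h4 := mul_le_mul_of_nonneg_left key hη
  linarith

theorem norm_yStar_sub_sq_le {x x' : Vec dx} (hx : x ∈ Q.X) (hx' : x' ∈ Q.X) (lam lam' : Vec p) :
    ‖Q.yStar x lam - Q.yStar x' lam'‖ ^ 2 ≤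
      2 * Q.lip l ^ 2 / μ ^ 2 * (‖x - x'‖ ^ 2 + ‖lam - lam'‖ ^ 2) := by
  have hμ := h.μ_pos
  have hl := h.l_pos
  have h1 := h.norm_yStar_sub_le hx hx' lam lam'
  have h2 : l * ‖x - x'‖ + ‖Q.B‖ * ‖lam - lam'‖ ≤ Q.lip l * (‖x - x'‖ + ‖lam - lam'‖) := by
    rw [mul_add]
    gcongr
    exacts [Q.l_le l, Q.norm_B_le l]
  have h3 : (μ * ‖Q.yStar x lam - Q.yStar x' lam'‖) ^ 2 ≤
      (Q.lip l * (‖x - x'‖ + ‖lam - lam'‖)) ^ 2 := by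
    have hL : 0 ≤ Q.lip l := hl.le.trans (Q.l_le l)
    exact pow_le_pow_left₀ (by positivity) (h1.trans h2) 2
  have h4 := sq_nonneg (Q.lip l * (‖x - x'‖ - ‖lam - lam'‖))
  rw [div_mul_eq_mul_div, le_div_iff₀ (by positivity)]
  nlinarith

end Regular

/-- The combination of the one-step estimates, with the parameters restricted as in the
algorithm. -/
theorem descent_combination {α β γ μ L η b X2 Y2 L2 d2 d2' T W E : ℝ}
    (hα : 0 < α) (hβ : 0 < β) (hγ : 0 < γ) (hμ : 0 < μ) (hL : 0 < L) (hη : 0 < η) (hη1 : η ≤ 1)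
    (hημ : η ≤ μ / (8 * α * L ^ 2)) (hβμ : β * μ ≤ 1 / 6) (hα' : α ≤ μ ^ 2 * β / (64 * L ^ 2))
    (hγ' : γ ≤ μ ^ 4 * β ^ 2 / (1280 * L ^ 4 * α)) (hb : b ≤ 2 * α * L ^ 2)
    (hX : 0 ≤ X2) (hY : 0 ≤ Y2) (hΛ : 0 ≤ L2) (hd : 0 ≤ d2) (hd' : 0 ≤ d2') (hE : 0 ≤ E)
    (hW : W ≤ 2 * E)
    (hT : T ≤ (1 - η * μ * β / 2) * d2 - 3 * η / 4 * Y2 + 4 * η * β / μ * W)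
    (hd2' : d2' ≤ (1 + η * μ * β / 4) * T +
      (1 + 1 / (η * μ * β / 4)) * (2 * L ^ 2 / μ ^ 2 * (η ^ 2 * (X2 + L2)))) :
    η * (-(3 / (4 * α)) * X2 + 4 * α * L ^ 2 * d2) + η ^ 2 * (L ^ 2 / μ) * X2
      + η * (-(3 / (4 * γ)) * L2 + b * d2')
      + (32 * α * L ^ 2 / (β * μ) - 4 * η * α * L ^ 2) * d2' ≤
    (32 * α * L ^ 2 / (β * μ) - 4 * η * α * L ^ 2) * d2
      - η * (1 / (2 * α) * X2 + 24 * α * L ^ 2 / (μ * β) * Y2 + 1 / (4 * γ) * L2)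
      + η * (320 * α * L ^ 2 / μ ^ 2 * E) := by
  -- Half of the contraction rate `2u`, and the Young parameter for the drift of the maximizer: `(1
  -- + u)(1 - 2u) ≤ 1 - u` keeps the other half.
  set u := η * μ * β / 4 with hu
  have hu0 : 0 < u := by positivity
  have hu1 : u ≤ 1 / 24 := by
    have : η * (β * μ) ≤ 1 * (1 / 6) := by gcongr
    rw [hu]
    linarith
  -- This weight gives `N u = 8 η α L²`. One half of that pays for the tracking error `4 α L² d2` of
  -- the `x`-step; the other half restores the correction `-4 η α L² d2` on the right.
  set N := 32 * α * L ^ 2 / (β * μ) with hN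
  have hN0 : 0 < N := by positivity
  -- the estimate of `T`, multiplied by `N (1 + u)`
  have t1 : N * ((1 + u) * T) ≤ N * d2 - 8 * η * α * L ^ 2 * d2
      - η * (24 * α * L ^ 2 / (μ * β)) * Y2 + η * (320 * α * L ^ 2 / μ ^ 2 * E) := by
    have h1 : (1 + u) * T ≤ (1 - u) * d2 - 3 * η / 4 * Y2 + 25 / 24 * (8 * η * β / μ * E) := by
      have h2 : (1 + u) * T ≤ (1 + u) * ((1 - 2 * u) * d2 - 3 * η / 4 * Y2 +
          4 * η * β / μ * W) := by
        have e : η * μ * β / 2 = 2 * u := by rw [hu]; ring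
        rw [e] at hT
        gcongr
      have h3 : 4 * η * β / μ * W ≤ 8 * η * β / μ * E := by
        have : 4 * η * β / μ * W ≤ 4 * η * β / μ * (2 * E) := by gcongr
        linarith [(by ring : 4 * η * β / μ * (2 * E) = 8 * η * β / μ * E)]
      have h4 : (1 + u) * (8 * η * β / μ * E) ≤ 25 / 24 * (8 * η * β / μ * E) := by
        gcongr
        linarith
      have h5 : (1 + u) * (4 * η * β / μ * W) ≤ (1 + u) * (8 * η * β / μ * E) := by gcongr
      have h6 : 0 ≤ u * (3 * η / 4 * Y2) := by positivity
      have h7 : 0 ≤ u ^ 2 * d2 := by positivity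
      nlinarith
    have h2 := mul_le_mul_of_nonneg_left h1 hN0.le
    have e1 : N * ((1 - u) * d2) = N * d2 - 8 * η * α * L ^ 2 * d2 := by
      rw [hN, hu]
      field_simp
      ring
    have e2 : N * (3 * η / 4 * Y2) = η * (24 * α * L ^ 2 / (μ * β)) * Y2 := by
      rw [hN]
      field_simp
      ring
    have e3 : N * (25 / 24 * (8 * η * β / μ * E)) =
        5 / 6 * (η * (320 * α * L ^ 2 / μ ^ 2 * E)) := by
      rw [hN]
      field_simp
      ring
    have h3 : 0 ≤ η * (320 * α * L ^ 2 / μ ^ 2 * E) := by positivity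
    linarith
  -- the displacement of the maximizer
  set R := 256 * α * L ^ 4 / (β ^ 2 * μ ^ 4) with hR
  have hR0 : 0 < R := by positivity
  -- `η R` is the drift coefficient `N · (1/u) · (2 L²/μ²) · η²`. The bound on `α`, squared, makes
  -- it small against `1/α`; the bound with `1280` makes it small against `1/γ`.
  have hRα : R ≤ 1 / (16 * α) := by
    rw [le_div_iff₀ (by positivity)] at hα'
    rw [hR, div_le_div_iff₀ (by positivity) (by positivity)]
    have h1 : (α * (64 * L ^ 2)) ^ 2 ≤ (μ ^ 2 * β) ^ 2 := by gcongr
    linarith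
  have hRγ : R ≤ 1 / (5 * γ) := by
    rw [le_div_iff₀ (by positivity)] at hγ'
    rw [hR, div_le_div_iff₀ (by positivity) (by positivity)]
    linarith
  have t2 : N * ((1 + 1 / u) * (2 * L ^ 2 / μ ^ 2 * (η ^ 2 * (X2 + L2)))) ≤
      25 / 24 * (η * (R * (X2 + L2))) := by
    have e1 : N * (1 / u * (2 * L ^ 2 / μ ^ 2 * (η ^ 2 * (X2 + L2)))) = η * (R * (X2 + L2)) := by
      rw [hN, hu, hR]
      field_simp
      ring
    have h1 : 1 + 1 / u ≤ 25 / 24 * (1 / u) := by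
      have : 1 ≤ 1 / 24 * (1 / u) := by
        rw [div_mul_div_comm, le_div_iff₀ (by positivity)]
        linarith
      linarith
    rw [← e1]
    have h2 : (1 + 1 / u) * (2 * L ^ 2 / μ ^ 2 * (η ^ 2 * (X2 + L2))) ≤
        25 / 24 * (1 / u) * (2 * L ^ 2 / μ ^ 2 * (η ^ 2 * (X2 + L2))) := by gcongr
    have h3 := mul_le_mul_of_nonneg_left h2 hN0.le
    linarith
  have t3 : η * (R * X2) ≤ η * (1 / (16 * α) * X2) := by gcongr
  have t4 : η * (R * L2) ≤ η * (1 / (5 * γ) * L2) := by gcongr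
  have t5 : η ^ 2 * (L ^ 2 / μ) * X2 ≤ η * (1 / (8 * α) * X2) := by
    have h1 : η * (L ^ 2 / μ) ≤ 1 / (8 * α) := by
      calc η * (L ^ 2 / μ) ≤ μ / (8 * α * L ^ 2) * (L ^ 2 / μ) := by gcongr
        _ = 1 / (8 * α) := by field_simp
    have h2 : η * (L ^ 2 / μ) * X2 ≤ 1 / (8 * α) * X2 := by gcongr
    have h3 := mul_le_mul_of_nonneg_left h2 hη.le
    linarith [(by ring : η ^ 2 * (L ^ 2 / μ) * X2 = η * (η * (L ^ 2 / μ) * X2))]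
  -- The tracking error at the new point, caused by the multiplier step, is cancelled by the
  -- correction `-4 η α L² d2'` on the left-hand side.
  have t6 : η * (b * d2') ≤ 4 * η * α * L ^ 2 * d2' := by
    have h1 : b * d2' ≤ 2 * α * L ^ 2 * d2' := by gcongr
    have h2 := mul_le_mul_of_nonneg_left h1 hη.le
    have h3 : 0 ≤ 2 * η * α * L ^ 2 * d2' := by positivity
    linarith
  have t7 := mul_le_mul_of_nonneg_left hd2' hN0.le
  have eα : ∀ r : ℝ, r / α = r * (1 / α) := fun r => by ring
  have e1 : 1 / (16 * α) = 1 / 16 * (1 / α) := by ring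
  have e2 : 1 / (8 * α) = 1 / 8 * (1 / α) := by ring
  have e3 : 3 / (4 * α) = 3 / 4 * (1 / α) := by ring
  have e4 : 1 / (2 * α) = 1 / 2 * (1 / α) := by ring
  have e5 : 3 / (4 * γ) = 3 / 4 * (1 / γ) := by ring
  have e6 : 1 / (4 * γ) = 1 / 4 * (1 / γ) := by ring
  have e7 : 1 / (5 * γ) = 1 / 5 * (1 / γ) := by ring
  rw [e1] at t3
  rw [e7] at t4
  rw [e2] at t5
  rw [e3, e4, e5, e6]
  -- In units of `η/α` and `η/γ`, the coefficient of `X2` is `-3/4 + 1/8 + 25/24 · 1/16 ≤ -1/2` and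
  -- that of `L2` is `-3/4 + 25/24 · 1/5 ≤ -1/4`.
  have p1 : 0 ≤ η * (1 / α) * X2 := by positivity
  have p2 : 0 ≤ η * (1 / γ) * L2 := by positivity
  linarith

namespace Regular

/-- One-step decrease of the deterministic part of the potential. -/
theorem descent (h : Q.Regular U V l μ) {c : Params} (hc : c.Admissible Q l μ)
    {x x' : Vec dx} {y y' : Vec dy} {lam lam' : Vec p} (hx : x ∈ Q.X) (hy : y ∈ Q.Y)
    (hlam : lam ∈ Q.mult) {v q : Vec dx} {w r : Vec dy} {η s₁ s₂ : ℝ} (hη : 0 < η) (hη1 : η ≤ 1)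
    (hημ : η ≤ μ / (8 * c.α * Q.lip l ^ 2))
    (hs₁ : ‖Q.lagrX x y lam - q‖ ≤ s₁) (hs₂ : ‖Q.lagrY x y lam - r‖ ≤ s₂)
    (ex : x' = x + η • (proj Q.X (x - c.α • v) - x))
    (ey : y' = y + η • (proj Q.Y (y + c.β • w) - y))
    (el : lam' = lam + η • (proj Q.mult (lam + c.γ • Q.resid x' y') - lam)) :
    Q.Phi x' lam' + (32 * c.α * Q.lip l ^ 2 / (c.β * μ) - 4 * η * c.α * Q.lip l ^ 2)
        * ‖y' - Q.yStar x' lam'‖ ^ 2 ≤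
      Q.Phi x lam + (32 * c.α * Q.lip l ^ 2 / (c.β * μ) - 4 * η * c.α * Q.lip l ^ 2)
        * ‖y - Q.yStar x lam‖ ^ 2
      - η * (1 / (2 * c.α) * ‖proj Q.X (x - c.α • v) - x‖ ^ 2
        + 24 * c.α * Q.lip l ^ 2 / (μ * c.β) * ‖proj Q.Y (y + c.β • w) - y‖ ^ 2
        + 1 / (4 * c.γ) * ‖proj Q.mult (lam + c.γ • Q.resid x' y') - lam‖ ^ 2)
      + η * (2 * c.α * ‖q - v‖ ^ 2 + 4 * c.α * s₁ ^ 2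
        + 320 * c.α * Q.lip l ^ 2 / μ ^ 2 * (‖r - w‖ ^ 2 + s₂ ^ 2)) := by
  have hμ := h.μ_pos
  have hL : 0 < Q.lip l := h.l_pos.trans_le (Q.l_le l)
  have hα := hc.α_pos
  have hβ := hc.β_pos
  have hγ := hc.γ_pos
  have hx' : x' ∈ Q.X := by
    rw [ex]
    exact add_smul_proj_mem Q.X_nonempty Q.X_compact.isClosed Q.X_convex hx _ hη.le hη1
  have p1 := h.Phi_step_x hx hy lam v q hα hη.le hη1 hs₁
  rw [← ex] at p1
  have p2 := h.Phi_step_lam hx' y' hlam hγ hη.le el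
  have p3 := h.norm_ascent_step_le hx hy lam w hβ hc.β_le hη.le hη1
  rw [← ey] at p3
  have hβμ : c.β * μ ≤ 1 / 6 := by
    have := hc.β_le
    rw [le_div_iff₀ (by positivity)] at this
    nlinarith [h.μ_le]
  have p4 := h.norm_yStar_sub_sq_le hx' hx lam' lam
  have exx : x' - x = η • (proj Q.X (x - c.α • v) - x) := by rw [ex, add_sub_cancel_left]
  have ell : lam' - lam = η • (proj Q.mult (lam + c.γ • Q.resid x' y') - lam) := by
    rw [sub_eq_iff_eq_add', ← el]
  rw [exx, ell, norm_smul, norm_smul, Real.norm_of_nonneg hη.le, mul_pow, mul_pow,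
    ← mul_add] at p4
  set X2 := ‖proj Q.X (x - c.α • v) - x‖ ^ 2
  set Y2 := ‖proj Q.Y (y + c.β • w) - y‖ ^ 2
  set L2 := ‖proj Q.mult (lam + c.γ • Q.resid x' y') - lam‖ ^ 2
  have hu : 0 < η * μ * c.β / 4 := by positivity
  have p5 : ‖y' - Q.yStar x' lam'‖ ^ 2 ≤ (1 + η * μ * c.β / 4) * ‖y' - Q.yStar x lam‖ ^ 2
      + (1 + 1 / (η * μ * c.β / 4)) *
        (2 * Q.lip l ^ 2 / μ ^ 2 * (η ^ 2 * (X2 + L2))) := by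
    have h1 : ‖y' - Q.yStar x' lam'‖ ≤
        ‖y' - Q.yStar x lam‖ + ‖Q.yStar x' lam' - Q.yStar x lam‖ := by
      rw [norm_sub_rev (Q.yStar x' lam')]
      exact norm_sub_le_norm_sub_add_norm_sub _ _ _
    calc ‖y' - Q.yStar x' lam'‖ ^ 2 ≤
        (‖y' - Q.yStar x lam‖ + ‖Q.yStar x' lam' - Q.yStar x lam‖) ^ 2 := by gcongr
      _ ≤ _ := add_sq_le_young hu
      _ ≤ _ := by gcongr
  have hW : ‖Q.lagrY x y lam - w‖ ^ 2 ≤ 2 * (‖r - w‖ ^ 2 + s₂ ^ 2) := by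
    have h1 : ‖Q.lagrY x y lam - w‖ ≤ ‖r - w‖ + s₂ := by
      have := norm_sub_le_norm_sub_add_norm_sub (Q.lagrY x y lam) r w
      linarith
    calc ‖Q.lagrY x y lam - w‖ ^ 2 ≤ (‖r - w‖ + s₂) ^ 2 := by gcongr
      _ ≤ _ := by nlinarith [sq_nonneg (‖r - w‖ - s₂)]
  have main := descent_combination (X2 := X2) (Y2 := Y2) (L2 := L2) hα hβ hγ hμ hL hη hη1 hημ hβμ
    hc.α_le hc.γ_le hc.γ_le_B
    (sq_nonneg _) (sq_nonneg _) (sq_nonneg _) (sq_nonneg ‖y - Q.yStar x lam‖) (sq_nonneg _)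
    (by positivity) hW p3 p5
  linarith

/-! ### The stationarity gap -/

theorem norm_gap_sq (h : Q.Regular U V l μ) {x : Vec dx} {y : Vec dy} (hx : x ∈ Q.X)
    (hy : y ∈ Q.Y) (lam : Vec p) {α β γ : ℝ} (hα : 0 < α) (hβ : 0 < β) (hγ : 0 < γ) :
    ‖Q.gap α β γ x y lam‖ ^ 2 =
      (1 / α * ‖x - proj Q.X (x - α • Q.lagrX x y lam)‖) ^ 2
      + (1 / β * ‖y - proj Q.Y (y + β • Q.lagrY x y lam)‖) ^ 2
      + (1 / γ * ‖lam - proj Q.mult (lam + γ • Q.resid x y)‖) ^ 2 := by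
  have e : ∀ {n : ℕ} {r : ℝ} (_ : 0 < r) (u : Vec n), 1 / r * ‖u‖ = ‖(1 / r) • u‖ :=
    fun hr u => by rw [norm_smul, Real.norm_of_nonneg (one_div_nonneg.2 hr.le)]
  rw [gap, WithLp.prod_norm_sq_eq_of_L2, WithLp.prod_norm_sq_eq_of_L2,
    gradient_lagr_x h.sm (h.X_sub hx) (h.Y_sub hy), gradient_lagr_y h.sm (h.X_sub hx) (h.Y_sub hy),
    gradient_lagr_lam, smul_neg, sub_neg_eq_add, e hα, e hβ, e hγ, ← add_assoc]
  rfl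

/-- The stationarity gap in terms of the displacements of the algorithm and of the errors of its
gradient estimators. -/
theorem norm_gap_sq_le (h : Q.Regular U V l μ) {c : Params} (hc : c.Admissible Q l μ)
    {x x' : Vec dx} {y y' : Vec dy} {lam : Vec p} (hx : x ∈ Q.X) (hy : y ∈ Q.Y)
    {v q : Vec dx} {w r : Vec dy} {η s₁ s₂ : ℝ} (hη : 0 < η) (hη1 : η ≤ 1)
    (hs₁ : ‖Q.lagrX x y lam - q‖ ≤ s₁) (hs₂ : ‖Q.lagrY x y lam - r‖ ≤ s₂)
    (ex : x' = x + η • (proj Q.X (x - c.α • v) - x))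
    (ey : y' = y + η • (proj Q.Y (y + c.β • w) - y)) :
    ‖Q.gap c.α c.β c.γ x y lam‖ ^ 2 ≤
      (3 / c.α ^ 2 + 3 * ‖Q.A‖ ^ 2) * ‖proj Q.X (x - c.α • v) - x‖ ^ 2
      + (3 / c.β ^ 2 + 3 * ‖Q.B‖ ^ 2) * ‖proj Q.Y (y + c.β • w) - y‖ ^ 2
      + 3 / c.γ ^ 2 * ‖proj Q.mult (lam + c.γ • Q.resid x' y') - lam‖ ^ 2
      + 3 * ‖q - v‖ ^ 2 + 3 * ‖r - w‖ ^ 2 + 3 * s₁ ^ 2 + 3 * s₂ ^ 2 := by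
  have hα := hc.α_pos
  have hβ := hc.β_pos
  have hγ := hc.γ_pos
  rw [h.norm_gap_sq hx hy lam hα hβ hγ]
  have b1 : 1 / c.α * ‖x - proj Q.X (x - c.α • Q.lagrX x y lam)‖ ≤
      1 / c.α * ‖proj Q.X (x - c.α • v) - x‖ + ‖q - v‖ + s₁ := by
    have h1 := norm_proj_sub_proj_le Q.X_nonempty Q.X_compact.isClosed Q.X_convex (x - c.α • v)
      (x - c.α • Q.lagrX x y lam)
    have e1 : x - c.α • v - (x - c.α • Q.lagrX x y lam) = c.α • (Q.lagrX x y lam - v) := by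
      module
    rw [e1, norm_smul, Real.norm_of_nonneg hα.le] at h1
    have h2 := norm_sub_le_norm_sub_add_norm_sub x (proj Q.X (x - c.α • v))
      (proj Q.X (x - c.α • Q.lagrX x y lam))
    have h3 := norm_sub_le_norm_sub_add_norm_sub (Q.lagrX x y lam) q v
    rw [norm_sub_rev x (proj Q.X (x - c.α • v))] at h2
    calc _ ≤ 1 / c.α * (‖proj Q.X (x - c.α • v) - x‖ + c.α * (‖q - v‖ + s₁)) := by
          gcongr
          refine h2.trans (add_le_add le_rfl (h1.trans ?_))
          gcongr
          linarith
      _ = _ := by field_simp; ring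
  have b2 : 1 / c.β * ‖y - proj Q.Y (y + c.β • Q.lagrY x y lam)‖ ≤
      1 / c.β * ‖proj Q.Y (y + c.β • w) - y‖ + ‖r - w‖ + s₂ := by
    have h1 := norm_proj_sub_proj_le Q.Y_nonempty Q.Y_compact.isClosed Q.Y_convex (y + c.β • w)
      (y + c.β • Q.lagrY x y lam)
    have e1 : y + c.β • w - (y + c.β • Q.lagrY x y lam) = -(c.β • (Q.lagrY x y lam - w)) := by
      module
    rw [e1, norm_neg, norm_smul, Real.norm_of_nonneg hβ.le] at h1
    have h2 := norm_sub_le_norm_sub_add_norm_sub y (proj Q.Y (y + c.β • w))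
      (proj Q.Y (y + c.β • Q.lagrY x y lam))
    have h3 := norm_sub_le_norm_sub_add_norm_sub (Q.lagrY x y lam) r w
    rw [norm_sub_rev y (proj Q.Y (y + c.β • w))] at h2
    calc _ ≤ 1 / c.β * (‖proj Q.Y (y + c.β • w) - y‖ + c.β * (‖r - w‖ + s₂)) := by
          gcongr
          refine h2.trans (add_le_add le_rfl (h1.trans ?_))
          gcongr
          linarith
      _ = _ := by field_simp; ring
  have b3 : 1 / c.γ * ‖lam - proj Q.mult (lam + c.γ • Q.resid x y)‖ ≤
      1 / c.γ * ‖proj Q.mult (lam + c.γ • Q.resid x' y') - lam‖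
        + ‖Q.A‖ * ‖proj Q.X (x - c.α • v) - x‖ + ‖Q.B‖ * ‖proj Q.Y (y + c.β • w) - y‖ := by
    have h1 := norm_proj_sub_proj_le Q.mult_nonempty Q.mult_isClosed Q.mult_convex
      (lam + c.γ • Q.resid x' y') (lam + c.γ • Q.resid x y)
    -- The algorithm uses the residual at the updated point, the gap the one at the current point.
    -- They differ by `η` times the images of the two displacements, whence `‖A‖` and `‖B‖` in `D₁`.
    have e1 : lam + c.γ • Q.resid x' y' - (lam + c.γ • Q.resid x y) =
        c.γ • (η • Q.A (proj Q.X (x - c.α • v) - x) + η • Q.B (proj Q.Y (y + c.β • w) - y)) := by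
      rw [← map_smul, ← map_smul, ← (sub_eq_iff_eq_add'.2 ex), ← (sub_eq_iff_eq_add'.2 ey)]
      simp only [resid, map_sub]
      module
    rw [e1, norm_smul, Real.norm_of_nonneg hγ.le] at h1
    have h2 := norm_sub_le_norm_sub_add_norm_sub lam (proj Q.mult (lam + c.γ • Q.resid x' y'))
      (proj Q.mult (lam + c.γ • Q.resid x y))
    rw [norm_sub_rev lam (proj Q.mult (lam + c.γ • Q.resid x' y'))] at h2
    have h3 : ‖η • Q.A (proj Q.X (x - c.α • v) - x) + η • Q.B (proj Q.Y (y + c.β • w) - y)‖ ≤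
        ‖Q.A‖ * ‖proj Q.X (x - c.α • v) - x‖ + ‖Q.B‖ * ‖proj Q.Y (y + c.β • w) - y‖ := by
      refine (norm_add_le _ _).trans (add_le_add ?_ ?_)
      · rw [norm_smul, Real.norm_of_nonneg hη.le]
        exact (mul_le_of_le_one_left (norm_nonneg _) hη1).trans (Q.A.le_opNorm _)
      · rw [norm_smul, Real.norm_of_nonneg hη.le]
        exact (mul_le_of_le_one_left (norm_nonneg _) hη1).trans (Q.B.le_opNorm _)
    calc _ ≤ 1 / c.γ * (‖proj Q.mult (lam + c.γ • Q.resid x' y') - lam‖ + c.γ *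
          (‖Q.A‖ * ‖proj Q.X (x - c.α • v) - x‖ + ‖Q.B‖ * ‖proj Q.Y (y + c.β • w) - y‖)) := by
          gcongr
          exact h2.trans (add_le_add le_rfl (h1.trans (by gcongr)))
      _ = _ := by field_simp; ring
  have c1 := (pow_le_pow_left₀ (by positivity) b1 2).trans (add_three_sq_le _ _ _)
  have c2 := (pow_le_pow_left₀ (by positivity) b2 2).trans (add_three_sq_le _ _ _)
  have c3 := (pow_le_pow_left₀ (by positivity) b3 2).trans (add_three_sq_le _ _ _)
  rw [mul_pow (1 / c.α) ‖proj Q.X (x - c.α • v) - x‖, one_div_pow] at c1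
  rw [mul_pow (1 / c.β) ‖proj Q.Y (y + c.β • w) - y‖, one_div_pow] at c2
  rw [mul_pow (1 / c.γ) ‖proj Q.mult (lam + c.γ • Q.resid x' y') - lam‖, one_div_pow,
    mul_pow ‖Q.A‖, mul_pow ‖Q.B‖] at c3
  have e1 : ∀ r : ℝ, 3 / r ^ 2 = 3 * (1 / r ^ 2) := fun r => by ring
  rw [e1 c.α, e1 c.β, e1 c.γ]
  linarith

end Regular

end Problem


/-! ### Averages of independent centered vectors -/

section Average

variable {Ξ : Type*} [MeasurableSpace Ξ] {D : Measure Ξ} [IsProbabilityMeasure D]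

/-- The cross term vanishes because the summands are centered, and variances of independent
coordinates add. This is the source of the factor `1/b`. -/
theorem integral_add_average_sq {b : ℕ} (hb : 0 < b) {X : Ξ → ℝ} (hX : MemLp X 2 D)
    (h0 : ∫ z, X z ∂D = 0) (a : ℝ) :
    ∫ ξ : Fin b → Ξ, (a + 1 / (b : ℝ) * ∑ j, X (ξ j)) ^ 2 ∂Measure.pi (fun _ => D) =
      a ^ 2 + 1 / (b : ℝ) * ∫ z, X z ^ 2 ∂D := by
  have hXj : ∀ j : Fin b, MemLp (fun ξ : Fin b → Ξ => X (ξ j)) 2 (Measure.pi fun _ => D) :=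
    fun j => hX.comp_measurePreserving (measurePreserving_eval _ j)
  have hS : MemLp (fun ξ : Fin b → Ξ => ∑ j, X (ξ j)) 2 (Measure.pi fun _ => D) :=
    memLp_finsetSum _ fun j _ => hXj j
  have hSint : ∫ ξ : Fin b → Ξ, ∑ j, X (ξ j) ∂Measure.pi (fun _ => D) = 0 := by
    rw [integral_finsetSum _ fun j _ => (hXj j).integrable one_le_two]
    refine Finset.sum_eq_zero fun j _ => ?_
    rw [integral_comp_eval hX.aestronglyMeasurable, h0]
  have hvar := variance_sum_pi (μ := fun _ : Fin b => D) (X := fun _ => X) fun _ => hX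
  have e1 : (∑ i : Fin b, fun ξ : Fin b → Ξ => X (ξ i)) = fun ξ => ∑ j, X (ξ j) := by
    ext ξ
    simp
  rw [e1, variance_of_integral_eq_zero hS.aestronglyMeasurable.aemeasurable hSint,
    variance_of_integral_eq_zero hX.aestronglyMeasurable.aemeasurable h0] at hvar
  simp only [Finset.sum_const, Finset.card_univ, Fintype.card_fin, nsmul_eq_mul] at hvar
  have hb' : (b : ℝ) ≠ 0 := by positivity
  have e2 : ∀ ξ : Fin b → Ξ, (a + 1 / (b : ℝ) * ∑ j, X (ξ j)) ^ 2 =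
      a ^ 2 + 2 * a / b * ∑ j, X (ξ j) + (1 / (b : ℝ)) ^ 2 * (∑ j, X (ξ j)) ^ 2 := fun ξ => by
    ring
  simp_rw [e2]
  have i1 : Integrable (fun ξ : Fin b → Ξ => a ^ 2 + 2 * a / b * ∑ j, X (ξ j))
      (Measure.pi fun _ => D) :=
    (integrable_const _).add ((hS.integrable one_le_two).const_mul _)
  rw [integral_add i1 (hS.integrable_sq.const_mul _),
    integral_add (integrable_const _) ((hS.integrable one_le_two).const_mul _),
    integral_const_mul, integral_const_mul, hSint, hvar]
  simp
  field_simp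

theorem integral_norm_add_average_sq {n b : ℕ} (hb : 0 < b) {N : Ξ → Vec n} (hN : MemLp N 2 D)
    (h0 : ∫ z, N z ∂D = 0) (a : Vec n) :
    Integrable (fun ξ : Fin b → Ξ => ‖a + (1 / (b : ℝ)) • ∑ j, N (ξ j)‖ ^ 2)
      (Measure.pi fun _ => D) ∧
    ∫ ξ : Fin b → Ξ, ‖a + (1 / (b : ℝ)) • ∑ j, N (ξ j)‖ ^ 2 ∂Measure.pi (fun _ => D) =
      ‖a‖ ^ 2 + 1 / (b : ℝ) * ∫ z, ‖N z‖ ^ 2 ∂D := by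
  have hNj : ∀ j : Fin b, MemLp (fun ξ : Fin b → Ξ => N (ξ j)) 2 (Measure.pi fun _ => D) :=
    fun j => hN.comp_measurePreserving (measurePreserving_eval _ j)
  have hS0 : MemLp (fun ξ : Fin b → Ξ => ∑ j, N (ξ j)) 2 (Measure.pi fun _ => D) :=
    memLp_finsetSum _ fun j _ => hNj j
  have hS : MemLp (fun ξ : Fin b → Ξ => a + (1 / (b : ℝ)) • ∑ j, N (ξ j)) 2
      (Measure.pi fun _ => D) :=
    (memLp_const a).add (hS0.const_smul (1 / (b : ℝ)))
  refine ⟨hS.integrable_norm_pow (by norm_num), ?_⟩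
  have hNi : ∀ i, MemLp (fun z => N z i) 2 D := hN.eval_piLp
  have hSi : ∀ i, MemLp (fun ξ : Fin b → Ξ => (a + (1 / (b : ℝ)) • ∑ j, N (ξ j)) i) 2
      (Measure.pi fun _ => D) := hS.eval_piLp
  have h0i : ∀ i, ∫ z, N z i ∂D = 0 := fun i => by
    rw [← eval_integral_piLp fun i => (hNi i).integrable one_le_two, h0]
    rfl
  simp_rw [EuclideanSpace.norm_sq_eq, Real.norm_eq_abs, sq_abs]
  rw [integral_finsetSum _ fun i _ => (hSi i).integrable_sq,
    integral_finsetSum _ fun i _ => (hNi i).integrable_sq, Finset.mul_sum,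
    ← Finset.sum_add_distrib]
  refine Finset.sum_congr rfl fun i _ => ?_
  rw [← integral_add_average_sq hb (hNi i) (h0i i) (a i)]
  simp

variable {Ω : Type*} [MeasurableSpace Ω] {P : Measure Ω} [IsProbabilityMeasure P]

/-- Second moment of a random vector plus the average of a batch of conditionally centered
independent noise vectors. -/
theorem integral_norm_add_batch_sq_le {T : Type*} [MeasurableSpace T] {n b : ℕ} (hb : 0 < b)
    {u : Ω → T} {ξ : Ω → Fin b → Ξ} (hu : Measurable u) (hξ : Measurable ξ)
    (hlaw : P.map (fun ω => (u ω, ξ ω)) = (P.map u).prod (Measure.pi fun _ => D))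
    {a : T → Vec n} (ha : Measurable a) {N : T → Ξ → Vec n} (hN : Measurable (Function.uncurry N))
    (hN0 : ∀ t, ∫ z, N t z ∂D = 0) {σ : T → ℝ} (hσ : Measurable σ)
    (hN2 : ∀ t, Integrable (fun z => ‖N t z‖ ^ 2) D) (hNσ : ∀ t, ∫ z, ‖N t z‖ ^ 2 ∂D ≤ σ t)
    (hai : Integrable (fun ω => ‖a (u ω)‖ ^ 2) P) (hσi : Integrable (fun ω => σ (u ω)) P) :
    Integrable (fun ω => ‖a (u ω) + (1 / (b : ℝ)) • ∑ j, N (u ω) (ξ ω j)‖ ^ 2) P ∧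
    ∫ ω, ‖a (u ω) + (1 / (b : ℝ)) • ∑ j, N (u ω) (ξ ω j)‖ ^ 2 ∂P ≤
      ∫ ω, ‖a (u ω)‖ ^ 2 ∂P + 1 / (b : ℝ) * ∫ ω, σ (u ω) ∂P := by
  have : IsProbabilityMeasure (P.map u) := Measure.isProbabilityMeasure_map hu.aemeasurable
  set F : T × (Fin b → Ξ) → ℝ :=
    fun q => ‖a q.1 + (1 / (b : ℝ)) • ∑ j, N q.1 (q.2 j)‖ ^ 2 with hF
  have hFm : Measurable F := by
    have h1 : ∀ j : Fin b, Measurable fun q : T × (Fin b → Ξ) => N q.1 (q.2 j) := fun j =>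
      hN.comp (measurable_fst.prodMk ((measurable_pi_apply j).comp measurable_snd))
    have h2 : Measurable fun q : T × (Fin b → Ξ) => ∑ j, N q.1 (q.2 j) :=
      Finset.measurable_fun_sum _ fun j _ => h1 j
    have h3 : Measurable fun q : T × (Fin b → Ξ) =>
        a q.1 + (1 / (b : ℝ)) • ∑ j, N q.1 (q.2 j) :=
      (ha.comp measurable_fst).add (h2.const_smul (1 / (b : ℝ)))
    exact h3.norm.pow_const 2
  have hNt : ∀ t, MemLp (N t) 2 D := fun t => by
    have hm : Measurable (N t) := hN.comp measurable_prodMk_left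
    exact (memLp_two_iff_integrable_sq_norm hm.aestronglyMeasurable).2 (hN2 t)
  -- Conditioning on the past is done by Fubini: the joint law is a product, so the batch is
  -- integrated out with the past frozen at `t`.
  have hfib := fun t => integral_norm_add_average_sq hb (hNt t) (hN0 t) (a t)
  have hle : ∀ t, ∫ ξ, F (t, ξ) ∂Measure.pi (fun _ => D) ≤ ‖a t‖ ^ 2 + 1 / (b : ℝ) * σ t :=
    fun t => by
      rw [(hfib t).2]
      gcongr
      exact hNσ t
  have hbound : Integrable (fun t => ‖a t‖ ^ 2 + 1 / (b : ℝ) * σ t) (P.map u) :=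
    ((integrable_map_measure (g := fun t => ‖a t‖ ^ 2)
      (ha.norm.pow_const 2).aestronglyMeasurable hu.aemeasurable).2 hai).add
      (((integrable_map_measure hσ.aestronglyMeasurable hu.aemeasurable).2 hσi).const_mul _)
  have hmeas : Measurable fun t => ∫ ξ, F (t, ξ) ∂Measure.pi (fun _ => D) :=
    hFm.stronglyMeasurable.integral_prod_right'.measurable
  have hnn : ∀ t, 0 ≤ ∫ ξ, F (t, ξ) ∂Measure.pi (fun _ => D) := fun t =>
    integral_nonneg fun _ => sq_nonneg _
  have hint1 : Integrable (fun t => ∫ ξ, F (t, ξ) ∂Measure.pi (fun _ => D)) (P.map u) :=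
    hbound.mono' hmeas.aestronglyMeasurable (Filter.Eventually.of_forall fun t => by
      rw [Real.norm_of_nonneg (hnn t)]
      exact hle t)
  have hint : Integrable F ((P.map u).prod (Measure.pi fun _ => D)) := by
    rw [integrable_prod_iff hFm.aestronglyMeasurable]
    refine ⟨Filter.Eventually.of_forall fun t => (hfib t).1, ?_⟩
    have e : ∀ t ξ, ‖F (t, ξ)‖ = F (t, ξ) := fun t ξ => Real.norm_of_nonneg (sq_nonneg _)
    simpa only [e] using hint1
  have hpair : Measurable fun ω => (u ω, ξ ω) := hu.prodMk hξ
  rw [← hlaw] at hint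
  refine ⟨hint.comp_measurable hpair, ?_⟩
  have e1 : ∫ ω, F (u ω, ξ ω) ∂P = ∫ t, ∫ ξ, F (t, ξ) ∂Measure.pi (fun _ => D) ∂P.map u := by
    rw [← integral_prod _ (by rwa [← hlaw]), ← hlaw,
      integral_map hpair.aemeasurable hFm.aestronglyMeasurable]
  change ∫ ω, F (u ω, ξ ω) ∂P ≤ _
  rw [e1]
  refine (integral_mono hint1 hbound hle).trans_eq ?_
  rw [integral_map hu.aemeasurable (by fun_prop),
    integral_add hai (hσi.const_mul _), integral_const_mul]

end Average

/-! ### Noise of the finite-difference estimators -/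

/-- Centering does not increase the second moment. -/
theorem integral_norm_sub_integral_sq_le {n : ℕ} {Ξ : Type*} [MeasurableSpace Ξ] {D : Measure Ξ}
    [IsProbabilityMeasure D] {d : Ξ → Vec n} {C : ℝ} (hd : Integrable d D)
    (hC : ∀ z, ‖d z‖ ≤ C) :
    Integrable (fun z => ‖d z - ∫ z', d z' ∂D‖ ^ 2) D ∧
    ∫ z, ‖d z - ∫ z', d z' ∂D‖ ^ 2 ∂D ≤ C ^ 2 := by
  set m := ∫ z', d z' ∂D
  have hd2 : Integrable (fun z => ‖d z‖ ^ 2) D := by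
    refine Integrable.of_bound (hd.aestronglyMeasurable.norm.pow 2) (C ^ 2)
      (Filter.Eventually.of_forall fun z => ?_)
    rw [Real.norm_of_nonneg (sq_nonneg _)]
    exact pow_le_pow_left₀ (norm_nonneg _) (hC z) 2
  have e : ∀ z, ‖d z - m‖ ^ 2 = ‖d z‖ ^ 2 - 2 * inner ℝ m (d z) + ‖m‖ ^ 2 := fun z => by
    rw [norm_sub_sq_real, real_inner_comm]
  simp_rw [e]
  have hi : Integrable (fun z => 2 * inner ℝ m (d z)) D := (hd.const_inner m).const_mul 2
  have hi2 : Integrable (fun z => ‖d z‖ ^ 2 - 2 * inner ℝ m (d z)) D := hd2.sub hi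
  refine ⟨hi2.add (integrable_const _), ?_⟩
  rw [integral_add hi2 (integrable_const _), integral_sub hd2 hi, integral_const_mul,
    integral_inner hd, real_inner_self_eq_norm_sq]
  have h1 : ∫ z, ‖d z‖ ^ 2 ∂D ≤ ∫ _z, C ^ 2 ∂D :=
    integral_mono hd2 (integrable_const _) fun z => pow_le_pow_left₀ (norm_nonneg _) (hC z) 2
  simp only [integral_const, probReal_univ, smul_eq_mul, one_mul] at h1 ⊢
  nlinarith [sq_nonneg ‖m‖]

section Noise

variable {m n : ℕ} {Ξ : Type*} [MeasurableSpace Ξ] {U : Set (Vec m)} {V : Set (Vec n)} {l : ℝ}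
  {G : Vec m → Vec n → Ξ → ℝ}

/-- A Carathéodory function, continuous in `(x, y)` and measurable in the sample, is jointly
measurable. The restriction to the subtype `U ×ˢ V` is needed because nothing is known about `G`
elsewhere. -/
theorem measurable_comp_of_smoothFun (hG : ∀ z, SmoothFun U V l (fun x y => G x y z))
    (hm : ∀ x ∈ U, ∀ y ∈ V, Measurable (G x y)) {Ω : Type*} {mΩ : MeasurableSpace Ω}
    {x : Ω → Vec m} {y : Ω → Vec n} {ζ : Ω → Ξ} (hx : Measurable x) (hy : Measurable y)
    (hζ : Measurable ζ) (hxU : ∀ ω, x ω ∈ U) (hyV : ∀ ω, y ω ∈ V) :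
    Measurable fun ω => G (x ω) (y ω) (ζ ω) := by
  have h1 : Measurable (Function.uncurry fun (q : (U ×ˢ V : Set (Vec m × Vec n))) (z : Ξ) =>
      G q.1.1 q.1.2 z) := by
    refine measurable_uncurry_of_continuous_of_measurable (fun z => ?_) fun q =>
      hm _ q.2.1 _ q.2.2
    exact continuousOn_iff_continuous_domRestrict.1 (hG z).continuousOn
  exact h1.comp (f := fun ω => ((⟨(x ω, y ω), hxU ω, hyV ω⟩ : (U ×ˢ V : Set (Vec m × Vec n))),
    ζ ω)) (((hx.prodMk hy).subtype_mk).prodMk hζ)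

theorem measurable_fdGrad_comp (hG : ∀ z, SmoothFun U V l (fun x y => G x y z))
    (hm : ∀ x ∈ U, ∀ y ∈ V, Measurable (G x y)) {θ : ℝ} {Ω : Type*} {mΩ : MeasurableSpace Ω}
    {x : Ω → Vec m} {y : Ω → Vec n} {ζ : Ω → Ξ} (hx : Measurable x) (hy : Measurable y)
    (hζ : Measurable ζ) (hxU : ∀ ω, x ω ∈ U)
    (hxθ : ∀ ω (i : Fin m), x ω + θ • EuclideanSpace.single i (1 : ℝ) ∈ U)
    (hyV : ∀ ω, y ω ∈ V) :
    Measurable fun ω => fdGrad θ (fun x' => G x' (y ω) (ζ ω)) (x ω) := by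
  unfold fdGrad
  refine Finset.measurable_fun_sum _ fun i _ => ?_
  refine Measurable.smul_const (Measurable.div_const (Measurable.sub ?_ ?_) _) _
  · exact measurable_comp_of_smoothFun hG hm (hx.add_const _) hy hζ (fun ω => hxθ ω i) hyV
  · exact measurable_comp_of_smoothFun hG hm hx hy hζ hxU hyV

variable (hG : ∀ z, SmoothFun U V l (fun x y => G x y z))
include hG

omit [MeasurableSpace Ξ] in
-- Compare each estimator with its gradient and the gradients with each other. As the smoothing
-- parameters decrease, both smoothing errors are charged at the larger `θ`.
theorem norm_fdGrad_sub_fdGrad_le (hl : 0 ≤ l) {θ θ' : ℝ} (hθ' : 0 ≤ θ') (hθθ : θ' ≤ θ)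
    (hθn : 0 < m → 0 < θ') {x x' : Vec m} {y y' : Vec n} (hx : x ∈ U) (hx' : x' ∈ U)
    (hy : y ∈ V) (hy' : y' ∈ V)
    (hs : ∀ i : Fin m, segment ℝ x (x + θ • EuclideanSpace.single i (1 : ℝ)) ⊆ U)
    (hs' : ∀ i : Fin m, segment ℝ x' (x' + θ' • EuclideanSpace.single i (1 : ℝ)) ⊆ U) (z : Ξ) :
    ‖fdGrad θ' (fun u => G u y' z) x' - fdGrad θ (fun u => G u y z) x‖ ≤
      l * ‖x' - x‖ + l * ‖y' - y‖ + 2 * (√m * (l * θ / 2)) := by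
  have h1 := norm_fdGrad_sub_gradient_le hl (hθ'.trans hθθ) (fun hm => (hθn hm).trans_le hθθ)
    (fun u hu => (hG z).diff_x u hu y hy)
    (fun u hu u' hu' => (hG z).lip_xx u hu u' hu' y hy) hs
  have h2 := norm_fdGrad_sub_gradient_le hl hθ' hθn
    (fun u hu => (hG z).diff_x u hu y' hy')
    (fun u hu u' hu' => (hG z).lip_xx u hu u' hu' y' hy') hs'
  have h3 := (hG z).norm_gradient_sub_le hx' hx hy' hy
  have h4 : √m * (l * θ' / 2) ≤ √m * (l * θ / 2) := by gcongr
  have h5 := norm_sub_le_norm_sub_add_norm_sub (fdGrad θ' (fun u => G u y' z) x')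
    (gradient (fun u => G u y' z) x') (fdGrad θ (fun u => G u y z) x)
  have h6 := norm_sub_le_norm_sub_add_norm_sub (gradient (fun u => G u y' z) x')
    (gradient (fun u => G u y z) x) (fdGrad θ (fun u => G u y z) x)
  rw [norm_sub_rev (gradient (fun u => G u y z) x)] at h6
  linarith

variable {D : Measure Ξ} [IsProbabilityMeasure D]

/-- The second moment of the noise of the momentum estimator. -/
theorem integral_norm_noise_sq_le {κ₁ κ₂ : ℝ}
    (hκ : ∀ a b c : ℝ, (a + b + 2 * c) ^ 2 ≤ κ₁ * a ^ 2 + κ₂ * b ^ 2 + 6 * c ^ 2)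
    (hint : ∀ x ∈ U, ∀ y ∈ V, Integrable (G x y) D)
    (hl : 0 ≤ l) {θ θ' : ℝ} (hθ' : 0 ≤ θ') (hθθ : θ' ≤ θ)
    (hθn : 0 < m → 0 < θ') {x x' : Vec m} {y y' : Vec n} (hx : x ∈ U) (hx' : x' ∈ U)
    (hy : y ∈ V) (hy' : y' ∈ V)
    (hs : ∀ i : Fin m, segment ℝ x (x + θ • EuclideanSpace.single i (1 : ℝ)) ⊆ U)
    (hs' : ∀ i : Fin m, segment ℝ x' (x' + θ' • EuclideanSpace.single i (1 : ℝ)) ⊆ U)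
    {g : Vec m → Vec n → ℝ} (hg : ∀ x y, g x y = ∫ z, G x y z ∂D) {δ ϱ : ℝ}
    (hv : Integrable (fun z => ‖fdGrad θ' (fun u => G u y' z) x' -
      fdGrad θ' (fun u => g u y') x'‖ ^ 2) D)
    (hvδ : ∫ z, ‖fdGrad θ' (fun u => G u y' z) x' - fdGrad θ' (fun u => g u y') x'‖ ^ 2 ∂D
      ≤ δ ^ 2) {N : Ξ → Vec m}
    (hN : ∀ z, N z = (fdGrad θ' (fun u => G u y' z) x' - fdGrad θ' (fun u => g u y') x')
      - (1 - ϱ) • (fdGrad θ (fun u => G u y z) x - fdGrad θ (fun u => g u y) x)) :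
    ∫ z, N z ∂D = 0 ∧ Integrable (fun z => ‖N z‖ ^ 2) D ∧
    ∫ z, ‖N z‖ ^ 2 ∂D ≤ 2 * ϱ ^ 2 * δ ^ 2 + 2 * (1 - ϱ) ^ 2 *
      (κ₁ * l ^ 2 * ‖x' - x‖ ^ 2 + κ₂ * l ^ 2 * ‖y' - y‖ ^ 2 + 6 * (√m * (l * θ / 2)) ^ 2) := by
  set F := fun z => fdGrad θ (fun u => G u y z) x with hF
  set F' := fun z => fdGrad θ' (fun u => G u y' z) x' with hF'
  have iF : Integrable F D := integrable_fdGrad (F := fun u z => G u y z) (hint x hx y hy)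
    fun i => hint _ (hs i (right_mem_segment ℝ _ _)) y hy
  have iF' : Integrable F' D := integrable_fdGrad (F := fun u z => G u y' z) (hint x' hx' y' hy')
    fun i => hint _ (hs' i (right_mem_segment ℝ _ _)) y' hy'
  have eF : fdGrad θ (fun u => g u y) x = ∫ z, F z ∂D := by
    simp_rw [hg]
    exact (integral_fdGrad (F := fun u z => G u y z) (hint x hx y hy)
      fun i => hint _ (hs i (right_mem_segment ℝ _ _)) y hy).symm
  have eF' : fdGrad θ' (fun u => g u y') x' = ∫ z, F' z ∂D := by
    simp_rw [hg]
    exact (integral_fdGrad (F := fun u z => G u y' z) (hint x' hx' y' hy')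
      fun i => hint _ (hs' i (right_mem_segment ℝ _ _)) y' hy').symm
  have hN' : ∀ z, N z = (F' z - ∫ z, F' z ∂D) - (1 - ϱ) • (F z - ∫ z, F z ∂D) := fun z => by
    rw [hN, ← eF, ← eF']
  rw [eF'] at hv hvδ
  have iC : Integrable (fun z => F z - ∫ z, F z ∂D) D := iF.sub (integrable_const _)
  have iC' : Integrable (fun z => F' z - ∫ z, F' z ∂D) D := iF'.sub (integrable_const _)
  have iS : Integrable (fun z => (1 - ϱ) • (F z - ∫ z, F z ∂D)) D := iC.smul (1 - ϱ)
  have iN : Integrable N D := (iC'.sub iS).congr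
    (Filter.Eventually.of_forall fun z => (hN' z).symm)
  refine ⟨?_, ?_⟩
  · simp_rw [hN']
    rw [integral_sub iC' iS, integral_smul, integral_sub iF (integrable_const _),
      integral_sub iF' (integrable_const _)]
    simp
  set C := l * ‖x' - x‖ + l * ‖y' - y‖ + 2 * (√m * (l * θ / 2)) with hC
  obtain ⟨id, hd⟩ := integral_norm_sub_integral_sq_le (D := D) (d := fun z => F' z - F z)
    (iF'.sub iF) fun z =>
      norm_fdGrad_sub_fdGrad_le hG hl hθ' hθθ hθn hx hx' hy hy' hs hs' z
  rw [integral_sub iF' iF] at id hd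
  have hbound : ∀ z, ‖N z‖ ^ 2 ≤ 2 * ϱ ^ 2 * ‖F' z - ∫ z, F' z ∂D‖ ^ 2 +
      2 * (1 - ϱ) ^ 2 * ‖F' z - F z - (∫ z, F' z ∂D - ∫ z, F z ∂D)‖ ^ 2 := fun z => by
    -- The identity behind variance reduction: a fraction `ϱ` of fresh noise, of variance at most
    -- `δ²`, and the rest in the centered difference `F' - F`, which is small when the iterates move
    -- little.
    have e : N z = ϱ • (F' z - ∫ z, F' z ∂D) +
        (1 - ϱ) • (F' z - F z - (∫ z, F' z ∂D - ∫ z, F z ∂D)) := by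
      rw [hN']
      module
    have h1 : ‖N z‖ ≤ |ϱ| * ‖F' z - ∫ z, F' z ∂D‖ +
        |1 - ϱ| * ‖F' z - F z - (∫ z, F' z ∂D - ∫ z, F z ∂D)‖ := by
      rw [e]
      refine (norm_add_le _ _).trans_eq ?_
      rw [norm_smul, norm_smul, Real.norm_eq_abs, Real.norm_eq_abs]
    refine (pow_le_pow_left₀ (norm_nonneg _) h1 2).trans ((add_sq_le_young one_pos).trans_eq ?_)
    rw [mul_pow, mul_pow, sq_abs, sq_abs]
    ring
  have iB : Integrable (fun z => 2 * ϱ ^ 2 * ‖F' z - ∫ z, F' z ∂D‖ ^ 2 +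
      2 * (1 - ϱ) ^ 2 * ‖F' z - F z - (∫ z, F' z ∂D - ∫ z, F z ∂D)‖ ^ 2) D :=
    (hv.const_mul _).add (id.const_mul _)
  have iN2 : Integrable (fun z => ‖N z‖ ^ 2) D := iB.mono' (iN.aestronglyMeasurable.norm.pow 2)
    (Filter.Eventually.of_forall fun z => by
      rw [Real.norm_of_nonneg (sq_nonneg _)]
      exact hbound z)
  refine ⟨iN2, (integral_mono iN2 iB hbound).trans ?_⟩
  rw [integral_add (hv.const_mul _) (id.const_mul _), integral_const_mul, integral_const_mul]
  have hC2 : C ^ 2 ≤ κ₁ * l ^ 2 * ‖x' - x‖ ^ 2 + κ₂ * l ^ 2 * ‖y' - y‖ ^ 2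
      + 6 * (√m * (l * θ / 2)) ^ 2 := by
    have := hκ (l * ‖x' - x‖) (l * ‖y' - y‖) (√m * (l * θ / 2))
    rw [mul_pow l ‖x' - x‖, mul_pow l ‖y' - y‖, ← mul_assoc κ₁, ← mul_assoc κ₂] at this
    exact this
  have h1 := hd.trans hC2
  gcongr

end Noise


/-- The momentum recursion for the error of a finite-difference estimator, in mean square. -/
theorem integral_norm_error_sq_le {m n b : ℕ} {Ξ Ω : Type*} [MeasurableSpace Ξ]
    {𝓕 : MeasurableSpace Ω} [mΩ : MeasurableSpace Ω] {P : Measure Ω} [IsProbabilityMeasure P]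
    {D : Measure Ξ} [IsProbabilityMeasure D] {U X : Set (Vec m)} {V Y : Set (Vec n)} {l θ θ' δ ϱ κ₁ κ₂ : ℝ}
    {G : Vec m → Vec n → Ξ → ℝ} {g : Vec m → Vec n → ℝ} (hb : 0 < b)
    (hκ : ∀ a b c : ℝ, (a + b + 2 * c) ^ 2 ≤ κ₁ * a ^ 2 + κ₂ * b ^ 2 + 6 * c ^ 2)
    (hG : ∀ z, SmoothFun U V l (fun x y => G x y z)) (hgs : SmoothFun U V l g)
    (hm : ∀ x ∈ U, ∀ y ∈ V, Measurable (G x y)) (hint : ∀ x ∈ U, ∀ y ∈ V, Integrable (G x y) D)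
    (hg : ∀ x y, g x y = ∫ z, G x y z ∂D) (hXU : X ⊆ U) (hYV : Y ⊆ V)
    (hl : 0 ≤ l) (hθ' : 0 ≤ θ') (hθθ : θ' ≤ θ) (hθm : 0 < m → 0 < θ')
    (hs : ∀ x ∈ X, ∀ i : Fin m, segment ℝ x (x + θ • EuclideanSpace.single i (1 : ℝ)) ⊆ U)
    (hs' : ∀ x ∈ X, ∀ i : Fin m, segment ℝ x (x + θ' • EuclideanSpace.single i (1 : ℝ)) ⊆ U)
    (hv : ∀ x ∈ X, ∀ y ∈ Y, Integrable (fun z => ‖fdGrad θ' (fun u => G u y z) x -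
      fdGrad θ' (fun u => g u y) x‖ ^ 2) D)
    (hvδ : ∀ x ∈ X, ∀ y ∈ Y, ∫ z, ‖fdGrad θ' (fun u => G u y z) x -
      fdGrad θ' (fun u => g u y) x‖ ^ 2 ∂D ≤ δ ^ 2)
    (h𝓕 : 𝓕 ≤ mΩ) {x x' e : Ω → Vec m} {y y' : Ω → Vec n}
    (hx : Measurable[𝓕] x) (hx' : Measurable[𝓕] x') (hy : Measurable[𝓕] y)
    (hy' : Measurable[𝓕] y') (he : Measurable[𝓕] e) (hxX : ∀ ω, x ω ∈ X) (hxX' : ∀ ω, x' ω ∈ X)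
    (hyY : ∀ ω, y ω ∈ Y) (hyY' : ∀ ω, y' ω ∈ Y) {ξ : Ω → Fin b → Ξ} (hξ : Measurable ξ)
    (hind : Indep 𝓕 (MeasurableSpace.comap ξ inferInstance) P)
    (hlaw : P.map ξ = Measure.pi fun _ => D)
    (hei : Integrable (fun ω => ‖e ω‖ ^ 2) P) (hxi : Integrable (fun ω => ‖x' ω - x ω‖ ^ 2) P)
    (hyi : Integrable (fun ω => ‖y' ω - y ω‖ ^ 2) P) {e' : Ω → Vec m}
    (he' : ∀ ω, e' ω = (1 - ϱ) • e ω + (1 / (b : ℝ)) • ∑ j,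
      ((fdGrad θ' (fun u => G u (y' ω) (ξ ω j)) (x' ω) - fdGrad θ' (fun u => g u (y' ω)) (x' ω))
      - (1 - ϱ) • (fdGrad θ (fun u => G u (y ω) (ξ ω j)) (x ω)
        - fdGrad θ (fun u => g u (y ω)) (x ω)))) :
    Integrable (fun ω => ‖e' ω‖ ^ 2) P ∧
    ∫ ω, ‖e' ω‖ ^ 2 ∂P ≤ (1 - ϱ) ^ 2 * ∫ ω, ‖e ω‖ ^ 2 ∂P + 1 / (b : ℝ) *
      (2 * ϱ ^ 2 * δ ^ 2 + 2 * (1 - ϱ) ^ 2 * (κ₁ * l ^ 2 * ∫ ω, ‖x' ω - x ω‖ ^ 2 ∂P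
        + κ₂ * l ^ 2 * ∫ ω, ‖y' ω - y ω‖ ^ 2 ∂P + 6 * (√m * (l * θ / 2)) ^ 2)) := by
  -- The past is recorded in a subtype so that the noise bounds hold for every value `t`, not merely
  -- for those attained by the iterates.
  let S := {t : (Vec m × Vec n) × (Vec m × Vec n) // (t.1.1 ∈ X ∧ t.1.2 ∈ Y) ∧
    (t.2.1 ∈ X ∧ t.2.2 ∈ Y)}
  let u : Ω → S × Vec m := fun ω =>
    (⟨((x ω, y ω), (x' ω, y' ω)), ⟨hxX ω, hyY ω⟩, ⟨hxX' ω, hyY' ω⟩⟩, e ω)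
  have hu𝓕 : Measurable[𝓕] u := by
    refine Measurable.prodMk (Measurable.subtype_mk ?_) he
    exact (hx.prodMk hy).prodMk (hx'.prodMk hy')
  have hu : Measurable u := hu𝓕.mono h𝓕 le_rfl
  have hindu : IndepFun u ξ P := by
    rw [IndepFun_iff_Indep]
    exact indep_of_indep_of_le_left hind (measurable_iff_comap_le.1 hu𝓕)
  have hpair := (indepFun_iff_map_prod_eq_prod_map_map hu.aemeasurable hξ.aemeasurable).1 hindu
  rw [hlaw] at hpair
  let N : S × Vec m → Ξ → Vec m := fun t z =>
    (fdGrad θ' (fun u => G u t.1.1.2.2 z) t.1.1.2.1 - fdGrad θ' (fun u => g u t.1.1.2.2) t.1.1.2.1)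
      - (1 - ϱ) • (fdGrad θ (fun u => G u t.1.1.1.2 z) t.1.1.1.1
        - fdGrad θ (fun u => g u t.1.1.1.2) t.1.1.1.1)
  let σ : S × Vec m → ℝ := fun t => 2 * ϱ ^ 2 * δ ^ 2 + 2 * (1 - ϱ) ^ 2 *
    (κ₁ * l ^ 2 * ‖t.1.1.2.1 - t.1.1.1.1‖ ^ 2 + κ₂ * l ^ 2 * ‖t.1.1.2.2 - t.1.1.1.2‖ ^ 2
      + 6 * (√m * (l * θ / 2)) ^ 2)
  have hq : Measurable fun q : (S × Vec m) × Ξ => q.1.1.1 :=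
    measurable_subtype_coe.comp (measurable_fst.comp measurable_fst)
  -- The expectation is treated as a family constant in the sample, so the same measurability lemma
  -- covers it.
  have hgG : ∀ _ : Ξ, SmoothFun U V l (fun x y => g x y) := fun _ => hgs
  have hgm : ∀ x ∈ U, ∀ y ∈ V, Measurable fun _ : Ξ => g x y := fun _ _ _ _ => measurable_const
  have hN : Measurable (Function.uncurry N) := by
    have m2 : Measurable fun q : (S × Vec m) × Ξ => q.2 := measurable_snd
    have a1 := hq.fst.fst
    have a2 := hq.fst.snd
    have a3 := hq.snd.fst
    have a4 := hq.snd.snd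
    have k1 : ∀ q : (S × Vec m) × Ξ, q.1.1.1.1.1 ∈ X := fun q => q.1.1.2.1.1
    have k2 : ∀ q : (S × Vec m) × Ξ, q.1.1.1.1.2 ∈ Y := fun q => q.1.1.2.1.2
    have k3 : ∀ q : (S × Vec m) × Ξ, q.1.1.1.2.1 ∈ X := fun q => q.1.1.2.2.1
    have k4 : ∀ q : (S × Vec m) × Ξ, q.1.1.1.2.2 ∈ Y := fun q => q.1.1.2.2.2
    have b1 := measurable_fdGrad_comp hG hm (θ := θ) a1 a2 m2 (fun q => hXU (k1 q))
      (fun q i => hs _ (k1 q) i (right_mem_segment ℝ _ _)) fun q => hYV (k2 q)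
    have b2 := measurable_fdGrad_comp hgG hgm (θ := θ) a1 a2 m2 (fun q => hXU (k1 q))
      (fun q i => hs _ (k1 q) i (right_mem_segment ℝ _ _)) fun q => hYV (k2 q)
    have b3 := measurable_fdGrad_comp hG hm (θ := θ') a3 a4 m2 (fun q => hXU (k3 q))
      (fun q i => hs' _ (k3 q) i (right_mem_segment ℝ _ _)) fun q => hYV (k4 q)
    have b4 := measurable_fdGrad_comp hgG hgm (θ := θ') a3 a4 m2 (fun q => hXU (k3 q))
      (fun q i => hs' _ (k3 q) i (right_mem_segment ℝ _ _)) fun q => hYV (k4 q)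
    exact (b3.sub b4).sub ((b1.sub b2).const_smul (1 - ϱ))
  have hnoise := fun t : S × Vec m => integral_norm_noise_sq_le hG hκ hint hl hθ' hθθ hθm
    (hXU t.1.2.1.1) (hXU t.1.2.2.1) (hYV t.1.2.1.2) (hYV t.1.2.2.2) (hs _ t.1.2.1.1)
    (hs' _ t.1.2.2.1) hg (hv _ t.1.2.2.1 _ t.1.2.2.2) (hvδ _ t.1.2.2.1 _ t.1.2.2.2)
    (N := N t) (ϱ := ϱ) fun z => rfl
  have hσ : Measurable σ := by
    have hq' : Measurable fun t : S × Vec m => t.1.1 := measurable_subtype_coe.comp measurable_fst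
    have c1 := ((hq'.snd.fst.sub hq'.fst.fst).norm.pow_const 2).const_mul (κ₁ * l ^ 2)
    have c2 := ((hq'.snd.snd.sub hq'.fst.snd).norm.pow_const 2).const_mul (κ₂ * l ^ 2)
    exact (((c1.add c2).add_const _).const_mul _).const_add _
  have iσ1 : Integrable (fun ω => κ₁ * l ^ 2 * ‖x' ω - x ω‖ ^ 2
      + κ₂ * l ^ 2 * ‖y' ω - y ω‖ ^ 2) P := (hxi.const_mul _).add (hyi.const_mul _)
  have iσ2 : Integrable (fun ω => κ₁ * l ^ 2 * ‖x' ω - x ω‖ ^ 2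
      + κ₂ * l ^ 2 * ‖y' ω - y ω‖ ^ 2 + 6 * (√m * (l * θ / 2)) ^ 2) P :=
    iσ1.add (integrable_const _)
  have hσi : Integrable (fun ω => σ (u ω)) P := (integrable_const _).add (iσ2.const_mul _)
  have ha2 : ∀ ω, ‖(1 - ϱ) • e ω‖ ^ 2 = (1 - ϱ) ^ 2 * ‖e ω‖ ^ 2 := fun ω => by
    rw [norm_smul, mul_pow, Real.norm_eq_abs, sq_abs]
  have hai : Integrable (fun ω => ‖(1 - ϱ) • e ω‖ ^ 2) P := by
    simp_rw [ha2]
    exact hei.const_mul _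
  obtain ⟨r1, r2⟩ := integral_norm_add_batch_sq_le (D := D) hb hu hξ hpair
    (a := fun t => (1 - ϱ) • t.2) (measurable_snd.const_smul (1 - ϱ)) hN
    (fun t => (hnoise t).1) hσ (fun t => (hnoise t).2.1) (fun t => (hnoise t).2.2) hai hσi
  have ee : ∀ ω, e' ω = (1 - ϱ) • (u ω).2 + (1 / (b : ℝ)) • ∑ j, N (u ω) (ξ ω j) := he'
  simp_rw [← ee] at r1 r2
  refine ⟨r1, r2.trans_eq ?_⟩
  have e1 : ∫ ω, ‖(1 - ϱ) • (u ω).2‖ ^ 2 ∂P = (1 - ϱ) ^ 2 * ∫ ω, ‖e ω‖ ^ 2 ∂P := by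
    change ∫ ω, ‖(1 - ϱ) • e ω‖ ^ 2 ∂P = _
    simp_rw [ha2]
    rw [integral_const_mul]
  rw [e1]
  congr 2
  change ∫ ω, (2 * ϱ ^ 2 * δ ^ 2 + 2 * (1 - ϱ) ^ 2 * (κ₁ * l ^ 2 * ‖x' ω - x ω‖ ^ 2
      + κ₂ * l ^ 2 * ‖y' ω - y ω‖ ^ 2 + 6 * (√m * (l * θ / 2)) ^ 2)) ∂P = _
  rw [integral_add (integrable_const _) (iσ2.const_mul _), integral_const, integral_const_mul,
    integral_add iσ1 (integrable_const _), integral_add (hxi.const_mul _) (hyi.const_mul _),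
    integral_const_mul, integral_const_mul]
  simp

/-! ### The samples -/

section Sample

variable {Ξ Ω : Type*} [MeasurableSpace Ξ] [mΩ : MeasurableSpace Ω] {D : Measure Ξ}
  {P : Measure Ω} {b : ℕ} {ζ : ℕ → Fin b → Ω → Ξ}

/-- The `σ`-algebra generated by the first `k` mini-batches. -/
abbrev past (ζ : ℕ → Fin b → Ω → Ξ) (k : ℕ) : MeasurableSpace Ω :=
  ⨆ q ∈ {q : ℕ × Fin b | q.1 < k}, MeasurableSpace.comap (ζ q.1 q.2) inferInstance

omit mΩ in
theorem past_mono (ζ : ℕ → Fin b → Ω → Ξ) {k k' : ℕ} (h : k ≤ k') : past ζ k ≤ past ζ k' :=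
  biSup_mono fun _ hq => lt_of_lt_of_le hq h

omit mΩ in
theorem measurable_past (ζ : ℕ → Fin b → Ω → Ξ) (k : ℕ) (j : Fin b) :
    Measurable[past ζ (k + 1)] (ζ k j) := by
  rw [measurable_iff_comap_le]
  exact le_biSup (fun q : ℕ × Fin b => MeasurableSpace.comap (ζ q.1 q.2) inferInstance)
    (show (k, j) ∈ {q : ℕ × Fin b | q.1 < k + 1} from Nat.lt_succ_self k)

namespace IsSample

variable (h : IsSample D P ζ)
include h

theorem past_le (k : ℕ) : past ζ k ≤ mΩ :=
  iSup₂_le fun q _ => measurable_iff_comap_le.1 (h.meas q.1 q.2)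

theorem measurable_batch (k : ℕ) : Measurable fun ω j => ζ k j ω :=
  measurable_pi_lambda _ fun j => h.meas k j

theorem indep_past (k : ℕ) :
    Indep (past ζ k) (MeasurableSpace.comap (fun ω j => ζ k j ω) inferInstance) P := by
  have hi := indep_iSup_of_disjoint
    (m := fun q : ℕ × Fin b => MeasurableSpace.comap (ζ q.1 q.2) inferInstance)
    (fun q => measurable_iff_comap_le.1 (h.meas q.1 q.2)) h.indep.iIndep
    (S := {q | q.1 < k}) (T := {q | q.1 = k}) (by
      rw [Set.disjoint_left]
      intro q hq hq'
      simp only [Set.mem_ofPred_eq] at hq hq'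
      omega)
  refine indep_of_indep_of_le_right hi ?_
  rw [← measurable_iff_comap_le]
  refine @measurable_pi_lambda _ _ _ (_) _ _ fun j => ?_
  rw [measurable_iff_comap_le]
  exact le_biSup (fun q : ℕ × Fin b => MeasurableSpace.comap (ζ q.1 q.2) inferInstance)
    (show (k, j) ∈ {q : ℕ × Fin b | q.1 = k} from rfl)

theorem map_batch [IsProbabilityMeasure P] (k : ℕ) :
    P.map (fun ω j => ζ k j ω) = Measure.pi fun _ : Fin b => D := by
  have hi : iIndepFun (fun j => ζ k j) P :=
    h.indep.precomp (g := fun j : Fin b => (k, j)) fun j j' hj => by simpa using hj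
  rw [(iIndepFun_iff_map_fun_eq_pi_map fun j => (h.meas k j).aemeasurable).1 hi]
  simp_rw [h.law]

end IsSample

end Sample


/-! ### Step sizes and smoothing parameters -/

/-- The cube root of `k + 2`. -/
noncomputable def cbrt (k : ℕ) : ℝ := ((k : ℝ) + 2) ^ (1 / 3 : ℝ)

theorem cbrt_pos (k : ℕ) : 0 < cbrt k := Real.rpow_pos_of_pos (by positivity) _

theorem one_le_cbrt (k : ℕ) : 1 ≤ cbrt k :=
  Real.one_le_rpow (by linarith [(Nat.cast_nonneg k : (0 : ℝ) ≤ k)]) (by norm_num)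

theorem cbrt_pow_three (k : ℕ) : cbrt k ^ 3 = (k : ℝ) + 2 := by
  rw [cbrt, ← Real.rpow_natCast, ← Real.rpow_mul (by positivity)]
  norm_num

theorem cbrt_pow_two (k : ℕ) : cbrt k ^ 2 = ((k : ℝ) + 2) ^ (2 / 3 : ℝ) := by
  rw [cbrt, ← Real.rpow_natCast, ← Real.rpow_mul (by positivity)]
  norm_num

theorem cbrt_le_cbrt_succ (k : ℕ) : cbrt k ≤ cbrt (k + 1) :=
  Real.rpow_le_rpow (by positivity) (by push_cast; linarith) (by norm_num)

namespace Params

variable {dx dy p : ℕ} {Ξ : Type*} [MeasurableSpace Ξ] {Q : Problem dx dy p Ξ} {l μ : ℝ}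
  {c : Params}

theorem eta_eq (c : Params) (k : ℕ) : c.eta k = c.A₃ / cbrt k := rfl

theorem varrho_succ (c : Params) (k : ℕ) : c.varrho (k + 1) = c.A₄ / cbrt (k + 1) ^ 2 := by
  rw [cbrt_pow_two, varrho, if_neg (Nat.succ_ne_zero k)]

theorem iota_succ (c : Params) (k : ℕ) : c.iota (k + 1) = c.A₅ / cbrt (k + 1) ^ 2 := by
  rw [cbrt_pow_two, iota, if_neg (Nat.succ_ne_zero k)]

/-- The denominator of the smoothing parameters `θ_{1,k}`. -/
noncomputable def W₁ (c : Params) (Q : Problem dx dy p Ξ) (l μ : ℝ) : ℝ :=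
  3 * c.D₁ Q l μ + 4 * c.α + 12 * c.A₁ / (c.b * c.A₃ ^ 2)

/-- The denominator of the smoothing parameters `θ_{2,k}`. -/
noncomputable def W₂ (c : Params) (Q : Problem dx dy p Ξ) (l μ : ℝ) : ℝ :=
  3 * c.D₁ Q l μ + 12 * c.A₂ / (c.b * c.A₃ ^ 2) + 320 * c.α * Q.lip l ^ 2 / μ ^ 2

namespace Admissible

variable (hc : c.Admissible Q l μ)
include hc

theorem eta_pos (k : ℕ) : 0 < c.eta k := div_pos hc.A₃_pos (cbrt_pos k)

theorem eta_le_A₃ (k : ℕ) : c.eta k ≤ c.A₃ := div_le_self hc.A₃_pos.le (one_le_cbrt k)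

theorem eta_le_one (k : ℕ) : c.eta k ≤ 1 :=
  (hc.eta_le_A₃ k).trans (hc.A₃_le.trans (min_le_left _ _))

theorem eta_le_div (k : ℕ) : c.eta k ≤ μ / (8 * c.α * Q.lip l ^ 2) :=
  (hc.eta_le_A₃ k).trans (hc.A₃_le.trans ((min_le_right _ _).trans (min_le_left _ _)))

theorem eta_succ_le (k : ℕ) : c.eta (k + 1) ≤ c.eta k := by
  have := hc.A₃_pos
  have := cbrt_pos k
  rw [eta_eq, eta_eq]
  gcongr
  exact cbrt_le_cbrt_succ k

theorem A₄_pos : 0 < c.A₄ := by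
  have := hc.A₁_pos
  have := hc.A₃_pos
  have := hc.α_pos
  exact lt_of_lt_of_le (by positivity) hc.A₄_ge

theorem A₅_pos (hμ : 0 < μ) : 0 < c.A₅ := by
  have := hc.A₂_pos
  have := hc.A₃_pos
  have := hc.α_pos
  exact lt_of_lt_of_le (by positivity) hc.A₅_ge

theorem varrho_nonneg (k : ℕ) : 0 ≤ c.varrho (k + 1) := by
  rw [varrho_succ]
  have := hc.A₄_pos
  positivity

theorem iota_nonneg (hμ : 0 < μ) (k : ℕ) : 0 ≤ c.iota (k + 1) := by
  rw [iota_succ]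
  have := hc.A₅_pos hμ
  positivity

theorem D₁_pos (hμ : 0 < μ) (hL : 0 < Q.lip l) : 0 < c.D₁ Q l μ := by
  have := hc.A₁_pos
  have := hc.A₂_pos
  have := hc.A₃_pos
  have := hc.A₄_pos
  have := hc.A₅_pos hμ
  have := hc.α_pos
  have := hc.β_pos
  have := hc.γ_pos
  refine div_pos ?_ (lt_of_lt_of_le three_pos
    ((le_max_right _ _).trans ((le_max_right _ _).trans (le_max_right _ _))))
  refine lt_min (by positivity) (lt_min (by positivity) (lt_min (by positivity)
    (lt_min (by positivity) (by positivity))))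

theorem W₁_pos (hμ : 0 < μ) (hL : 0 < Q.lip l) : 0 < c.W₁ Q l μ := by
  have := hc.A₁_pos
  have := hc.A₃_pos
  have := hc.α_pos
  have := hc.D₁_pos hμ hL
  have : (0 : ℝ) < c.b := Nat.cast_pos.2 hc.b_pos
  unfold W₁
  positivity

theorem W₂_pos (hμ : 0 < μ) (hL : 0 < Q.lip l) : 0 < c.W₂ Q l μ := by
  have := hc.A₂_pos
  have := hc.A₃_pos
  have := hc.α_pos
  have := hc.D₁_pos hμ hL
  have : (0 : ℝ) < c.b := Nat.cast_pos.2 hc.b_pos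
  unfold W₂
  positivity

end Admissible

theorem smoothing_nonneg {ε L S : ℝ} (hε : 0 ≤ ε) (hL : 0 ≤ L) (k : ℕ) :
    0 ≤ ε / (L * cbrt k) * √S := by
  have := cbrt_pos k
  positivity

theorem smoothing_pos {n : ℕ} {ε L D W : ℝ} (hε : 0 < ε) (hL : 0 < L) (hD : 0 < D) (hW : 0 < W)
    (k : ℕ) (hn : 0 < n) : 0 < ε / (L * cbrt k) * √(D / (n * W)) := by
  have := cbrt_pos k
  have : (0 : ℝ) < n := Nat.cast_pos.2 hn
  positivity

theorem smoothing_succ_le {ε L S : ℝ} (hε : 0 ≤ ε) (hL : 0 < L) (k : ℕ) :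
    ε / (L * cbrt (k + 1)) * √S ≤ ε / (L * cbrt k) * √S := by
  have := cbrt_pos k
  gcongr
  exact cbrt_le_cbrt_succ k

/-- The dimension and `L` in the smoothing parameter cancel the factors `√n` and `l` of the
finite-difference error. In dimension zero the quotient is a division by zero and both sides are
handled directly. -/
theorem smoothing_error_sq_le {n : ℕ} {l ε L D W : ℝ} (hl : 0 ≤ l) (hlL : l ≤ L) (hL : 0 < L)
    (hD : 0 < D) (hW : 0 < W) (k : ℕ) :
    (√n * (l * (ε / (L * cbrt k) * √(D / (n * W))) / 2)) ^ 2 ≤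
      1 / 4 * ε ^ 2 * (D / W) / cbrt k ^ 2 := by
  have hr := cbrt_pos k
  rcases Nat.eq_zero_or_pos n with rfl | hn
  · simp
    positivity
  have hn' : (0 : ℝ) < n := Nat.cast_pos.2 hn
  have e : (√n * (l * (ε / (L * cbrt k) * √(D / (n * W))) / 2)) ^ 2 =
      (l / L) ^ 2 * (1 / 4 * ε ^ 2 * (D / W) / cbrt k ^ 2) := by
    have h1 : √(n : ℝ) ^ 2 = n := Real.sq_sqrt hn'.le
    have h2 : √(D / (n * W)) ^ 2 = D / (n * W) := Real.sq_sqrt (by positivity)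
    calc _ = √(n : ℝ) ^ 2 * (l ^ 2 * ε ^ 2 / (L * cbrt k) ^ 2 * √(D / (n * W)) ^ 2) / 4 := by ring
      _ = _ := by
        rw [h1, h2]
        field_simp
  rw [e]
  refine mul_le_of_le_one_left (by positivity) ?_
  exact pow_le_one₀ (by positivity) ((div_le_one hL).2 hlL)

end Params

/-! ### Runs of the algorithm -/

/-- A run of the algorithm under the standing assumptions. -/
structure Run {dx dy p : ℕ} {Ξ : Type*} [MeasurableSpace Ξ] (Q : Problem dx dy p Ξ)
    (U : Set (Vec dx)) (V : Set (Vec dy)) (l μ δ : ℝ) (c : Params) (ε : ℝ) {Ω : Type*}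
    [MeasurableSpace Ω] (P : Measure Ω) (ζ : ℕ → Fin c.b → Ω → Ξ) (it : Iterates dx dy p Ω)
    (x₁ : Vec dx) (y₁ : Vec dy) (lam₁ : Vec p) : Prop where
  reg : Q.Regular U V l μ
  smooth : Q.Smooth U V l
  adm : c.Admissible Q l μ
  ε_pos : 0 < ε
  stencil : Q.Stencil U V (c.theta₁ Q l μ ε) (c.theta₂ Q l μ ε)
  var : Q.BoundedVariance δ (c.theta₁ Q l μ ε) (c.theta₂ Q l μ ε)
  sample : IsSample Q.D P ζ
  gen : IsGenerated Q c (c.theta₁ Q l μ ε) (c.theta₂ Q l μ ε) ζ x₁ y₁ lam₁ it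
  x₁_mem : x₁ ∈ Q.X
  y₁_mem : y₁ ∈ Q.Y
  lam₁_mem : lam₁ ∈ Q.mult

namespace Problem

variable {dx dy p : ℕ} {Ξ : Type*} [MeasurableSpace Ξ]

theorem exists_resid_bound (Q : Problem dx dy p Ξ) :
    ∃ R, 0 ≤ R ∧ ∀ x ∈ Q.X, ∀ y ∈ Q.Y, ‖Q.resid x y‖ ≤ R := by
  have hc : ContinuousOn (fun q : Vec dx × Vec dy => Q.resid q.1 q.2) (Q.X ×ˢ Q.Y) := by
    unfold resid
    fun_prop
  obtain ⟨R, hR⟩ := (Q.X_compact.prod Q.Y_compact).exists_bound_of_continuousOn hc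
  exact ⟨max R 0, le_max_right _ _, fun x hx y hy => (hR (x, y) ⟨hx, hy⟩).trans (le_max_left _ _)⟩

theorem norm_sub_le_of_mem_Y (Q : Problem dx dy p Ξ) {y y' : Vec dy} (hy : y ∈ Q.Y)
    (hy' : y' ∈ Q.Y) : ‖y - y'‖ ≤ 2 * Q.sigmaY := by
  have h : ∀ y ∈ Q.Y, ‖y‖ ≤ Q.sigmaY := fun y hy =>
    le_csSup (Q.Y_compact.image continuous_norm).bddAbove ⟨y, hy, rfl⟩
  linarith [norm_sub_le y y', h y hy, h y' hy']

end Problem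

namespace Run

variable {dx dy p : ℕ} {Ξ : Type*} [MeasurableSpace Ξ] {Q : Problem dx dy p Ξ}
  {U : Set (Vec dx)} {V : Set (Vec dy)} {l μ δ : ℝ} {c : Params} {ε : ℝ} {Ω : Type*}
  [mΩ : MeasurableSpace Ω] {P : Measure Ω} {ζ : ℕ → Fin c.b → Ω → Ξ}
  {it : Iterates dx dy p Ω} {x₁ : Vec dx} {y₁ : Vec dy} {lam₁ : Vec p}
  (h : Run Q U V l μ δ c ε P ζ it x₁ y₁ lam₁)
include h

theorem lip_pos : 0 < Q.lip l := h.reg.l_pos.trans_le (Q.l_le l)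

theorem D₁_pos : 0 < c.D₁ Q l μ := h.adm.D₁_pos h.reg.μ_pos h.lip_pos

theorem W₁_pos : 0 < c.W₁ Q l μ := h.adm.W₁_pos h.reg.μ_pos h.lip_pos

theorem W₂_pos : 0 < c.W₂ Q l μ := h.adm.W₂_pos h.reg.μ_pos h.lip_pos

theorem theta₁_nonneg (k : ℕ) : 0 ≤ c.theta₁ Q l μ ε k :=
  Params.smoothing_nonneg h.ε_pos.le h.lip_pos.le k

theorem theta₂_nonneg (k : ℕ) : 0 ≤ c.theta₂ Q l μ ε k :=
  Params.smoothing_nonneg h.ε_pos.le h.lip_pos.le k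

theorem theta₁_pos (k : ℕ) (hn : 0 < dx) : 0 < c.theta₁ Q l μ ε k :=
  Params.smoothing_pos h.ε_pos h.lip_pos h.D₁_pos h.W₁_pos k hn

theorem theta₂_pos (k : ℕ) (hn : 0 < dy) : 0 < c.theta₂ Q l μ ε k :=
  Params.smoothing_pos h.ε_pos h.lip_pos h.D₁_pos h.W₂_pos k hn

theorem theta₁_succ_le (k : ℕ) : c.theta₁ Q l μ ε (k + 1) ≤ c.theta₁ Q l μ ε k :=
  Params.smoothing_succ_le h.ε_pos.le h.lip_pos k

theorem theta₂_succ_le (k : ℕ) : c.theta₂ Q l μ ε (k + 1) ≤ c.theta₂ Q l μ ε k :=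
  Params.smoothing_succ_le h.ε_pos.le h.lip_pos k

theorem smoothing₁_sq_le (k : ℕ) : (√dx * (l * c.theta₁ Q l μ ε k / 2)) ^ 2 ≤
    1 / 4 * ε ^ 2 * (c.D₁ Q l μ / c.W₁ Q l μ) / cbrt k ^ 2 :=
  Params.smoothing_error_sq_le h.reg.l_pos.le (Q.l_le l) h.lip_pos h.D₁_pos h.W₁_pos k

theorem smoothing₂_sq_le (k : ℕ) : (√dy * (l * c.theta₂ Q l μ ε k / 2)) ^ 2 ≤
    1 / 4 * ε ^ 2 * (c.D₁ Q l μ / c.W₂ Q l μ) / cbrt k ^ 2 :=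
  Params.smoothing_error_sq_le h.reg.l_pos.le (Q.l_le l) h.lip_pos h.D₁_pos h.W₂_pos k

theorem norm_lagrX_sub_popX_le (k : ℕ) {x : Vec dx} (hx : x ∈ Q.X) {y : Vec dy} (hy : y ∈ Q.Y)
    (lam : Vec p) :
    ‖Q.lagrX x y lam - Q.popX (c.theta₁ Q l μ ε (k + 1)) x y lam‖ ≤
      √dx * (l * c.theta₁ Q l μ ε (k + 1) / 2) := by
  rw [Problem.lagrX, Problem.popX, sub_sub_sub_cancel_right, norm_sub_rev]
  have hyV := h.reg.Y_sub hy
  exact norm_fdGrad_sub_gradient_le h.reg.l_pos.le (h.theta₁_nonneg _) (h.theta₁_pos _)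
    (fun u hu => h.reg.sm.diff_x u hu y hyV)
    (fun u hu u' hu' => h.reg.sm.lip_xx u hu u' hu' y hyV)
    (h.stencil.seg_x (k + 1) (Nat.le_add_left 1 k) x hx)

theorem norm_lagrY_sub_popY_le (k : ℕ) {x : Vec dx} (hx : x ∈ Q.X) {y : Vec dy} (hy : y ∈ Q.Y)
    (lam : Vec p) :
    ‖Q.lagrY x y lam - Q.popY (c.theta₂ Q l μ ε (k + 1)) x y lam‖ ≤
      √dy * (l * c.theta₂ Q l μ ε (k + 1) / 2) := by
  rw [Problem.lagrY, Problem.popY, sub_sub_sub_cancel_right, norm_sub_rev]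
  have hxU := h.reg.X_sub hx
  exact norm_fdGrad_sub_gradient_le h.reg.l_pos.le (h.theta₂_nonneg _) (h.theta₂_pos _)
    (fun u hu => h.reg.sm.diff_y x hxU u hu)
    (fun u hu u' hu' => h.reg.sm.lip_yy x hxU u hu u' hu')
    (h.stencil.seg_y (k + 1) (Nat.le_add_left 1 k) y hy)

theorem mem (k : ℕ) (ω : Ω) :
    it.x (k + 1) ω ∈ Q.X ∧ it.y (k + 1) ω ∈ Q.Y ∧ it.lam (k + 1) ω ∈ Q.mult := by
  induction k with
  | zero => exact ⟨by simpa [h.gen.init_x] using h.x₁_mem, by simpa [h.gen.init_y] using h.y₁_mem,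
      by simpa [h.gen.init_lam] using h.lam₁_mem⟩
  | succ k ih =>
    have hη := (h.adm.eta_pos (k + 1)).le
    have hη1 := h.adm.eta_le_one (k + 1)
    have hk : 1 ≤ k + 1 := Nat.le_add_left 1 k
    refine ⟨?_, ?_, ?_⟩
    · rw [h.gen.upd_x _ hk]
      exact Problem.add_smul_proj_mem Q.X_nonempty Q.X_compact.isClosed Q.X_convex ih.1 _ hη hη1
    · rw [h.gen.upd_y _ hk]
      exact Problem.add_smul_proj_mem Q.Y_nonempty Q.Y_compact.isClosed Q.Y_convex ih.2.1 _ hη hη1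
    · rw [h.gen.upd_lam _ hk]
      exact Problem.add_smul_proj_mem Q.mult_nonempty Q.mult_isClosed Q.mult_convex ih.2.2 _ hη hη1

theorem x_mem (k : ℕ) (ω : Ω) : it.x (k + 1) ω ∈ Q.X := (h.mem k ω).1

theorem y_mem (k : ℕ) (ω : Ω) : it.y (k + 1) ω ∈ Q.Y := (h.mem k ω).2.1

theorem lam_mem (k : ℕ) (ω : Ω) : it.lam (k + 1) ω ∈ Q.mult := (h.mem k ω).2.2

/-- Since the multiplier already lies in the multiplier set, nonexpansiveness bounds its step by `γ
R`. The bound grows with `k`; it serves for integrability at each index and for `C₁`, where only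
index `2` matters. -/
theorem norm_lam_le {R : ℝ} (hR : ∀ x ∈ Q.X, ∀ y ∈ Q.Y, ‖Q.resid x y‖ ≤ R) (k : ℕ) (ω : Ω) :
    ‖it.lam (k + 1) ω‖ ≤ ‖lam₁‖ + k * (c.γ * R) := by
  induction k with
  | zero => simp [h.gen.init_lam]
  | succ k ih =>
    have hη := (h.adm.eta_pos (k + 1)).le
    have hη1 := h.adm.eta_le_one (k + 1)
    have hγ := h.adm.γ_pos
    have hr := hR _ (h.x_mem (k + 1) ω) _ (h.y_mem (k + 1) ω)
    rw [h.gen.upd_lam _ (Nat.le_add_left 1 k)]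
    set a := it.lam (k + 1) ω
    have hp := norm_proj_sub_proj_le Q.mult_nonempty Q.mult_isClosed Q.mult_convex
      (a + c.γ • Q.resid (it.x (k + 1 + 1) ω) (it.y (k + 1 + 1) ω)) a
    rw [proj_eq_self Q.mult_nonempty Q.mult_isClosed (h.lam_mem k ω), add_sub_cancel_left,
      norm_smul, Real.norm_of_nonneg hγ.le] at hp
    refine (norm_add_le _ _).trans ?_
    rw [norm_smul, Real.norm_of_nonneg hη]
    have h1 := mul_le_of_le_one_left (norm_nonneg (proj Q.mult
      (a + c.γ • Q.resid (it.x (k + 1 + 1) ω) (it.y (k + 1 + 1) ω)) - a)) hη1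
    have h2 := mul_le_mul_of_nonneg_left hr hγ.le
    push_cast
    linarith

/-! ### Adaptedness -/

omit h mΩ in
theorem measurable_relaxed_proj {n : ℕ} {m : MeasurableSpace Ω} {Z : Set (Vec n)}
    (hne : Z.Nonempty) (hcl : IsClosed Z) (hco : Convex ℝ Z) (η : ℝ) {x u : Ω → Vec n}
    (hx : Measurable x) (hu : Measurable u) :
    Measurable fun ω => x ω + η • (proj Z (u ω) - x ω) :=
  hx.add ((((continuous_proj hne hcl hco).measurable.comp hu).sub hx).const_smul η)

/-- The `σ`-algebra is arbitrary so that the statement applies to `past` as well as to the ambient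
one. -/
theorem measurable_batchX {Ω' : Type*} {m : MeasurableSpace Ω'} (k : ℕ) {x : Ω' → Vec dx}
    {y : Ω' → Vec dy}
    {lam : Ω' → Vec p} {ξ : Ω' → Fin c.b → Ξ} (hx : Measurable x) (hy : Measurable y)
    (hlam : Measurable lam) (hξ : ∀ j, Measurable fun ω => ξ ω j) (hxX : ∀ ω, x ω ∈ Q.X)
    (hyY : ∀ ω, y ω ∈ Q.Y) : Measurable fun ω =>
      Q.batchX (c.theta₁ Q l μ ε (k + 1)) (x ω) (y ω) (lam ω) (ξ ω) := by
  unfold Problem.batchX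
  refine Measurable.const_smul ?_ (1 / (c.b : ℝ))
  refine Finset.measurable_fun_sum _ fun j _ => ?_
  refine Measurable.sub ?_ ?_
  · exact measurable_fdGrad_comp h.smooth.smoothFun_G h.smooth.meas hx hy (hξ j)
      (fun ω => h.reg.X_sub (hxX ω)) (fun ω i => h.stencil.seg_x (k + 1) (Nat.le_add_left 1 k) _
        (hxX ω) i (right_mem_segment ℝ _ _)) (fun ω => h.reg.Y_sub (hyY ω))
  · exact (ContinuousLinearMap.continuous _).measurable.comp hlam

theorem measurable_batchY {Ω' : Type*} {m : MeasurableSpace Ω'} (k : ℕ) {x : Ω' → Vec dx}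
    {y : Ω' → Vec dy}
    {lam : Ω' → Vec p} {ξ : Ω' → Fin c.b → Ξ} (hx : Measurable x) (hy : Measurable y)
    (hlam : Measurable lam) (hξ : ∀ j, Measurable fun ω => ξ ω j) (hxX : ∀ ω, x ω ∈ Q.X)
    (hyY : ∀ ω, y ω ∈ Q.Y) : Measurable fun ω =>
      Q.batchY (c.theta₂ Q l μ ε (k + 1)) (x ω) (y ω) (lam ω) (ξ ω) := by
  unfold Problem.batchY
  refine Measurable.const_smul ?_ (1 / (c.b : ℝ))
  refine Finset.measurable_fun_sum _ fun j _ => ?_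
  refine Measurable.sub ?_ ?_
  · exact measurable_fdGrad_comp (fun z => (h.smooth.smoothFun_G z).flip)
      (fun y hy x hx => h.smooth.meas x hx y hy) hy hx (hξ j)
      (fun ω => h.reg.Y_sub (hyY ω)) (fun ω i => h.stencil.seg_y (k + 1) (Nat.le_add_left 1 k) _
        (hyY ω) i (right_mem_segment ℝ _ _)) (fun ω => h.reg.X_sub (hxX ω))
  · exact (ContinuousLinearMap.continuous _).measurable.comp hlam

theorem measurable_popX {Ω' : Type*} {m : MeasurableSpace Ω'} (k : ℕ) {x : Ω' → Vec dx}
    {y : Ω' → Vec dy}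
    {lam : Ω' → Vec p} (hx : Measurable x) (hy : Measurable y)
    (hlam : Measurable lam) (hxX : ∀ ω, x ω ∈ Q.X) (hyY : ∀ ω, y ω ∈ Q.Y) : Measurable fun ω =>
      Q.popX (c.theta₁ Q l μ ε (k + 1)) (x ω) (y ω) (lam ω) := by
  unfold Problem.popX
  refine Measurable.sub ?_ ?_
  · exact measurable_fdGrad_comp (Ξ := Unit) (G := fun x y _ => Q.g x y) (fun _ => h.reg.sm)
      (fun _ _ _ _ => measurable_const) hx hy (ζ := fun _ => ()) measurable_const
      (fun ω => h.reg.X_sub (hxX ω)) (fun ω i => h.stencil.seg_x (k + 1) (Nat.le_add_left 1 k) _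
        (hxX ω) i (right_mem_segment ℝ _ _)) (fun ω => h.reg.Y_sub (hyY ω))
  · exact (ContinuousLinearMap.continuous _).measurable.comp hlam

theorem measurable_popY {Ω' : Type*} {m : MeasurableSpace Ω'} (k : ℕ) {x : Ω' → Vec dx}
    {y : Ω' → Vec dy}
    {lam : Ω' → Vec p} (hx : Measurable x) (hy : Measurable y)
    (hlam : Measurable lam) (hxX : ∀ ω, x ω ∈ Q.X) (hyY : ∀ ω, y ω ∈ Q.Y) : Measurable fun ω =>
      Q.popY (c.theta₂ Q l μ ε (k + 1)) (x ω) (y ω) (lam ω) := by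
  unfold Problem.popY
  refine Measurable.sub ?_ ?_
  · exact measurable_fdGrad_comp (Ξ := Unit) (G := fun y x _ => Q.g x y)
      (fun _ => h.reg.sm.flip)
      (fun _ _ _ _ => measurable_const) hy hx (ζ := fun _ => ()) measurable_const
      (fun ω => h.reg.Y_sub (hyY ω)) (fun ω i => h.stencil.seg_y (k + 1) (Nat.le_add_left 1 k) _
        (hyY ω) i (right_mem_segment ℝ _ _)) (fun ω => h.reg.X_sub (hxX ω))
  · exact (ContinuousLinearMap.continuous _).measurable.comp hlam

end Run


/-! ### Measurability and integrability tools -/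

theorem measurable_comp_of_continuousOn {α β Ω : Type*} [TopologicalSpace α] [MeasurableSpace α]
    [OpensMeasurableSpace α] [TopologicalSpace β] [MeasurableSpace β] [BorelSpace β]
    {mΩ : MeasurableSpace Ω} {f : α → β} {s : Set α} (hf : ContinuousOn f s) {u : Ω → α}
    (hu : Measurable u) (hs : ∀ ω, u ω ∈ s) : Measurable fun ω => f (u ω) := by
  have h1 : Continuous (s.domRestrict f) := continuousOn_iff_continuous_domRestrict.1 hf
  exact h1.measurable.comp (hu.subtype_mk (h := hs))

theorem integrable_of_abs_le {Ω : Type*} [MeasurableSpace Ω] {P : Measure Ω}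
    [IsProbabilityMeasure P]
    {f : Ω → ℝ} (hf : Measurable f) {C : ℝ} (hC : ∀ ω, |f ω| ≤ C) : Integrable f P :=
  Integrable.of_bound hf.aestronglyMeasurable C (Filter.Eventually.of_forall hC)

theorem integrable_norm_sq_of_le {Ω : Type*} [MeasurableSpace Ω] {P : Measure Ω}
    [IsProbabilityMeasure P] {n : ℕ} {f : Ω → Vec n} (hf : Measurable f) {C : ℝ}
    (hC : ∀ ω, ‖f ω‖ ≤ C) : Integrable (fun ω => ‖f ω‖ ^ 2) P :=
  integrable_of_abs_le (hf.norm.pow_const 2) (C := C ^ 2) fun ω => by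
    rw [abs_of_nonneg (sq_nonneg _)]
    exact pow_le_pow_left₀ (norm_nonneg _) (hC ω) 2

namespace Problem

variable {dx dy p : ℕ} {Ξ : Type*} [MeasurableSpace Ξ] {Q : Problem dx dy p Ξ}
  {U : Set (Vec dx)} {V : Set (Vec dy)} {l μ : ℝ}

namespace Regular

variable (h : Q.Regular U V l μ)
include h

/-- The maximizer is defined by choice, so its measurability along the iterates is not automatic; it
comes from the Lipschitz bound that strong concavity provides. -/
theorem continuousOn_yStar :
    ContinuousOn (fun q : Vec dx × Vec p => Q.yStar q.1 q.2) (Q.X ×ˢ Set.univ) := by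
  intro q hq
  rw [ContinuousWithinAt, tendsto_iff_norm_sub_tendsto_zero]
  have hμ := h.μ_pos
  have hlim : Filter.Tendsto (fun q' : Vec dx × Vec p =>
      (l * ‖q'.1 - q.1‖ + ‖Q.B‖ * ‖q'.2 - q.2‖) / μ)
      (nhdsWithin q (Q.X ×ˢ Set.univ)) (nhds 0) := by
    have : Continuous (fun q' : Vec dx × Vec p =>
        (l * ‖q'.1 - q.1‖ + ‖Q.B‖ * ‖q'.2 - q.2‖) / μ) := by
      fun_prop
    simpa using (this.tendsto q).mono_left nhdsWithin_le_nhds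
  refine squeeze_zero' (Filter.Eventually.of_forall fun _ => norm_nonneg _) ?_ hlim
  filter_upwards [self_mem_nhdsWithin] with q' hq'
  rw [le_div_iff₀ hμ, mul_comm]
  exact h.norm_yStar_sub_le hq'.1 hq.1 _ _

theorem continuousOn_Phi :
    ContinuousOn (fun q : Vec dx × Vec p => Q.Phi q.1 q.2) (Q.X ×ˢ Set.univ) := by
  have hy := h.continuousOn_yStar
  have hg : ContinuousOn (fun q : Vec dx × Vec p => Q.g q.1 (Q.yStar q.1 q.2))
      (Q.X ×ˢ Set.univ) :=
    h.continuousOn_g.comp (f := fun q : Vec dx × Vec p => (q.1, Q.yStar q.1 q.2))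
      (continuousOn_fst.prodMk hy) fun q hq => ⟨hq.1, h.yStar_mem hq.1 _⟩
  have hB : ContinuousOn (fun q : Vec dx × Vec p => Q.B (Q.yStar q.1 q.2)) (Q.X ×ˢ Set.univ) :=
    Q.B.continuous.comp_continuousOn hy
  have hr : ContinuousOn (fun q : Vec dx × Vec p => Q.resid q.1 (Q.yStar q.1 q.2))
      (Q.X ×ˢ Set.univ) := by
    unfold resid
    fun_prop
  have hl : ContinuousOn (fun q : Vec dx × Vec p => Q.lagr q.1 (Q.yStar q.1 q.2) q.2)
      (Q.X ×ˢ Set.univ) := by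
    unfold lagr
    fun_prop
  exact hl.congr fun q hq => h.Phi_eq hq.1 _

theorem continuousOn_lagrX : ContinuousOn (fun q : (Vec dx × Vec dy) × Vec p =>
    Q.lagrX q.1.1 q.1.2 q.2) ((Q.X ×ˢ Q.Y) ×ˢ Set.univ) := by
  have h1 : ContinuousOn (fun q : (Vec dx × Vec dy) × Vec p =>
      gradient (fun x' => Q.g x' q.1.2) q.1.1) ((Q.X ×ˢ Q.Y) ×ˢ Set.univ) :=
    h.sm.continuousOn_gradient.comp continuousOn_fst
      fun q hq => ⟨h.X_sub hq.1.1, h.Y_sub hq.1.2⟩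
  exact h1.sub ((ContinuousLinearMap.continuous _).comp_continuousOn continuousOn_snd)

theorem continuousOn_lagrY : ContinuousOn (fun q : (Vec dx × Vec dy) × Vec p =>
    Q.lagrY q.1.1 q.1.2 q.2) ((Q.X ×ˢ Q.Y) ×ˢ Set.univ) := by
  have h1 : ContinuousOn (fun q : (Vec dx × Vec dy) × Vec p =>
      gradient (fun y' => Q.g q.1.1 y') q.1.2) ((Q.X ×ˢ Q.Y) ×ˢ Set.univ) :=
    h.sm.flip.continuousOn_gradient.comp (f := fun q : (Vec dx × Vec dy) × Vec p => (q.1.2, q.1.1))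
      (by fun_prop) fun q hq => ⟨h.Y_sub hq.1.2, h.X_sub hq.1.1⟩
  exact h1.sub ((ContinuousLinearMap.continuous _).comp_continuousOn continuousOn_snd)

theorem measurable_norm_gap_sq {α β γ : ℝ} (hα : 0 < α) (hβ : 0 < β) (hγ : 0 < γ) {Ω : Type*}
    {mΩ : MeasurableSpace Ω} {x : Ω → Vec dx} {y : Ω → Vec dy} {lam : Ω → Vec p}
    (hx : Measurable x) (hy : Measurable y) (hlam : Measurable lam) (hxX : ∀ ω, x ω ∈ Q.X)
    (hyY : ∀ ω, y ω ∈ Q.Y) :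
    Measurable fun ω => ‖Q.gap α β γ (x ω) (y ω) (lam ω)‖ ^ 2 := by
  have hu : Measurable fun ω => ((x ω, y ω), lam ω) := (hx.prodMk hy).prodMk hlam
  have hmem : ∀ ω, ((x ω, y ω), lam ω) ∈ (Q.X ×ˢ Q.Y) ×ˢ Set.univ := fun ω =>
    ⟨⟨hxX ω, hyY ω⟩, trivial⟩
  have m1 := measurable_comp_of_continuousOn h.continuousOn_lagrX hu hmem
  have m2 := measurable_comp_of_continuousOn h.continuousOn_lagrY hu hmem
  have m3 : Measurable fun ω => Q.resid (x ω) (y ω) := by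
    unfold resid
    exact ((Q.A.continuous.measurable.comp hx).add (Q.B.continuous.measurable.comp hy)).sub_const _
  have p1 := (continuous_proj Q.X_nonempty Q.X_compact.isClosed Q.X_convex).measurable
  have p2 := (continuous_proj Q.Y_nonempty Q.Y_compact.isClosed Q.Y_convex).measurable
  have p3 := (continuous_proj Q.mult_nonempty Q.mult_isClosed Q.mult_convex).measurable
  have q1 : Measurable fun ω =>
      (1 / α * ‖x ω - proj Q.X (x ω - α • Q.lagrX (x ω) (y ω) (lam ω))‖) ^ 2 := by
    have r1 : Measurable fun ω => α • Q.lagrX (x ω) (y ω) (lam ω) := m1.const_smul α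
    have r2 : Measurable fun ω => proj Q.X (x ω - α • Q.lagrX (x ω) (y ω) (lam ω)) :=
      p1.comp (hx.sub r1)
    exact ((hx.sub r2).norm.const_mul (1 / α)).pow_const 2
  have q2 : Measurable fun ω =>
      (1 / β * ‖y ω - proj Q.Y (y ω + β • Q.lagrY (x ω) (y ω) (lam ω))‖) ^ 2 := by
    have r1 : Measurable fun ω => β • Q.lagrY (x ω) (y ω) (lam ω) := m2.const_smul β
    have r2 : Measurable fun ω => proj Q.Y (y ω + β • Q.lagrY (x ω) (y ω) (lam ω)) :=
      p2.comp (hy.add r1)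
    exact ((hy.sub r2).norm.const_mul (1 / β)).pow_const 2
  have q3 : Measurable fun ω =>
      (1 / γ * ‖lam ω - proj Q.mult (lam ω + γ • Q.resid (x ω) (y ω))‖) ^ 2 := by
    have r1 : Measurable fun ω => γ • Q.resid (x ω) (y ω) := m3.const_smul γ
    have r2 : Measurable fun ω => proj Q.mult (lam ω + γ • Q.resid (x ω) (y ω)) :=
      p3.comp (hlam.add r1)
    exact ((hlam.sub r2).norm.const_mul (1 / γ)).pow_const 2
  have q := (q1.add q2).add q3
  have e : (fun ω => ‖Q.gap α β γ (x ω) (y ω) (lam ω)‖ ^ 2) = _ := funext fun ω =>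
    h.norm_gap_sq (hxX ω) (hyY ω) (lam ω) hα hβ hγ
  rw [e]
  exact q

end Regular

end Problem

/-! ### Errors of the momentum estimators -/

/-- The error of the `x`-gradient estimator. -/
noncomputable def errX {dx dy p : ℕ} {Ξ : Type*} [MeasurableSpace Ξ] (Q : Problem dx dy p Ξ)
    (c : Params) (l μ ε : ℝ) {Ω : Type*} (it : Iterates dx dy p Ω) (k : ℕ) (ω : Ω) : Vec dx :=
  it.v k ω - Q.popX (c.theta₁ Q l μ ε k) (it.x k ω) (it.y k ω) (it.lam k ω)

/-- The error of the `y`-gradient estimator. -/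
noncomputable def errY {dx dy p : ℕ} {Ξ : Type*} [MeasurableSpace Ξ] (Q : Problem dx dy p Ξ)
    (c : Params) (l μ ε : ℝ) {Ω : Type*} (it : Iterates dx dy p Ω) (k : ℕ) (ω : Ω) : Vec dy :=
  it.w k ω - Q.popY (c.theta₂ Q l μ ε k) (it.x k ω) (it.y k ω) (it.lam k ω)

theorem average_sub_const {n b : ℕ} (hb : 0 < b) (F : Fin b → Vec n) (a : Vec n) :
    (1 / (b : ℝ)) • ∑ j, (F j - a) = (1 / (b : ℝ)) • ∑ j, F j - a := by
  have hb' : (b : ℝ) ≠ 0 := by positivity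
  rw [Finset.sum_sub_distrib, smul_sub, Finset.sum_const, Finset.card_univ, Fintype.card_fin,
    ← Nat.cast_smul_eq_nsmul ℝ, smul_smul, one_div_mul_cancel hb', one_smul]

/-- Cauchy–Schwarz with weights satisfying `1/9 + 2/9 + 4/6 = 1`. The weights are uneven on purpose:
`x`-displacements get `9` and `y`-displacements `9/2` in both recursions, as the coefficients in
`displacement_coeff` require; the primed version is the mirror image for the `y`-estimator. -/
theorem add_add_sq_le (a b c : ℝ) :
    (a + b + 2 * c) ^ 2 ≤ 9 * a ^ 2 + 9 / 2 * b ^ 2 + 6 * c ^ 2 := by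
  nlinarith [sq_nonneg (2 * a - b), sq_nonneg (3 * a - c), sq_nonneg (3 * b - 2 * c)]

theorem add_add_sq_le' (a b c : ℝ) :
    (a + b + 2 * c) ^ 2 ≤ 9 / 2 * a ^ 2 + 9 * b ^ 2 + 6 * c ^ 2 := by
  linarith [add_add_sq_le b a c]

/-- The multiplier parts `a` and `a'` are deterministic given the past and cancel, so only the noise
of the finite differences enters the recursion. -/
theorem momentum_error_eq {n b : ℕ} (hb : 0 < b) (F' F : Fin b → Vec n) (f' f a' a v : Vec n)
    (r : ℝ) :
    (1 / (b : ℝ)) • ∑ j, (F' j - a') + r • (v - (1 / (b : ℝ)) • ∑ j, (F j - a)) - (f' - a') =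
      r • (v - (f - a)) + (1 / (b : ℝ)) • ∑ j, ((F' j - f') - r • (F j - f)) := by
  have e : ∑ j, ((F' j - f') - r • (F j - f)) = ∑ j, (F' j - f') - r • ∑ j, (F j - f) := by
    rw [Finset.sum_sub_distrib, Finset.smul_sum]
  rw [e, smul_sub (1 / (b : ℝ)), smul_comm (1 / (b : ℝ)) r, average_sub_const hb F' a',
    average_sub_const hb F a, average_sub_const hb F' f', average_sub_const hb F f]
  module

namespace Run

variable {dx dy p : ℕ} {Ξ : Type*} [MeasurableSpace Ξ] {Q : Problem dx dy p Ξ}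
  {U : Set (Vec dx)} {V : Set (Vec dy)} {l μ δ : ℝ} {c : Params} {ε : ℝ} {Ω : Type*}
  [mΩ : MeasurableSpace Ω] {P : Measure Ω} {ζ : ℕ → Fin c.b → Ω → Ξ}
  {it : Iterates dx dy p Ω} {x₁ : Vec dx} {y₁ : Vec dy} {lam₁ : Vec p}
  (h : Run Q U V l μ δ c ε P ζ it x₁ y₁ lam₁)
include h

/-- Mind the shift: `ζ k` is the batch `I_{k+1}`. Thus `x_{k+1}`, `y_{k+1}`, `λ_{k+1}` depend on the
first `k` batches, while `v_{k+1}`, `w_{k+1}` also see `ζ k`. This is what makes `ζ (k + 1)`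
independent of everything that enters the error at index `k + 2` except itself. -/
theorem adapted (k : ℕ) :
    (Measurable[past ζ k] (it.x (k + 1)) ∧ Measurable[past ζ k] (it.y (k + 1)) ∧
      Measurable[past ζ k] (it.lam (k + 1))) ∧
    Measurable[past ζ (k + 1)] (it.v (k + 1)) ∧ Measurable[past ζ (k + 1)] (it.w (k + 1)) := by
  induction k with
  | zero =>
    have hx : Measurable[past ζ 0] (it.x 1) := by
      rw [funext h.gen.init_x]
      exact measurable_const
    have hy : Measurable[past ζ 0] (it.y 1) := by
      rw [funext h.gen.init_y]
      exact measurable_const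
    have hlam : Measurable[past ζ 0] (it.lam 1) := by
      rw [funext h.gen.init_lam]
      exact measurable_const
    have hmono := past_mono ζ (Nat.zero_le 1)
    refine ⟨⟨hx, hy, hlam⟩, ?_, ?_⟩
    · rw [funext (h.gen.upd_v 0)]
      simp only [Params.varrho, if_true, sub_self, zero_smul, add_zero]
      exact h.measurable_batchX 0 (hx.mono hmono le_rfl) (hy.mono hmono le_rfl)
        (hlam.mono hmono le_rfl) (measurable_past ζ 0) (h.x_mem 0) (h.y_mem 0)
    · rw [funext (h.gen.upd_w 0)]
      simp only [Params.iota, if_true, sub_self, zero_smul, add_zero]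
      exact h.measurable_batchY 0 (hx.mono hmono le_rfl) (hy.mono hmono le_rfl)
        (hlam.mono hmono le_rfl) (measurable_past ζ 0) (h.x_mem 0) (h.y_mem 0)
  | succ k ih =>
    obtain ⟨⟨hx, hy, hlam⟩, hv, hw⟩ := ih
    have hm1 := past_mono ζ (Nat.le_succ k)
    have hm2 := past_mono ζ (Nat.le_succ (k + 1))
    have hx1 := hx.mono hm1 le_rfl
    have hy1 := hy.mono hm1 le_rfl
    have hlam1 := hlam.mono hm1 le_rfl
    have hk : 1 ≤ k + 1 := Nat.le_add_left 1 k
    have hx' : Measurable[past ζ (k + 1)] (it.x (k + 1 + 1)) := by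
      rw [funext (h.gen.upd_x (k + 1) hk)]
      exact measurable_relaxed_proj Q.X_nonempty Q.X_compact.isClosed Q.X_convex _ hx1
        (hx1.sub (hv.const_smul c.α))
    have hy' : Measurable[past ζ (k + 1)] (it.y (k + 1 + 1)) := by
      rw [funext (h.gen.upd_y (k + 1) hk)]
      exact measurable_relaxed_proj Q.Y_nonempty Q.Y_compact.isClosed Q.Y_convex _ hy1
        (hy1.add (hw.const_smul c.β))
    have hlam' : Measurable[past ζ (k + 1)] (it.lam (k + 1 + 1)) := by
      rw [funext (h.gen.upd_lam (k + 1) hk)]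
      refine measurable_relaxed_proj Q.mult_nonempty Q.mult_isClosed Q.mult_convex _ hlam1
        (hlam1.add (Measurable.const_smul ?_ c.γ))
      exact ((Q.A.continuous.measurable.comp hx').add
        (Q.B.continuous.measurable.comp hy')).sub_const _
    refine ⟨⟨hx', hy', hlam'⟩, ?_, ?_⟩
    · rw [funext (h.gen.upd_v (k + 1))]
      have hb : Measurable[past ζ (k + 1 + 1)] fun ω => it.v (k + 1) ω -
          Q.batchX (c.theta₁ Q l μ ε (k + 1)) (it.x (k + 1) ω) (it.y (k + 1) ω) (it.lam (k + 1) ω)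
            (fun j => ζ (k + 1) j ω) :=
        (hv.mono hm2 le_rfl).sub (h.measurable_batchX k (hx1.mono hm2 le_rfl)
          (hy1.mono hm2 le_rfl) (hlam1.mono hm2 le_rfl) (measurable_past ζ (k + 1)) (h.x_mem k)
          (h.y_mem k))
      have hb' : Measurable[past ζ (k + 1 + 1)] fun ω => (1 - c.varrho (k + 1)) • (it.v (k + 1) ω -
          Q.batchX (c.theta₁ Q l μ ε (k + 1)) (it.x (k + 1) ω) (it.y (k + 1) ω) (it.lam (k + 1) ω)
            (fun j => ζ (k + 1) j ω)) := hb.const_smul (1 - c.varrho (k + 1))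
      exact (h.measurable_batchX (k + 1) (hx'.mono hm2 le_rfl) (hy'.mono hm2 le_rfl)
        (hlam'.mono hm2 le_rfl) (measurable_past ζ (k + 1)) (h.x_mem (k + 1))
        (h.y_mem (k + 1))).add hb'
    · rw [funext (h.gen.upd_w (k + 1))]
      have hb : Measurable[past ζ (k + 1 + 1)] fun ω => it.w (k + 1) ω -
          Q.batchY (c.theta₂ Q l μ ε (k + 1)) (it.x (k + 1) ω) (it.y (k + 1) ω) (it.lam (k + 1) ω)
            (fun j => ζ (k + 1) j ω) :=
        (hw.mono hm2 le_rfl).sub (h.measurable_batchY k (hx1.mono hm2 le_rfl)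
          (hy1.mono hm2 le_rfl) (hlam1.mono hm2 le_rfl) (measurable_past ζ (k + 1)) (h.x_mem k)
          (h.y_mem k))
      have hb' : Measurable[past ζ (k + 1 + 1)] fun ω => (1 - c.iota (k + 1)) • (it.w (k + 1) ω -
          Q.batchY (c.theta₂ Q l μ ε (k + 1)) (it.x (k + 1) ω) (it.y (k + 1) ω) (it.lam (k + 1) ω)
            (fun j => ζ (k + 1) j ω)) := hb.const_smul (1 - c.iota (k + 1))
      exact (h.measurable_batchY (k + 1) (hx'.mono hm2 le_rfl) (hy'.mono hm2 le_rfl)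
        (hlam'.mono hm2 le_rfl) (measurable_past ζ (k + 1)) (h.x_mem (k + 1))
        (h.y_mem (k + 1))).add hb'

theorem measurable_x (k : ℕ) : Measurable (it.x (k + 1)) :=
  (h.adapted k).1.1.mono (h.sample.past_le k) le_rfl

theorem measurable_y (k : ℕ) : Measurable (it.y (k + 1)) :=
  (h.adapted k).1.2.1.mono (h.sample.past_le k) le_rfl

theorem measurable_lam (k : ℕ) : Measurable (it.lam (k + 1)) :=
  (h.adapted k).1.2.2.mono (h.sample.past_le k) le_rfl

theorem measurable_v (k : ℕ) : Measurable (it.v (k + 1)) :=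
  (h.adapted k).2.1.mono (h.sample.past_le (k + 1)) le_rfl

theorem measurable_w (k : ℕ) : Measurable (it.w (k + 1)) :=
  (h.adapted k).2.2.mono (h.sample.past_le (k + 1)) le_rfl

theorem adapted_errX (k : ℕ) : Measurable[past ζ (k + 1)] (errX Q c l μ ε it (k + 1)) := by
  obtain ⟨⟨hx, hy, hlam⟩, hv, -⟩ := h.adapted k
  have hm := past_mono ζ (Nat.le_succ k)
  exact hv.sub (h.measurable_popX k (hx.mono hm le_rfl) (hy.mono hm le_rfl) (hlam.mono hm le_rfl)
    (h.x_mem k) (h.y_mem k))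

theorem adapted_errY (k : ℕ) : Measurable[past ζ (k + 1)] (errY Q c l μ ε it (k + 1)) := by
  obtain ⟨⟨hx, hy, hlam⟩, -, hw⟩ := h.adapted k
  have hm := past_mono ζ (Nat.le_succ k)
  exact hw.sub (h.measurable_popY k (hx.mono hm le_rfl) (hy.mono hm le_rfl) (hlam.mono hm le_rfl)
    (h.x_mem k) (h.y_mem k))

/-! ### Mean square errors of the gradient estimators -/

variable [IsProbabilityMeasure P]

theorem integrable_norm_sub_x (k k' : ℕ) :
    Integrable (fun ω => ‖it.x (k' + 1) ω - it.x (k + 1) ω‖ ^ 2) P := by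
  obtain ⟨R, hR⟩ := Q.X_compact.isBounded.exists_norm_le
  refine integrable_norm_sq_of_le ((h.measurable_x k').sub (h.measurable_x k)) (C := R + R)
    fun ω => (norm_sub_le _ _).trans (add_le_add (hR _ (h.x_mem k' ω)) (hR _ (h.x_mem k ω)))

theorem integrable_norm_sub_y (k k' : ℕ) :
    Integrable (fun ω => ‖it.y (k' + 1) ω - it.y (k + 1) ω‖ ^ 2) P :=
  integrable_norm_sq_of_le ((h.measurable_y k').sub (h.measurable_y k))
    fun ω => Q.norm_sub_le_of_mem_Y (h.y_mem k' ω) (h.y_mem k ω)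

/-- With `ϱ_0 = 1` the first estimator is a plain mini-batch average: the general recursion applies
with zero previous error and coinciding old and new points. Its factor `2` is not sharp here, but
harmless. -/
theorem integral_errX_one_le : Integrable (fun ω => ‖errX Q c l μ ε it 1 ω‖ ^ 2) P ∧
    ∫ ω, ‖errX Q c l μ ε it 1 ω‖ ^ 2 ∂P ≤ 2 * δ ^ 2 / c.b := by
  have := Q.D_prob
  obtain ⟨hx, hy, -⟩ := (h.adapted 0).1
  have r := integral_norm_error_sq_le (P := P) (D := Q.D) (δ := δ) (ϱ := 1)
    (e := fun _ => 0) (e' := errX Q c l μ ε it 1) h.adm.b_pos add_add_sq_le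
    h.smooth.smoothFun_G h.reg.sm
    h.smooth.meas h.smooth.integrable (fun _ _ => rfl) h.reg.X_sub h.reg.Y_sub h.reg.l_pos.le
    (h.theta₁_nonneg 1) le_rfl (h.theta₁_pos 1) (h.stencil.seg_x 1 le_rfl)
    (h.stencil.seg_x 1 le_rfl) (h.var.int_x 1 le_rfl) (h.var.var_x 1 le_rfl)
    (h.sample.past_le 0) hx hx hy hy measurable_const (h.x_mem 0) (h.x_mem 0) (h.y_mem 0)
    (h.y_mem 0) (h.sample.measurable_batch 0) (h.sample.indep_past 0) (h.sample.map_batch 0)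
    (by simp) (by simp) (by simp) (fun ω => by
      rw [errX, h.gen.upd_v 0]
      simp only [Params.varrho, if_true, sub_self, zero_smul, add_zero, zero_add, sub_zero,
        Problem.batchX, Problem.popX]
      rw [average_sub_const h.adm.b_pos, average_sub_const h.adm.b_pos]
      abel)
  refine ⟨r.1, r.2.trans_eq ?_⟩
  simp
  ring

theorem integral_errY_one_le : Integrable (fun ω => ‖errY Q c l μ ε it 1 ω‖ ^ 2) P ∧
    ∫ ω, ‖errY Q c l μ ε it 1 ω‖ ^ 2 ∂P ≤ 2 * δ ^ 2 / c.b := by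
  have := Q.D_prob
  obtain ⟨hx, hy, -⟩ := (h.adapted 0).1
  have r := integral_norm_error_sq_le (P := P) (D := Q.D) (δ := δ) (ϱ := 1)
    (G := fun y x => Q.G x y) (g := fun y x => Q.g x y)
    (e := fun _ => 0) (e' := errY Q c l μ ε it 1) h.adm.b_pos
    add_add_sq_le' (fun z => (h.smooth.smoothFun_G z).flip) h.reg.sm.flip
    (fun y hy x hx => h.smooth.meas x hx y hy) (fun y hy x hx => h.smooth.integrable x hx y hy)
    (fun _ _ => rfl) h.reg.Y_sub h.reg.X_sub h.reg.l_pos.le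
    (h.theta₂_nonneg 1) le_rfl (h.theta₂_pos 1) (h.stencil.seg_y 1 le_rfl)
    (h.stencil.seg_y 1 le_rfl) (fun y hy x hx => h.var.int_y 1 le_rfl x hx y hy)
    (fun y hy x hx => h.var.var_y 1 le_rfl x hx y hy)
    (h.sample.past_le 0) hy hy hx hx measurable_const (h.y_mem 0) (h.y_mem 0) (h.x_mem 0)
    (h.x_mem 0) (h.sample.measurable_batch 0) (h.sample.indep_past 0) (h.sample.map_batch 0)
    (by simp) (by simp) (by simp) (fun ω => by
      rw [errY, h.gen.upd_w 0]
      simp only [Params.iota, if_true, sub_self, zero_smul, add_zero, zero_add, sub_zero,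
        Problem.batchY, Problem.popY]
      rw [average_sub_const h.adm.b_pos, average_sub_const h.adm.b_pos]
      abel)
  refine ⟨r.1, r.2.trans_eq ?_⟩
  simp
  ring

theorem integral_errX_succ_le (k : ℕ)
    (hi : Integrable (fun ω => ‖errX Q c l μ ε it (k + 1) ω‖ ^ 2) P) :
    Integrable (fun ω => ‖errX Q c l μ ε it (k + 1 + 1) ω‖ ^ 2) P ∧
    ∫ ω, ‖errX Q c l μ ε it (k + 1 + 1) ω‖ ^ 2 ∂P ≤
      (1 - c.varrho (k + 1)) ^ 2 * ∫ ω, ‖errX Q c l μ ε it (k + 1) ω‖ ^ 2 ∂P + 1 / (c.b : ℝ) *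
      (2 * c.varrho (k + 1) ^ 2 * δ ^ 2 + 2 * (1 - c.varrho (k + 1)) ^ 2 *
        (9 * l ^ 2 * ∫ ω, ‖it.x (k + 1 + 1) ω - it.x (k + 1) ω‖ ^ 2 ∂P
        + 9 / 2 * l ^ 2 * ∫ ω, ‖it.y (k + 1 + 1) ω - it.y (k + 1) ω‖ ^ 2 ∂P
        + 6 * (√dx * (l * c.theta₁ Q l μ ε (k + 1) / 2)) ^ 2)) := by
  have := Q.D_prob
  obtain ⟨hx, hy, -⟩ := (h.adapted k).1
  obtain ⟨hx', hy', -⟩ := (h.adapted (k + 1)).1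
  have hm := past_mono ζ (Nat.le_succ k)
  have hk : 1 ≤ k + 1 := Nat.le_add_left 1 k
  have hk' : 1 ≤ k + 1 + 1 := Nat.le_add_left 1 (k + 1)
  exact integral_norm_error_sq_le (P := P) (D := Q.D)
    h.adm.b_pos add_add_sq_le
    h.smooth.smoothFun_G h.reg.sm
    h.smooth.meas h.smooth.integrable (fun _ _ => rfl) h.reg.X_sub h.reg.Y_sub h.reg.l_pos.le
    (h.theta₁_nonneg (k + 1 + 1)) (h.theta₁_succ_le (k + 1)) (h.theta₁_pos (k + 1 + 1))
    (h.stencil.seg_x (k + 1) hk) (h.stencil.seg_x (k + 1 + 1) hk')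
    (h.var.int_x (k + 1 + 1) hk') (h.var.var_x (k + 1 + 1) hk')
    (h.sample.past_le (k + 1)) (hx.mono hm le_rfl) hx' (hy.mono hm le_rfl) hy'
    (h.adapted_errX k) (h.x_mem k) (h.x_mem (k + 1)) (h.y_mem k) (h.y_mem (k + 1))
    (h.sample.measurable_batch (k + 1)) (h.sample.indep_past (k + 1)) (h.sample.map_batch (k + 1))
    hi (h.integrable_norm_sub_x k (k + 1)) (h.integrable_norm_sub_y k (k + 1)) (fun ω => by
      rw [errX, errX, h.gen.upd_v (k + 1)]
      exact momentum_error_eq h.adm.b_pos _ _ _ _ _ _ _ _)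

theorem integral_errY_succ_le (k : ℕ)
    (hi : Integrable (fun ω => ‖errY Q c l μ ε it (k + 1) ω‖ ^ 2) P) :
    Integrable (fun ω => ‖errY Q c l μ ε it (k + 1 + 1) ω‖ ^ 2) P ∧
    ∫ ω, ‖errY Q c l μ ε it (k + 1 + 1) ω‖ ^ 2 ∂P ≤
      (1 - c.iota (k + 1)) ^ 2 * ∫ ω, ‖errY Q c l μ ε it (k + 1) ω‖ ^ 2 ∂P + 1 / (c.b : ℝ) *
      (2 * c.iota (k + 1) ^ 2 * δ ^ 2 + 2 * (1 - c.iota (k + 1)) ^ 2 *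
        (9 / 2 * l ^ 2 * ∫ ω, ‖it.y (k + 1 + 1) ω - it.y (k + 1) ω‖ ^ 2 ∂P
        + 9 * l ^ 2 * ∫ ω, ‖it.x (k + 1 + 1) ω - it.x (k + 1) ω‖ ^ 2 ∂P
        + 6 * (√dy * (l * c.theta₂ Q l μ ε (k + 1) / 2)) ^ 2)) := by
  have := Q.D_prob
  obtain ⟨hx, hy, -⟩ := (h.adapted k).1
  obtain ⟨hx', hy', -⟩ := (h.adapted (k + 1)).1
  have hm := past_mono ζ (Nat.le_succ k)
  have hk : 1 ≤ k + 1 := Nat.le_add_left 1 k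
  have hk' : 1 ≤ k + 1 + 1 := Nat.le_add_left 1 (k + 1)
  exact integral_norm_error_sq_le (P := P) (D := Q.D)
    (G := fun y x => Q.G x y) (g := fun y x => Q.g x y) h.adm.b_pos
    add_add_sq_le' (fun z => (h.smooth.smoothFun_G z).flip) h.reg.sm.flip
    (fun y hy x hx => h.smooth.meas x hx y hy) (fun y hy x hx => h.smooth.integrable x hx y hy)
    (fun _ _ => rfl) h.reg.Y_sub h.reg.X_sub h.reg.l_pos.le
    (h.theta₂_nonneg (k + 1 + 1)) (h.theta₂_succ_le (k + 1)) (h.theta₂_pos (k + 1 + 1))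
    (h.stencil.seg_y (k + 1) hk) (h.stencil.seg_y (k + 1 + 1) hk')
    (fun y hy x hx => h.var.int_y (k + 1 + 1) hk' x hx y hy)
    (fun y hy x hx => h.var.var_y (k + 1 + 1) hk' x hx y hy)
    (h.sample.past_le (k + 1)) (hy.mono hm le_rfl) hy' (hx.mono hm le_rfl) hx'
    (h.adapted_errY k) (h.y_mem k) (h.y_mem (k + 1)) (h.x_mem k) (h.x_mem (k + 1))
    (h.sample.measurable_batch (k + 1)) (h.sample.indep_past (k + 1)) (h.sample.map_batch (k + 1))
    hi (h.integrable_norm_sub_y k (k + 1)) (h.integrable_norm_sub_x k (k + 1)) (fun ω => by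
      rw [errY, errY, h.gen.upd_w (k + 1)]
      exact momentum_error_eq h.adm.b_pos _ _ _ _ _ _ _ _)

theorem integrable_errX (k : ℕ) :
    Integrable (fun ω => ‖errX Q c l μ ε it (k + 1) ω‖ ^ 2) P := by
  induction k with
  | zero => exact h.integral_errX_one_le.1
  | succ k ih => exact (h.integral_errX_succ_le k ih).1

theorem integrable_errY (k : ℕ) :
    Integrable (fun ω => ‖errY Q c l μ ε it (k + 1) ω‖ ^ 2) P := by
  induction k with
  | zero => exact h.integral_errY_one_le.1
  | succ k ih => exact (h.integral_errY_succ_le k ih).1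

end Run


/-! ### Expectations of the one-step estimates -/

/-- `f` is integrable, with integral `a`. -/
def HasMean {Ω : Type*} [MeasurableSpace Ω] (P : Measure Ω) (f : Ω → ℝ) (a : ℝ) : Prop :=
  Integrable f P ∧ ∫ ω, f ω ∂P = a

namespace HasMean

variable {Ω : Type*} [MeasurableSpace Ω] {P : Measure Ω} {f g : Ω → ℝ} {a b : ℝ}

theorem of_integrable (hf : Integrable f P) : HasMean P f (∫ ω, f ω ∂P) := ⟨hf, rfl⟩

theorem add (hf : HasMean P f a) (hg : HasMean P g b) : HasMean P (fun ω => f ω + g ω) (a + b) :=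
  ⟨hf.1.add hg.1, by rw [integral_add hf.1 hg.1, hf.2, hg.2]⟩

theorem const_mul (r : ℝ) (hf : HasMean P f a) : HasMean P (fun ω => r * f ω) (r * a) :=
  ⟨hf.1.const_mul r, by rw [integral_const_mul, hf.2]⟩

theorem const [IsProbabilityMeasure P] (r : ℝ) : HasMean P (fun _ => r) r :=
  ⟨integrable_const r, by simp⟩

theorem le (hf : HasMean P f a) (hg : HasMean P g b) (h : ∀ ω, f ω ≤ g ω) : a ≤ b := by
  rw [← hf.2, ← hg.2]
  exact integral_mono hf.1 hg.1 h

theorem dominated (hg : HasMean P g b) (hf : Measurable f) (h0 : ∀ ω, 0 ≤ f ω)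
    (h : ∀ ω, f ω ≤ g ω) : Integrable f P ∧ ∫ ω, f ω ∂P ≤ b := by
  have hi : Integrable f P := hg.1.mono' hf.aestronglyMeasurable
    (Filter.Eventually.of_forall fun ω => by rw [Real.norm_of_nonneg (h0 ω)]; exact h ω)
  exact ⟨hi, (of_integrable hi).le hg h⟩

end HasMean

section Steps

variable {dx dy p : ℕ} {Ξ : Type*} [MeasurableSpace Ξ] (Q : Problem dx dy p Ξ) (c : Params)
  {Ω : Type*} (it : Iterates dx dy p Ω)

/-- The displacement towards the projected `x`-step. -/
noncomputable def stepX (k : ℕ) (ω : Ω) : Vec dx :=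
  proj Q.X (it.x k ω - c.α • it.v k ω) - it.x k ω

/-- The displacement towards the projected `y`-step. -/
noncomputable def stepY (k : ℕ) (ω : Ω) : Vec dy :=
  proj Q.Y (it.y k ω + c.β • it.w k ω) - it.y k ω

/-- The displacement towards the projected multiplier step. -/
noncomputable def stepLam (k : ℕ) (ω : Ω) : Vec p :=
  proj Q.mult (it.lam k ω + c.γ • Q.resid (it.x (k + 1) ω) (it.y (k + 1) ω)) - it.lam k ω

/-- The tracking error `y_k - y*(x_k, λ_k)`. -/
noncomputable def track (k : ℕ) (ω : Ω) : Vec dy :=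
  it.y k ω - Q.yStar (it.x k ω) (it.lam k ω)

end Steps

namespace Run

variable {dx dy p : ℕ} {Ξ : Type*} [MeasurableSpace Ξ] {Q : Problem dx dy p Ξ}
  {U : Set (Vec dx)} {V : Set (Vec dy)} {l μ δ : ℝ} {c : Params} {ε : ℝ} {Ω : Type*}
  [mΩ : MeasurableSpace Ω] {P : Measure Ω} {ζ : ℕ → Fin c.b → Ω → Ξ}
  {it : Iterates dx dy p Ω} {x₁ : Vec dx} {y₁ : Vec dy} {lam₁ : Vec p}
  (h : Run Q U V l μ δ c ε P ζ it x₁ y₁ lam₁)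
include h

theorem exists_norm_lam_le (k : ℕ) : ∃ R, ∀ ω, ‖it.lam (k + 1) ω‖ ≤ R := by
  obtain ⟨R, -, hR⟩ := Q.exists_resid_bound
  exact ⟨_, h.norm_lam_le hR k⟩

theorem norm_track_le (k : ℕ) (ω : Ω) : ‖track Q it (k + 1) ω‖ ≤ 2 * Q.sigmaY :=
  Q.norm_sub_le_of_mem_Y (h.y_mem k ω) (h.reg.yStar_mem (h.x_mem k ω) _)

theorem measurable_track (k : ℕ) : Measurable (track Q it (k + 1)) :=
  (h.measurable_y k).sub (measurable_comp_of_continuousOn h.reg.continuousOn_yStar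
    ((h.measurable_x k).prodMk (h.measurable_lam k)) fun ω => ⟨h.x_mem k ω, trivial⟩)

theorem x_succ_sub (k : ℕ) (ω : Ω) :
    it.x (k + 1 + 1) ω - it.x (k + 1) ω = c.eta (k + 1) • stepX Q c it (k + 1) ω := by
  rw [h.gen.upd_x _ (Nat.le_add_left 1 k), add_sub_cancel_left, stepX]

theorem y_succ_sub (k : ℕ) (ω : Ω) :
    it.y (k + 1 + 1) ω - it.y (k + 1) ω = c.eta (k + 1) • stepY Q c it (k + 1) ω := by
  rw [h.gen.upd_y _ (Nat.le_add_left 1 k), add_sub_cancel_left, stepY]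

theorem integral_norm_sub_x (k : ℕ) : ∫ ω, ‖it.x (k + 1 + 1) ω - it.x (k + 1) ω‖ ^ 2 ∂P =
    c.eta (k + 1) ^ 2 * ∫ ω, ‖stepX Q c it (k + 1) ω‖ ^ 2 ∂P := by
  rw [← integral_const_mul]
  refine integral_congr_ae (Filter.Eventually.of_forall fun ω => ?_)
  simp only [h.x_succ_sub k ω, norm_smul, mul_pow, Real.norm_eq_abs, sq_abs]

theorem integral_norm_sub_y (k : ℕ) : ∫ ω, ‖it.y (k + 1 + 1) ω - it.y (k + 1) ω‖ ^ 2 ∂P =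
    c.eta (k + 1) ^ 2 * ∫ ω, ‖stepY Q c it (k + 1) ω‖ ^ 2 ∂P := by
  rw [← integral_const_mul]
  refine integral_congr_ae (Filter.Eventually.of_forall fun ω => ?_)
  simp only [h.y_succ_sub k ω, norm_smul, mul_pow, Real.norm_eq_abs, sq_abs]

variable [IsProbabilityMeasure P]

theorem integrable_Phi (k : ℕ) :
    Integrable (fun ω => Q.Phi (it.x (k + 1) ω) (it.lam (k + 1) ω)) P := by
  obtain ⟨R, hR⟩ := h.exists_norm_lam_le k
  have hcpt := Q.X_compact.prod (isCompact_closedBall (0 : Vec p) R)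
  obtain ⟨C, hC⟩ := hcpt.exists_bound_of_continuousOn
    (h.reg.continuousOn_Phi.mono (Set.prod_mono_right (Set.subset_univ _)))
  refine integrable_of_abs_le (measurable_comp_of_continuousOn h.reg.continuousOn_Phi
    ((h.measurable_x k).prodMk (h.measurable_lam k)) fun ω => ⟨h.x_mem k ω, trivial⟩) (C := C)
    fun ω => hC (it.x (k + 1) ω, it.lam (k + 1) ω) ⟨h.x_mem k ω, ?_⟩
  rw [mem_closedBall_zero_iff]
  exact hR ω

theorem integrable_track (k : ℕ) : Integrable (fun ω => ‖track Q it (k + 1) ω‖ ^ 2) P :=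
  integrable_norm_sq_of_le (h.measurable_track k) (h.norm_track_le k)

theorem integrable_stepX (k : ℕ) : Integrable (fun ω => ‖stepX Q c it (k + 1) ω‖ ^ 2) P := by
  obtain ⟨R, hR⟩ := Q.X_compact.isBounded.exists_norm_le
  have hp := (continuous_proj Q.X_nonempty Q.X_compact.isClosed Q.X_convex).measurable
  have hx := h.measurable_x k
  have hv := h.measurable_v k
  have hm : Measurable fun ω => proj Q.X (it.x (k + 1) ω - c.α • it.v (k + 1) ω) :=
    hp.comp (hx.sub (hv.const_smul c.α))
  exact integrable_norm_sq_of_le (hm.sub hx) (C := R + R) fun ω => (norm_sub_le _ _).trans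
    (add_le_add (hR _ (proj_spec Q.X_nonempty Q.X_compact.isClosed _).1) (hR _ (h.x_mem k ω)))

theorem integrable_stepY (k : ℕ) : Integrable (fun ω => ‖stepY Q c it (k + 1) ω‖ ^ 2) P := by
  have hp := (continuous_proj Q.Y_nonempty Q.Y_compact.isClosed Q.Y_convex).measurable
  have hy := h.measurable_y k
  have hw := h.measurable_w k
  have hm : Measurable fun ω => proj Q.Y (it.y (k + 1) ω + c.β • it.w (k + 1) ω) :=
    hp.comp (hy.add (hw.const_smul c.β))
  exact integrable_norm_sq_of_le (hm.sub hy) fun ω => Q.norm_sub_le_of_mem_Y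
    (proj_spec Q.Y_nonempty Q.Y_compact.isClosed _).1 (h.y_mem k ω)

theorem integrable_stepLam (k : ℕ) : Integrable (fun ω => ‖stepLam Q c it (k + 1) ω‖ ^ 2) P := by
  obtain ⟨R, -, hR⟩ := Q.exists_resid_bound
  have hp := (continuous_proj Q.mult_nonempty Q.mult_isClosed Q.mult_convex).measurable
  have hlam := h.measurable_lam k
  have hr : Measurable fun ω => Q.resid (it.x (k + 1 + 1) ω) (it.y (k + 1 + 1) ω) :=
    ((Q.A.continuous.measurable.comp (h.measurable_x (k + 1))).add
      (Q.B.continuous.measurable.comp (h.measurable_y (k + 1)))).sub_const _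
  have hm : Measurable fun ω => proj Q.mult (it.lam (k + 1) ω + c.γ •
      Q.resid (it.x (k + 1 + 1) ω) (it.y (k + 1 + 1) ω)) :=
    hp.comp (hlam.add (hr.const_smul c.γ))
  refine integrable_norm_sq_of_le (hm.sub hlam) (C := c.γ * R) fun ω => ?_
  have h1 := norm_proj_sub_proj_le Q.mult_nonempty Q.mult_isClosed Q.mult_convex
    (it.lam (k + 1) ω + c.γ • Q.resid (it.x (k + 1 + 1) ω) (it.y (k + 1 + 1) ω))
    (it.lam (k + 1) ω)
  rw [proj_eq_self Q.mult_nonempty Q.mult_isClosed (h.lam_mem k ω), add_sub_cancel_left,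
    norm_smul, Real.norm_of_nonneg h.adm.γ_pos.le] at h1
  exact h1.trans (mul_le_mul_of_nonneg_left (hR _ (h.x_mem (k + 1) ω) _ (h.y_mem (k + 1) ω))
    h.adm.γ_pos.le)

/-- The deterministic descent estimate, in expectation. -/
theorem integral_descent (k : ℕ) :
    (∫ ω, Q.Phi (it.x (k + 1 + 1) ω) (it.lam (k + 1 + 1) ω) ∂P)
      + (32 * c.α * Q.lip l ^ 2 / (c.β * μ) - 4 * c.eta (k + 1) * c.α * Q.lip l ^ 2)
        * ∫ ω, ‖track Q it (k + 1 + 1) ω‖ ^ 2 ∂P ≤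
    (∫ ω, Q.Phi (it.x (k + 1) ω) (it.lam (k + 1) ω) ∂P)
      + (32 * c.α * Q.lip l ^ 2 / (c.β * μ) - 4 * c.eta (k + 1) * c.α * Q.lip l ^ 2)
        * ∫ ω, ‖track Q it (k + 1) ω‖ ^ 2 ∂P
      - c.eta (k + 1) * (1 / (2 * c.α) * ∫ ω, ‖stepX Q c it (k + 1) ω‖ ^ 2 ∂P)
      - c.eta (k + 1) * (24 * c.α * Q.lip l ^ 2 / (μ * c.β)
          * ∫ ω, ‖stepY Q c it (k + 1) ω‖ ^ 2 ∂P)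
      - c.eta (k + 1) * (1 / (4 * c.γ) * ∫ ω, ‖stepLam Q c it (k + 1) ω‖ ^ 2 ∂P)
      + c.eta (k + 1) * (2 * c.α * (∫ ω, ‖errX Q c l μ ε it (k + 1) ω‖ ^ 2 ∂P)
        + 4 * c.α * (√dx * (l * c.theta₁ Q l μ ε (k + 1) / 2)) ^ 2
        + 320 * c.α * Q.lip l ^ 2 / μ ^ 2 * ((∫ ω, ‖errY Q c l μ ε it (k + 1) ω‖ ^ 2 ∂P)
          + (√dy * (l * c.theta₂ Q l μ ε (k + 1) / 2)) ^ 2)) := by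
  set η := c.eta (k + 1)
  set N := 32 * c.α * Q.lip l ^ 2 / (c.β * μ) - 4 * η * c.α * Q.lip l ^ 2
  set s₁ := √dx * (l * c.theta₁ Q l μ ε (k + 1) / 2)
  set s₂ := √dy * (l * c.theta₂ Q l μ ε (k + 1) / 2)
  have hL := (HasMean.of_integrable (h.integrable_Phi (k + 1))).add
    ((HasMean.of_integrable (h.integrable_track (k + 1))).const_mul N)
  have hR := ((((((HasMean.of_integrable (h.integrable_Phi k)).add
    ((HasMean.of_integrable (h.integrable_track k)).const_mul N)).add
    ((HasMean.of_integrable (h.integrable_stepX k)).const_mul (-(η * (1 / (2 * c.α)))))).add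
    ((HasMean.of_integrable (h.integrable_stepY k)).const_mul
      (-(η * (24 * c.α * Q.lip l ^ 2 / (μ * c.β)))))).add
    ((HasMean.of_integrable (h.integrable_stepLam k)).const_mul (-(η * (1 / (4 * c.γ)))))).add
    ((HasMean.of_integrable (h.integrable_errX k)).const_mul (η * (2 * c.α)))).add
    (((HasMean.of_integrable (h.integrable_errY k)).const_mul
      (η * (320 * c.α * Q.lip l ^ 2 / μ ^ 2))).add
    (HasMean.const (η * (4 * c.α * s₁ ^ 2 + 320 * c.α * Q.lip l ^ 2 / μ ^ 2 * s₂ ^ 2))))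
  have key := hL.le hR fun ω => by
    have hk : 1 ≤ k + 1 := Nat.le_add_left 1 k
    have d := h.reg.descent h.adm (h.x_mem k ω) (h.y_mem k ω) (h.lam_mem k ω)
      (h.adm.eta_pos (k + 1)) (h.adm.eta_le_one (k + 1)) (h.adm.eta_le_div (k + 1))
      (h.norm_lagrX_sub_popX_le k (h.x_mem k ω) (h.y_mem k ω) (it.lam (k + 1) ω))
      (h.norm_lagrY_sub_popY_le k (h.x_mem k ω) (h.y_mem k ω) (it.lam (k + 1) ω))
      (h.gen.upd_x _ hk ω) (h.gen.upd_y _ hk ω) (h.gen.upd_lam _ hk ω)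
    rw [norm_sub_rev (Q.popX _ _ _ _), norm_sub_rev (Q.popY _ _ _ _)] at d
    simp only [track, stepX, stepY, stepLam, errX, errY, N, η, s₁, s₂]
    linarith
  linarith

theorem integrable_gap_and_le (k : ℕ) :
    Integrable (fun ω => ‖Q.gap c.α c.β c.γ (it.x (k + 1) ω) (it.y (k + 1) ω)
      (it.lam (k + 1) ω)‖ ^ 2) P ∧
    meanSqGap Q c P it (k + 1) ≤
      (3 / c.α ^ 2 + 3 * ‖Q.A‖ ^ 2) * ∫ ω, ‖stepX Q c it (k + 1) ω‖ ^ 2 ∂P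
      + (3 / c.β ^ 2 + 3 * ‖Q.B‖ ^ 2) * ∫ ω, ‖stepY Q c it (k + 1) ω‖ ^ 2 ∂P
      + 3 / c.γ ^ 2 * ∫ ω, ‖stepLam Q c it (k + 1) ω‖ ^ 2 ∂P
      + 3 * ∫ ω, ‖errX Q c l μ ε it (k + 1) ω‖ ^ 2 ∂P
      + 3 * ∫ ω, ‖errY Q c l μ ε it (k + 1) ω‖ ^ 2 ∂P
      + (3 * (√dx * (l * c.theta₁ Q l μ ε (k + 1) / 2)) ^ 2
      + 3 * (√dy * (l * c.theta₂ Q l μ ε (k + 1) / 2)) ^ 2) := by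
  have hR := (((((HasMean.of_integrable (h.integrable_stepX k)).const_mul
      (3 / c.α ^ 2 + 3 * ‖Q.A‖ ^ 2)).add
    ((HasMean.of_integrable (h.integrable_stepY k)).const_mul (3 / c.β ^ 2 + 3 * ‖Q.B‖ ^ 2))).add
    ((HasMean.of_integrable (h.integrable_stepLam k)).const_mul (3 / c.γ ^ 2))).add
    ((HasMean.of_integrable (h.integrable_errX k)).const_mul 3)).add
    ((HasMean.of_integrable (h.integrable_errY k)).const_mul 3)
  have hR := hR.add (HasMean.const (3 * (√dx * (l * c.theta₁ Q l μ ε (k + 1) / 2)) ^ 2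
      + 3 * (√dy * (l * c.theta₂ Q l μ ε (k + 1) / 2)) ^ 2))
  have hm := h.reg.measurable_norm_gap_sq h.adm.α_pos h.adm.β_pos h.adm.γ_pos (h.measurable_x k)
    (h.measurable_y k) (h.measurable_lam k) (h.x_mem k) (h.y_mem k)
  refine hR.dominated hm (fun ω => sq_nonneg _) fun ω => ?_
  have hk : 1 ≤ k + 1 := Nat.le_add_left 1 k
  have d := h.reg.norm_gap_sq_le h.adm (lam := it.lam (k + 1) ω) (h.x_mem k ω) (h.y_mem k ω)
    (h.adm.eta_pos (k + 1)) (h.adm.eta_le_one (k + 1))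
    (h.norm_lagrX_sub_popX_le k (h.x_mem k ω) (h.y_mem k ω) (it.lam (k + 1) ω))
    (h.norm_lagrY_sub_popY_le k (h.x_mem k ω) (h.y_mem k ω) (it.lam (k + 1) ω))
    (h.gen.upd_x _ hk ω) (h.gen.upd_y _ hk ω)
  rw [norm_sub_rev (Q.popX _ _ _ _), norm_sub_rev (Q.popY _ _ _ _), add_assoc] at d
  exact d

/-- The potential along the iterates. -/
theorem potential_eq (k : ℕ) :
    potential Q c l μ ε P it (k + 1) (it.x (k + 1)) (it.y (k + 1)) (it.lam (k + 1)) =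
      (∫ ω, Q.Phi (it.x (k + 1) ω) (it.lam (k + 1) ω) ∂P)
      + 32 * c.α * Q.lip l ^ 2 / (c.β * μ) * (∫ ω, ‖track Q it (k + 1) ω‖ ^ 2 ∂P)
      + c.A₁ / c.eta k * (∫ ω, ‖errX Q c l μ ε it (k + 1) ω‖ ^ 2 ∂P)
      + c.A₂ / c.eta k * (∫ ω, ‖errY Q c l μ ε it (k + 1) ω‖ ^ 2 ∂P)
      - 4 * c.eta k * c.α * Q.lip l ^ 2 * ∫ ω, ‖track Q it (k + 1) ω‖ ^ 2 ∂P := by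
  have hR := ((((HasMean.of_integrable (h.integrable_Phi k)).add
    ((HasMean.of_integrable (h.integrable_track k)).const_mul
      (32 * c.α * Q.lip l ^ 2 / (c.β * μ)))).add
    ((HasMean.of_integrable (h.integrable_errX k)).const_mul (c.A₁ / c.eta k))).add
    ((HasMean.of_integrable (h.integrable_errY k)).const_mul (c.A₂ / c.eta k)))
  rw [← hR.2, potential, Nat.add_sub_cancel]
  simp only [track, errX, errY, norm_sub_rev (Q.popX _ _ _ _), norm_sub_rev (Q.popY _ _ _ _)]

end Run


/-! ### One step of the potential -/

/-- Linear bookkeeping. `X`, `Y`, `Z` are the mean squared displacements, `E₁`, `E₂` the estimator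
errors, `s₁`, `s₂` the smoothing errors. The hypotheses `cX` to `c₂` say that each available
decrease covers both its cost elsewhere and its share of `D₁ G`. Changing the weight of the tracking
error from `η₀` to `η` leaves the term `4 (η₀ - η) M D`. -/
theorem combine_steps {F F' D D' N M η η₀ X Y Z E₁ E₂ E₁' E₂' s₁ s₂ G D₁ a₁ a₂ a₁' a₂' pX pY pZ
    gX gY gZ g₁ g₂ q₁ q₂ r₁ u₁ u₂ n₁ n₂ m₁ m₂ t₁ t₂ B₁ B₂ : ℝ} (hη : 0 ≤ η) (hX : 0 ≤ X)
    (hY : 0 ≤ Y) (hZ : 0 ≤ Z) (hE₁ : 0 ≤ E₁) (hE₂ : 0 ≤ E₂)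
    (hd : F' + (N - 4 * η * M) * D' ≤ F + (N - 4 * η * M) * D - η * (pX * X) - η * (pY * Y)
      - η * (pZ * Z) + η * (q₁ * E₁ + r₁ * s₁ + q₂ * (E₂ + s₂)))
    (h₁ : a₁' * E₁' ≤ a₁ * E₁ - η * (u₁ * E₁) + n₁ + η * (m₁ * (9 * X + 9 / 2 * Y)) + t₁ * s₁)
    (h₂ : a₂' * E₂' ≤ a₂ * E₂ - η * (u₂ * E₂) + n₂ + η * (m₂ * (9 / 2 * Y + 9 * X)) + t₂ * s₂)
    (hg : D₁ * G ≤ gX * X + gY * Y + gZ * Z + g₁ * E₁ + g₂ * E₂ + 3 * D₁ * (s₁ + s₂))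
    (cX : 9 * (m₁ + m₂) + gX ≤ pX) (cY : 9 / 2 * (m₁ + m₂) + gY ≤ pY) (cZ : gZ ≤ pZ)
    (c₁ : q₁ + g₁ ≤ u₁) (c₂ : q₂ + g₂ ≤ u₂) (hs₁ : η * ((3 * D₁ + r₁) * s₁) + t₁ * s₁ ≤ B₁)
    (hs₂ : η * ((3 * D₁ + q₂) * s₂) + t₂ * s₂ ≤ B₂) :
    F' + N * D' + a₁' * E₁' + a₂' * E₂' - 4 * η * M * D' ≤
      F + N * D + a₁ * E₁ + a₂ * E₂ - 4 * η₀ * M * D + 4 * (η₀ - η) * M * D - η * (D₁ * G)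
        + B₁ + B₂ + n₁ + n₂ := by
  have k1 := mul_le_mul_of_nonneg_left (mul_le_mul_of_nonneg_right cX hX) hη
  have k2 := mul_le_mul_of_nonneg_left (mul_le_mul_of_nonneg_right cY hY) hη
  have k3 := mul_le_mul_of_nonneg_left (mul_le_mul_of_nonneg_right cZ hZ) hη
  have k4 := mul_le_mul_of_nonneg_left (mul_le_mul_of_nonneg_right c₁ hE₁) hη
  have k5 := mul_le_mul_of_nonneg_left (mul_le_mul_of_nonneg_right c₂ hE₂) hη
  have k6 := mul_le_mul_of_nonneg_left hg hη
  linarith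

/-- The weights `1/η` grow slowly: the increment is `(a' - a) / A`, and `(a' - a)(a'² + a a' + a²) =
1` gives `a' (a' - a) ≤ 2/3`. -/
theorem inv_step_sub_le {a a' A : ℝ} (ha : 1 ≤ a) (haa : a ≤ a') (h3 : a' ^ 3 = a ^ 3 + 1)
    (hA : 0 < A) : 1 / (A / a') - 1 / (A / a) ≤ 2 / 3 * (A / a') / A ^ 2 := by
  have ha' : 0 < a' := by linarith
  have h1 : a' * (a' - a) ≤ 2 / 3 := by
    have : a' * (a' - a) * 3 ≤ (a' ^ 3 - a ^ 3) * 2 := by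
      have h2 : (a' - a) * (3 * a') ≤ (a' - a) * (2 * (a' ^ 2 + a * a' + a ^ 2)) := by
        refine mul_le_mul_of_nonneg_left ?_ (by linarith)
        nlinarith
      linarith
    rw [h3] at this
    linarith
  have e1 : 1 / (A / a') - 1 / (A / a) = a' * (a' - a) * (1 / (A * a')) := by
    field_simp
  have e2 : 2 / 3 * (A / a') / A ^ 2 = 2 / 3 * (1 / (A * a')) := by
    field_simp
  rw [e1, e2]
  gcongr

/-- The contribution of a momentum estimator to the change of the potential. -/
theorem momentum_term_le {a a' A A₃ A₄ b δ E E' m s η η₀ ϱ : ℝ} (ha : 1 ≤ a) (haa : a ≤ a')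
    (h3 : a' ^ 3 = a ^ 3 + 1) (hA : 0 < A) (hA₃ : 0 < A₃) (hA₄ : 0 < A₄) (hb : 0 < b)
    (hE : 0 ≤ E) (hm : 0 ≤ m) (hs : 0 ≤ s) (hη : η = A₃ / a') (hη₀ : η₀ = A₃ / a)
    (hϱ : ϱ = A₄ / a' ^ 2) (hϱ1 : ϱ ≤ 1)
    (h : E' ≤ (1 - ϱ) ^ 2 * E + 1 / b * (2 * ϱ ^ 2 * δ ^ 2 + 2 * (1 - ϱ) ^ 2 *
      (η ^ 2 * m + 6 * s))) :
    A / η * E' ≤ A / η₀ * E - η * ((A * A₄ / A₃ ^ 2 - 2 / 3 * (A / A₃ ^ 2)) * E)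
      + 2 * δ ^ 2 * (A₄ ^ 2 * A) / (b * A₃) / a' ^ 3 + η * (2 * A / b * m)
      + 12 * A / (η * b) * s := by
  have ha' : 0 < a' := by linarith
  have hη0 : 0 < η := by rw [hη]; positivity
  have hϱ0 : 0 < ϱ := by rw [hϱ]; positivity
  have hr2 : (1 - ϱ) ^ 2 ≤ 1 - ϱ := by nlinarith
  have hr1 : (1 - ϱ) ^ 2 ≤ 1 := by linarith
  have h1 : E' ≤ (1 - ϱ) * E + 1 / b * (2 * ϱ ^ 2 * δ ^ 2 + 2 * 1 * (η ^ 2 * m + 6 * s)) := by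
    refine h.trans ?_
    gcongr
  have h2 := mul_le_mul_of_nonneg_left h1 (by positivity : 0 ≤ A / η)
  refine h2.trans ?_
  have k1 := mul_le_mul_of_nonneg_left (inv_step_sub_le ha haa h3 hA₃) hA.le
  rw [← hη, ← hη₀] at k1
  have k2 := mul_le_mul_of_nonneg_right k1 hE
  have e1 : A / η * ((1 - ϱ) * E) = A / η₀ * E + A * (1 / η - 1 / η₀) * E - A / η * ϱ * E := by
    ring
  -- Here `ϱ = (A₄ / A₃²) η²`, so the contraction yields a decrease of order `η E`, the same order
  -- as the growth of `1/η` and the cost in the descent step.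
  have e2 : A / η * ϱ * E = η * (A * A₄ / A₃ ^ 2) * E := by
    rw [hη, hϱ]
    field_simp
  have e3 : A / η * (1 / b * (2 * ϱ ^ 2 * δ ^ 2)) =
      2 * δ ^ 2 * (A₄ ^ 2 * A) / (b * A₃) / a' ^ 3 := by
    rw [hη, hϱ]
    field_simp
  have e4 : A / η * (1 / b * (2 * 1 * (η ^ 2 * m))) = η * (2 * A / b * m) := by
    field_simp
  have e5 : A / η * (1 / b * (2 * 1 * (6 * s))) = 12 * A / (η * b) * s := by
    field_simp
    ring
  have e6 : A * (2 / 3 * η / A₃ ^ 2) * E = η * (2 / 3 * (A / A₃ ^ 2) * E) := by ring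
  linarith

/-- The contribution of the smoothing errors to the change of the potential. -/
theorem smoothing_budget {a A A₃ b ε D w s η : ℝ} (ha : 1 ≤ a) (hA : 0 < A) (hA₃ : 0 < A₃)
    (hb : 0 < b) (hD : 0 < D) (hw : 0 ≤ w) (hη : η = A₃ / a)
    (hs : s ≤ 1 / 4 * ε ^ 2 * (D / (w + 12 * A / (b * A₃ ^ 2))) / a ^ 2) :
    η * (w * s) + 12 * A / (η * b) * s ≤ η * (1 / 4 * ε ^ 2 * D) := by
  have ha' : 0 < a := by linarith
  set W := w + 12 * A / (b * A₃ ^ 2) with hW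
  have hW0 : 0 < W := by positivity
  have hη0 : 0 < η := by rw [hη]; positivity
  -- Since `1/η = η a² / A₃²`, the second term is `a²` times larger than the first; the decay `1/a²`
  -- of `s` compensates exactly.
  have e : η * (w * s) + 12 * A / (η * b) * s = η * (w + 12 * A / (b * A₃ ^ 2) * a ^ 2) * s := by
    rw [hη]
    field_simp
  have h1 : w + 12 * A / (b * A₃ ^ 2) * a ^ 2 ≤ W * a ^ 2 := by
    rw [hW, add_mul]
    gcongr
    exact le_mul_of_one_le_right hw (one_le_pow₀ ha)
  rw [e]
  calc η * (w + 12 * A / (b * A₃ ^ 2) * a ^ 2) * s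
      ≤ η * (w + 12 * A / (b * A₃ ^ 2) * a ^ 2) * (1 / 4 * ε ^ 2 * (D / W) / a ^ 2) := by
        gcongr
    _ ≤ η * (W * a ^ 2) * (1 / 4 * ε ^ 2 * (D / W) / a ^ 2) := by gcongr
    _ = η * (1 / 4 * ε ^ 2 * D) := by field_simp

/-! ### How the parameter restrictions enter -/

namespace Params.Admissible

variable {dx dy p : ℕ} {Ξ : Type*} [MeasurableSpace Ξ] {Q : Problem dx dy p Ξ} {l μ : ℝ}
  {c : Params} (hc : c.Admissible Q l μ)
include hc

/-- `D₁` is a minimum of affordable coefficients over a maximum of gap coefficients, so each product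
of `D₁` with a gap coefficient is at most the matching affordable one. -/
theorem D₁_mul_gap_le (hμ : 0 < μ) (hL : 0 < Q.lip l) {X Y Z E₁ E₂ S G : ℝ} (hX : 0 ≤ X)
    (hY : 0 ≤ Y) (hZ : 0 ≤ Z) (hE₁ : 0 ≤ E₁) (hE₂ : 0 ≤ E₂)
    (hG : G ≤ (3 / c.α ^ 2 + 3 * ‖Q.A‖ ^ 2) * X + (3 / c.β ^ 2 + 3 * ‖Q.B‖ ^ 2) * Y
      + 3 / c.γ ^ 2 * Z + 3 * E₁ + 3 * E₂ + 3 * S) :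
    c.D₁ Q l μ * G ≤ 1 / (4 * c.α) * X + 2 * c.α * Q.lip l ^ 2 / (μ * c.β) * Y
      + 1 / (4 * c.γ) * Z + c.A₁ * c.A₄ / (3 * c.A₃ ^ 2) * E₁
      + c.A₂ * c.A₅ / (3 * c.A₃ ^ 2) * E₂ + 3 * c.D₁ Q l μ * S := by
  have hD := hc.D₁_pos hμ hL
  set m := min (1 / (4 * c.α)) (min (2 * c.α * Q.lip l ^ 2 / (μ * c.β)) (min (1 / (4 * c.γ))
      (min (c.A₁ * c.A₄ / (3 * c.A₃ ^ 2)) (c.A₂ * c.A₅ / (3 * c.A₃ ^ 2))))) with hm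
  set K := max (3 / c.α ^ 2 + 3 * ‖Q.A‖ ^ 2) (max (3 / c.β ^ 2 + 3 * ‖Q.B‖ ^ 2)
    (max (3 / c.γ ^ 2) 3)) with hK
  have k4 : 3 ≤ K := (le_max_right _ _).trans ((le_max_right _ _).trans (le_max_right _ _))
  have hDK : c.D₁ Q l μ * K = m := div_mul_cancel₀ _ (by linarith)
  have k1 : 3 / c.α ^ 2 + 3 * ‖Q.A‖ ^ 2 ≤ K := le_max_left _ _
  have k2 : 3 / c.β ^ 2 + 3 * ‖Q.B‖ ^ 2 ≤ K := (le_max_left _ _).trans (le_max_right _ _)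
  have k3 : 3 / c.γ ^ 2 ≤ K :=
    (le_max_left _ _).trans ((le_max_right _ _).trans (le_max_right _ _))
  have m1 : m ≤ 1 / (4 * c.α) := min_le_left _ _
  have m2 : m ≤ 2 * c.α * Q.lip l ^ 2 / (μ * c.β) := (min_le_right _ _).trans (min_le_left _ _)
  have m3 : m ≤ 1 / (4 * c.γ) :=
    (min_le_right _ _).trans ((min_le_right _ _).trans (min_le_left _ _))
  have m4 : m ≤ c.A₁ * c.A₄ / (3 * c.A₃ ^ 2) :=
    (min_le_right _ _).trans ((min_le_right _ _).trans ((min_le_right _ _).trans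
      (min_le_left _ _)))
  have m5 : m ≤ c.A₂ * c.A₅ / (3 * c.A₃ ^ 2) :=
    (min_le_right _ _).trans ((min_le_right _ _).trans ((min_le_right _ _).trans
      (min_le_right _ _)))
  have key : ∀ {r t u : ℝ}, r ≤ K → m ≤ t → 0 ≤ u → c.D₁ Q l μ * (r * u) ≤ t * u :=
    fun {r t u} hr ht hu => by
      calc c.D₁ Q l μ * (r * u) ≤ c.D₁ Q l μ * (K * u) := by gcongr
        _ = m * u := by rw [← mul_assoc, hDK]
        _ ≤ t * u := by gcongr
  have h0 := mul_le_mul_of_nonneg_left hG hD.le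
  have h1 := key k1 m1 hX
  have h2 := key k2 m2 hY
  have h3 := key k3 m3 hZ
  have h4 := key k4 m4 hE₁
  have h5 := key k4 m5 hE₂
  linarith

/-- A rearrangement of the lower bound on `A₄`. The term `2/3 A₁ / A₃²` is the growth of the weight
`1/η`, `2α` the price of the error in the descent, and a third of the contraction is reserved for
the gap. The bound on `A₅` plays the same role below, with `320 · 3/2 = 480`. -/
theorem momentum_coeff₁ :
    2 * c.α + c.A₁ * c.A₄ / (3 * c.A₃ ^ 2) ≤
      c.A₁ * c.A₄ / c.A₃ ^ 2 - 2 / 3 * (c.A₁ / c.A₃ ^ 2) := by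
  have h := hc.A₄_ge
  have hA := hc.A₁_pos
  have hA₃ := hc.A₃_pos
  rw [div_le_iff₀ hA] at h
  have h2 : 0 ≤ (c.A₄ * c.A₁ - (3 * c.A₃ ^ 2 * c.α + c.A₁)) * (2 / (3 * c.A₃ ^ 2)) :=
    mul_nonneg (sub_nonneg.2 h) (by positivity)
  have e : (c.A₄ * c.A₁ - (3 * c.A₃ ^ 2 * c.α + c.A₁)) * (2 / (3 * c.A₃ ^ 2)) =
      c.A₁ * c.A₄ / c.A₃ ^ 2 - 2 / 3 * (c.A₁ / c.A₃ ^ 2) -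
        (2 * c.α + c.A₁ * c.A₄ / (3 * c.A₃ ^ 2)) := by
    field_simp
    ring
  linarith

theorem momentum_coeff₂ (hμ : 0 < μ) :
    320 * c.α * Q.lip l ^ 2 / μ ^ 2 + c.A₂ * c.A₅ / (3 * c.A₃ ^ 2) ≤
      c.A₂ * c.A₅ / c.A₃ ^ 2 - 2 / 3 * (c.A₂ / c.A₃ ^ 2) := by
  have h := hc.A₅_ge
  have hA := hc.A₂_pos
  have hA₃ := hc.A₃_pos
  rw [div_le_iff₀ (by positivity)] at h
  have h2 : 0 ≤ (c.A₅ * (c.A₂ * μ ^ 2) -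
      (480 * c.A₃ ^ 2 * c.α * Q.lip l ^ 2 + c.A₂ * μ ^ 2)) * (2 / (3 * c.A₃ ^ 2 * μ ^ 2)) :=
    mul_nonneg (sub_nonneg.2 h) (by positivity)
  have e : (c.A₅ * (c.A₂ * μ ^ 2) -
      (480 * c.A₃ ^ 2 * c.α * Q.lip l ^ 2 + c.A₂ * μ ^ 2)) * (2 / (3 * c.A₃ ^ 2 * μ ^ 2)) =
      c.A₂ * c.A₅ / c.A₃ ^ 2 - 2 / 3 * (c.A₂ / c.A₃ ^ 2) -
        (320 * c.α * Q.lip l ^ 2 / μ ^ 2 + c.A₂ * c.A₅ / (3 * c.A₃ ^ 2)) := by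
    field_simp
    ring
  linarith

/-- With `q = α L² / (μ β)`, the bound `11 α b / (9 μ β)` on `A₁` and `A₂` makes each momentum
coefficient at most `22/9 q`. For `y` this gives `22 q + 2 q = 24 q`; for `x` it gives `44 q`, which
is at most `1/(4α)` because `q ≤ 1/(176 α)`. -/
theorem displacement_coeff (hl : 0 < l) (hμ : 0 < μ) (hμL : μ ≤ Q.lip l) :
    9 / 2 * (2 * c.A₁ / c.b * l ^ 2 + 2 * c.A₂ / c.b * l ^ 2)
      + 2 * c.α * Q.lip l ^ 2 / (μ * c.β) ≤ 24 * c.α * Q.lip l ^ 2 / (μ * c.β) ∧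
    9 * (2 * c.A₁ / c.b * l ^ 2 + 2 * c.A₂ / c.b * l ^ 2) + 1 / (4 * c.α) ≤ 1 / (2 * c.α) := by
  have hb : (0 : ℝ) < c.b := Nat.cast_pos.2 hc.b_pos
  have hα := hc.α_pos
  have hβ := hc.β_pos
  have hlL := Q.l_le l
  have hL : 0 < Q.lip l := hl.trans_le hlL
  have key : ∀ {A : ℝ}, 0 < A → A ≤ c.bound₁₂ Q l μ →
      2 * A / c.b * l ^ 2 ≤ 22 / 9 * (c.α * Q.lip l ^ 2 / (μ * c.β)) := fun {A} hA hAb => by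
    have h1 : A ≤ 11 * c.α * c.b / (9 * μ * c.β) :=
      hAb.trans ((min_le_right _ _).trans (min_le_left _ _))
    calc 2 * A / c.b * l ^ 2 ≤ 2 * (11 * c.α * c.b / (9 * μ * c.β)) / c.b * Q.lip l ^ 2 := by
          gcongr
      _ = 22 / 9 * (c.α * Q.lip l ^ 2 / (μ * c.β)) := by
          field_simp
          ring
  have k1 := key hc.A₁_pos hc.A₁_le
  have k2 := key hc.A₂_pos hc.A₂_le
  refine ⟨?_, ?_⟩
  · have e1 : 2 * c.α * Q.lip l ^ 2 / (μ * c.β) = 2 * (c.α * Q.lip l ^ 2 / (μ * c.β)) := by ring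
    have e2 : 24 * c.α * Q.lip l ^ 2 / (μ * c.β) = 24 * (c.α * Q.lip l ^ 2 / (μ * c.β)) := by ring
    linarith
  · have hβμ : c.β * μ ≤ 1 / 6 := by
      have := hc.β_le
      rw [le_div_iff₀ (by positivity)] at this
      nlinarith
    have h3 := hc.α_le
    rw [le_div_iff₀ (by positivity)] at h3
    have hαμ : c.α * μ ≤ 1 / 384 := by
      have h4 : c.α * (64 * μ ^ 2) ≤ c.α * (64 * Q.lip l ^ 2) := by gcongr
      have h5 : c.α * 64 ≤ c.β := by
        have : c.α * 64 * μ ^ 2 ≤ c.β * μ ^ 2 := by linarith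
        exact le_of_mul_le_mul_right this (by positivity)
      nlinarith
    have h6 : c.α * Q.lip l ^ 2 / (μ * c.β) ≤ 1 / 176 * (1 / c.α) := by
      rw [div_mul_div_comm, div_le_div_iff₀ (by positivity) (by positivity)]
      have h7 : c.α * (c.α * (64 * Q.lip l ^ 2)) ≤ c.α * (μ ^ 2 * c.β) := by gcongr
      have h8 : c.α * μ * (μ * c.β) ≤ 1 / 384 * (μ * c.β) := by gcongr
      have h9 : 0 < μ * c.β := by positivity
      nlinarith
    have e1 : 1 / (4 * c.α) = 1 / 4 * (1 / c.α) := by ring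
    have e2 : 1 / (2 * c.α) = 1 / 2 * (1 / c.α) := by ring
    linarith

end Params.Admissible

namespace Run

variable {dx dy p : ℕ} {Ξ : Type*} [MeasurableSpace Ξ] {Q : Problem dx dy p Ξ}
  {U : Set (Vec dx)} {V : Set (Vec dy)} {l μ δ : ℝ} {c : Params} {ε : ℝ} {Ω : Type*}
  [mΩ : MeasurableSpace Ω] {P : Measure Ω} {ζ : ℕ → Fin c.b → Ω → Ξ}
  {it : Iterates dx dy p Ω} {x₁ : Vec dx} {y₁ : Vec dy} {lam₁ : Vec p}
  (h : Run Q U V l μ δ c ε P ζ it x₁ y₁ lam₁) [IsProbabilityMeasure P]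
include h

/-- One step of the potential along the iterates. -/
theorem potential_succ_le (k : ℕ) :
    potential Q c l μ ε P it (k + 1 + 1) (it.x (k + 1 + 1)) (it.y (k + 1 + 1))
        (it.lam (k + 1 + 1)) ≤
      potential Q c l μ ε P it (k + 1) (it.x (k + 1)) (it.y (k + 1)) (it.lam (k + 1))
      + 4 * (c.eta k - c.eta (k + 1)) * (c.α * Q.lip l ^ 2)
        * (∫ ω, ‖track Q it (k + 1) ω‖ ^ 2 ∂P)
      - c.eta (k + 1) * (c.D₁ Q l μ * meanSqGap Q c P it (k + 1))
      + c.eta (k + 1) * (1 / 2 * ε ^ 2 * c.D₁ Q l μ) + C₂ c δ / ((k : ℝ) + 3) := by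
  have hb : (0 : ℝ) < c.b := Nat.cast_pos.2 h.adm.b_pos
  have hα := h.adm.α_pos
  have hμ := h.reg.μ_pos
  have hL := h.lip_pos
  have hD := h.D₁_pos
  have hη := h.adm.eta_pos (k + 1)
  have h3 : cbrt (k + 1) ^ 3 = cbrt k ^ 3 + 1 := by
    rw [cbrt_pow_three, cbrt_pow_three]
    push_cast
    ring
  have nn : ∀ {n : ℕ} (f : Ω → Vec n), 0 ≤ ∫ ω, ‖f ω‖ ^ 2 ∂P := fun f =>
    integral_nonneg fun ω => sq_nonneg _
  have d := h.integral_descent k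
  have g := h.adm.D₁_mul_gap_le hμ hL (nn (stepX Q c it (k + 1))) (nn (stepY Q c it (k + 1)))
    (nn (stepLam Q c it (k + 1))) (nn (errX Q c l μ ε it (k + 1)))
    (nn (errY Q c l μ ε it (k + 1)))
    ((h.integrable_gap_and_le k).2.trans_eq (by rw [mul_add 3]))
  have r₁ := (h.integral_errX_succ_le k (h.integrable_errX k)).2
  have r₂ := (h.integral_errY_succ_le k (h.integrable_errY k)).2
  rw [h.integral_norm_sub_x, h.integral_norm_sub_y] at r₁ r₂
  have s₁ := h.smoothing₁_sq_le (k + 1)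
  have s₂ := h.smoothing₂_sq_le (k + 1)
  rw [h.potential_eq k, h.potential_eq (k + 1)]
  have pX := nn (stepX Q c it (k + 1))
  have pY := nn (stepY Q c it (k + 1))
  have pZ := nn (stepLam Q c it (k + 1))
  have pE₁ := nn (errX Q c l μ ε it (k + 1))
  have pE₂ := nn (errY Q c l μ ε it (k + 1))
  have ps₁ := sq_nonneg (√dx * (l * c.theta₁ Q l μ ε (k + 1) / 2))
  have ps₂ := sq_nonneg (√dy * (l * c.theta₂ Q l μ ε (k + 1) / 2))
  generalize (∫ ω, ‖stepX Q c it (k + 1) ω‖ ^ 2 ∂P) = X at *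
  generalize (∫ ω, ‖stepY Q c it (k + 1) ω‖ ^ 2 ∂P) = Y at *
  generalize (∫ ω, ‖stepLam Q c it (k + 1) ω‖ ^ 2 ∂P) = Z at *
  generalize (∫ ω, ‖errX Q c l μ ε it (k + 1) ω‖ ^ 2 ∂P) = E₁ at *
  generalize (∫ ω, ‖errY Q c l μ ε it (k + 1) ω‖ ^ 2 ∂P) = E₂ at *
  generalize (√dx * (l * c.theta₁ Q l μ ε (k + 1) / 2)) ^ 2 = σ₁ at *
  generalize (√dy * (l * c.theta₂ Q l μ ε (k + 1) / 2)) ^ 2 = σ₂ at *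
  have t₁ := momentum_term_le (δ := δ) (m := 9 * l ^ 2 * X + 9 / 2 * l ^ 2 * Y) (one_le_cbrt k)
    (cbrt_le_cbrt_succ k) h3 h.adm.A₁_pos h.adm.A₃_pos h.adm.A₄_pos hb pE₁ (by positivity) ps₁
    (c.eta_eq (k + 1)) (c.eta_eq k) (c.varrho_succ k) (h.adm.varrho_le _ (Nat.le_add_left 1 k))
    (r₁.trans_eq (by ring))
  have t₂ := momentum_term_le (δ := δ) (m := 9 / 2 * l ^ 2 * Y + 9 * l ^ 2 * X) (one_le_cbrt k)
    (cbrt_le_cbrt_succ k) h3 h.adm.A₂_pos h.adm.A₃_pos (h.adm.A₅_pos hμ) hb pE₂ (by positivity) ps₂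
    (c.eta_eq (k + 1)) (c.eta_eq k) (c.iota_succ k) (h.adm.iota_le _ (Nat.le_add_left 1 k))
    (r₂.trans_eq (by ring))
  have b₁ := smoothing_budget (w := 3 * c.D₁ Q l μ + 4 * c.α) (one_le_cbrt (k + 1)) h.adm.A₁_pos
    h.adm.A₃_pos hb hD (by positivity) (c.eta_eq (k + 1)) s₁
  have b₂ := smoothing_budget (w := 3 * c.D₁ Q l μ + 320 * c.α * Q.lip l ^ 2 / μ ^ 2)
    (one_le_cbrt (k + 1)) h.adm.A₂_pos h.adm.A₃_pos hb hD (by positivity) (c.eta_eq (k + 1))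
    (s₂.trans_eq (by rw [Params.W₂, add_right_comm]))
  obtain ⟨cY, cX⟩ := h.adm.displacement_coeff h.reg.l_pos hμ h.reg.μ_le
  generalize (∫ ω, Q.Phi (it.x (k + 1) ω) (it.lam (k + 1) ω) ∂P) = F at *
  generalize (∫ ω, Q.Phi (it.x (k + 1 + 1) ω) (it.lam (k + 1 + 1) ω) ∂P) = F' at *
  generalize (∫ ω, ‖track Q it (k + 1) ω‖ ^ 2 ∂P) = D at *
  generalize (∫ ω, ‖track Q it (k + 1 + 1) ω‖ ^ 2 ∂P) = D' at *
  have d' : F' + (32 * c.α * Q.lip l ^ 2 / (c.β * μ) - 4 * c.eta (k + 1) * (c.α * Q.lip l ^ 2)) * D'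
      ≤ F + (32 * c.α * Q.lip l ^ 2 / (c.β * μ) - 4 * c.eta (k + 1) * (c.α * Q.lip l ^ 2)) * D
      - c.eta (k + 1) * (1 / (2 * c.α) * X)
      - c.eta (k + 1) * (24 * c.α * Q.lip l ^ 2 / (μ * c.β) * Y)
      - c.eta (k + 1) * (1 / (4 * c.γ) * Z) + c.eta (k + 1) * (2 * c.α * E₁ + 4 * c.α * σ₁
        + 320 * c.α * Q.lip l ^ 2 / μ ^ 2 * (E₂ + σ₂)) := by
    rw [← mul_assoc _ c.α]
    exact d
  have fin := combine_steps (η₀ := c.eta k) (m₁ := 2 * c.A₁ / c.b * l ^ 2)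
    (m₂ := 2 * c.A₂ / c.b * l ^ 2) (a₁ := c.A₁ / c.eta k) (a₂ := c.A₂ / c.eta k)
    (u₁ := c.A₁ * c.A₄ / c.A₃ ^ 2 - 2 / 3 * (c.A₁ / c.A₃ ^ 2))
    (u₂ := c.A₂ * c.A₅ / c.A₃ ^ 2 - 2 / 3 * (c.A₂ / c.A₃ ^ 2))
    (n₁ := 2 * δ ^ 2 * (c.A₄ ^ 2 * c.A₁) / (c.b * c.A₃) / cbrt (k + 1) ^ 3)
    (n₂ := 2 * δ ^ 2 * (c.A₅ ^ 2 * c.A₂) / (c.b * c.A₃) / cbrt (k + 1) ^ 3)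
    (t₁ := 12 * c.A₁ / (c.eta (k + 1) * c.b)) (t₂ := 12 * c.A₂ / (c.eta (k + 1) * c.b))
    hη.le pX pY pZ pE₁ pE₂ d' (t₁.trans_eq (by ring)) (t₂.trans_eq (by ring)) g cX cY le_rfl
    h.adm.momentum_coeff₁ (h.adm.momentum_coeff₂ hμ) b₁ b₂
  have e : C₂ c δ / ((k : ℝ) + 3) = 2 * δ ^ 2 * (c.A₄ ^ 2 * c.A₁) / (c.b * c.A₃) / cbrt (k + 1) ^ 3
      + 2 * δ ^ 2 * (c.A₅ ^ 2 * c.A₂) / (c.b * c.A₃) / cbrt (k + 1) ^ 3 := by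
    rw [cbrt_pow_three, C₂]
    push_cast
    ring
  rw [e]
  linarith

end Run


/-! ### Increments of the squared cube roots -/

/-- A discrete form of comparing `∑ k^{-1/3}` with its integral, by polynomial algebra from `v³ = u³
+ 1` and `u ≤ v`. The next lemma is the opposite comparison. -/
theorem cbrt_sq_succ_sub_le (k : ℕ) : 3 / 2 * (cbrt (k + 1) ^ 2 - cbrt k ^ 2) ≤ 1 / cbrt k := by
  have h0 := cbrt_pos k
  have h1 := cbrt_le_cbrt_succ k
  have h3 : cbrt (k + 1) ^ 3 = cbrt k ^ 3 + 1 := by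
    rw [cbrt_pow_three, cbrt_pow_three]
    push_cast
    ring
  rw [le_div_iff₀ h0]
  set u := cbrt k
  set v := cbrt (k + 1)
  have h2 : 0 ≤ (v - u) * (2 * v ^ 2 - u ^ 2 - u * v) :=
    mul_nonneg (by linarith) (by nlinarith)
  nlinarith

theorem le_cbrt_sq_succ_sub (k : ℕ) :
    1 / cbrt (k + 1) ≤ 3 / 2 * (cbrt (k + 1) ^ 2 - cbrt k ^ 2) := by
  have h0 := cbrt_pos k
  have h1 := cbrt_le_cbrt_succ k
  have h3 : cbrt (k + 1) ^ 3 = cbrt k ^ 3 + 1 := by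
    rw [cbrt_pow_three, cbrt_pow_three]
    push_cast
    ring
  rw [div_le_iff₀ (by linarith)]
  set u := cbrt k
  set v := cbrt (k + 1)
  have h2 : 0 ≤ (v - u) * (v ^ 2 + u * v - 2 * u ^ 2) :=
    mul_nonneg (by linarith) (by nlinarith)
  nlinarith

theorem cbrt_mono {j k : ℕ} (h : j ≤ k) : cbrt j ≤ cbrt k :=
  monotone_nat_of_le_succ cbrt_le_cbrt_succ h

/-- The last increment is at most the increment from `2` to `3`, by concavity, which in turn is at
most the total growth. It trades `T + 2` for `T + 3` in the final bound at the cost of a factor two;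
the first increment must exist, hence the condition `3 ≤ T`. -/
theorem cbrt_sq_add_le (n : ℕ) :
    cbrt (n + 1 + 3) ^ 2 + cbrt 2 ^ 2 ≤ 2 * cbrt (n + 1 + 2) ^ 2 := by
  have h1 := cbrt_sq_succ_sub_le (n + 1 + 2)
  have h2 := le_cbrt_sq_succ_sub 2
  have h3 : cbrt (2 + 1) ≤ cbrt (n + 1 + 2) := cbrt_mono (by omega)
  have h4 := cbrt_pos (2 + 1)
  have h5 : 1 / cbrt (n + 1 + 2) ≤ 1 / cbrt (2 + 1) := by gcongr
  have h6 : cbrt (2 + 1) ^ 2 ≤ cbrt (n + 1 + 2) ^ 2 := by gcongr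
  linarith

theorem one_div_le_log_sub {x : ℝ} (hx : 0 < x) : 1 / (x + 1) ≤ Real.log (x + 1) - Real.log x := by
  have h := Real.log_le_sub_one_of_pos (div_pos hx (by linarith : 0 < x + 1))
  rw [Real.log_div hx.ne' (by linarith)] at h
  have e : x / (x + 1) - 1 = -(1 / (x + 1)) := by
    field_simp
    ring
  linarith

/-! ### Lower bound for the potential -/

namespace Problem

variable {dx dy p : ℕ} {Ξ : Type*} [MeasurableSpace Ξ] {Q : Problem dx dy p Ξ}

theorem Feasible.exists_inner_resid_nonpos (hf : Q.Feasible) {x : Vec dx} (hx : x ∈ Q.X)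
    {lam : Vec p} (hlam : lam ∈ Q.mult) : ∃ y ∈ Q.Y, inner ℝ lam (Q.resid x y) ≤ 0 := by
  unfold Feasible at hf
  unfold mult at hlam
  split at hf <;> rename_i hk <;> rw [hk] at hlam
  · obtain ⟨y, hy, hr⟩ := hf x hx
    refine ⟨y, intrinsicInterior_subset hy, ?_⟩
    rw [PiLp.inner_apply]
    exact Finset.sum_nonpos fun i _ => mul_nonpos_of_nonpos_of_nonneg (hr i) (hlam i)
  · obtain ⟨y, hy, hr⟩ := hf x hx
    exact ⟨y, hy, by rw [hr, inner_zero_right]⟩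

/-- Testing the maximum with a feasible point makes the multiplier term harmless, so the bound is
uniform over the unbounded multiplier set. This is where feasibility enters. -/
theorem Regular.le_Phi {U : Set (Vec dx)} {V : Set (Vec dy)} {l μ : ℝ} (h : Q.Regular U V l μ)
    (hf : Q.Feasible) {C : ℝ} (hC : ∀ x ∈ Q.X, ∀ y ∈ Q.Y, |Q.g x y| ≤ C) {x : Vec dx}
    (hx : x ∈ Q.X) {lam : Vec p} (hlam : lam ∈ Q.mult) : -C ≤ Q.Phi x lam := by
  obtain ⟨y, hy, hr⟩ := hf.exists_inner_resid_nonpos hx hlam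
  have h1 := h.lagr_le_Phi hx hy lam
  have h2 := (abs_le.1 (hC x hx y hy)).1
  rw [lagr] at h1
  linarith

theorem Regular.exists_abs_g_le {U : Set (Vec dx)} {V : Set (Vec dy)} {l μ : ℝ}
    (h : Q.Regular U V l μ) : ∃ C, 0 ≤ C ∧ ∀ x ∈ Q.X, ∀ y ∈ Q.Y, |Q.g x y| ≤ C := by
  obtain ⟨C, hC⟩ := (Q.X_compact.prod Q.Y_compact).exists_bound_of_continuousOn h.continuousOn_g
  exact ⟨max C 0, le_max_right _ _, fun x hx y hy => (hC (x, y) ⟨hx, hy⟩).trans (le_max_left _ _)⟩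

theorem Regular.exists_abs_Phi_le {U : Set (Vec dx)} {V : Set (Vec dy)} {l μ : ℝ}
    (h : Q.Regular U V l μ) (R : ℝ) :
    ∃ C, 0 ≤ C ∧ ∀ x ∈ Q.X, ∀ lam : Vec p, ‖lam‖ ≤ R → |Q.Phi x lam| ≤ C := by
  have hcpt := Q.X_compact.prod (isCompact_closedBall (0 : Vec p) R)
  obtain ⟨C, hC⟩ := hcpt.exists_bound_of_continuousOn
    (h.continuousOn_Phi.mono (Set.prod_mono_right (Set.subset_univ _)))
  exact ⟨max C 0, le_max_right _ _, fun x hx lam hlam =>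
    (hC (x, lam) ⟨hx, mem_closedBall_zero_iff.2 hlam⟩).trans (le_max_left _ _)⟩

end Problem

theorem le_of_mem_potentialValues {dx dy p : ℕ} {Ξ : Type*} [MeasurableSpace Ξ]
    {Q : Problem dx dy p Ξ} {U : Set (Vec dx)} {V : Set (Vec dy)} {l μ ε : ℝ} {c : Params}
    {Ω : Type*} [MeasurableSpace Ω] {P : Measure Ω} [IsProbabilityMeasure P]
    {it : Iterates dx dy p Ω} (h : Q.Regular U V l μ) (hc : c.Admissible Q l μ) (hf : Q.Feasible)
    {C : ℝ} (hC0 : 0 ≤ C) (hC : ∀ x ∈ Q.X, ∀ y ∈ Q.Y, |Q.g x y| ≤ C) {s : ℝ}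
    (hs : s ∈ potentialValues Q c l μ ε P it) :
    -C - 16 * (c.α * Q.lip l ^ 2) * Q.sigmaY ^ 2 ≤ s := by
  obtain ⟨k, -, x, y, lam, -, -, -, -, hx, hy, hlam, rfl⟩ := hs
  have hα := hc.α_pos
  have hβ := hc.β_pos
  have hμ := h.μ_pos
  have hη := hc.eta_pos (k - 1)
  have hη1 := hc.eta_le_one (k - 1)
  have hA₁ := hc.A₁_pos
  have hA₂ := hc.A₂_pos
  have h1 : -C ≤ ∫ ω, (Q.Phi (x ω) (lam ω)
      + 32 * c.α * Q.lip l ^ 2 / (c.β * μ) * ‖y ω - Q.yStar (x ω) (lam ω)‖ ^ 2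
      + c.A₁ / c.eta (k - 1) *
        ‖Q.popX (c.theta₁ Q l μ ε k) (x ω) (y ω) (lam ω) - it.v k ω‖ ^ 2
      + c.A₂ / c.eta (k - 1) *
        ‖Q.popY (c.theta₂ Q l μ ε k) (x ω) (y ω) (lam ω) - it.w k ω‖ ^ 2) ∂P := by
    by_cases hi : Integrable (fun ω => Q.Phi (x ω) (lam ω)
      + 32 * c.α * Q.lip l ^ 2 / (c.β * μ) * ‖y ω - Q.yStar (x ω) (lam ω)‖ ^ 2
      + c.A₁ / c.eta (k - 1) *
        ‖Q.popX (c.theta₁ Q l μ ε k) (x ω) (y ω) (lam ω) - it.v k ω‖ ^ 2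
      + c.A₂ / c.eta (k - 1) *
        ‖Q.popY (c.theta₂ Q l μ ε k) (x ω) (y ω) (lam ω) - it.w k ω‖ ^ 2) P
    · refine HasMean.le (HasMean.const (P := P) (-C)) (HasMean.of_integrable hi) fun ω => ?_
      have := h.le_Phi hf hC (hx ω) (hlam ω)
      have t1 : 0 ≤ 32 * c.α * Q.lip l ^ 2 / (c.β * μ) * ‖y ω - Q.yStar (x ω) (lam ω)‖ ^ 2 := by
        positivity
      have t2 : 0 ≤ c.A₁ / c.eta (k - 1) *
        ‖Q.popX (c.theta₁ Q l μ ε k) (x ω) (y ω) (lam ω) - it.v k ω‖ ^ 2 := by positivity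
      have t3 : 0 ≤ c.A₂ / c.eta (k - 1) *
        ‖Q.popY (c.theta₂ Q l μ ε k) (x ω) (y ω) (lam ω) - it.w k ω‖ ^ 2 := by positivity
      linarith
    -- A non-integrable integrand has integral `0` by convention, which still satisfies the bound
    -- because `0 ≤ C`.
    · rw [integral_undef hi]
      linarith
  have h2 : ∫ ω, ‖y ω - Q.yStar (x ω) (lam ω)‖ ^ 2 ∂P ≤ (2 * Q.sigmaY) ^ 2 := by
    have := norm_integral_le_of_norm_le_const (μ := P)
      (f := fun ω => ‖y ω - Q.yStar (x ω) (lam ω)‖ ^ 2) (C := (2 * Q.sigmaY) ^ 2)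
      (Filter.Eventually.of_forall fun ω => by
        rw [Real.norm_of_nonneg (sq_nonneg _)]
        exact pow_le_pow_left₀ (norm_nonneg _)
          (Q.norm_sub_le_of_mem_Y (hy ω) (h.yStar_mem (hx ω) _)) 2)
    rw [probReal_univ, mul_one] at this
    exact (le_abs_self _).trans this
  have h3 : 4 * c.eta (k - 1) * c.α * Q.lip l ^ 2 * ∫ ω, ‖y ω - Q.yStar (x ω) (lam ω)‖ ^ 2 ∂P ≤
      4 * 1 * c.α * Q.lip l ^ 2 * (2 * Q.sigmaY) ^ 2 := by
    gcongr
  rw [potential]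
  linarith

namespace Run

variable {dx dy p : ℕ} {Ξ : Type*} [MeasurableSpace Ξ] {Q : Problem dx dy p Ξ}
  {U : Set (Vec dx)} {V : Set (Vec dy)} {l μ δ : ℝ} {c : Params} {ε : ℝ} {Ω : Type*}
  [mΩ : MeasurableSpace Ω] {P : Measure Ω} {ζ : ℕ → Fin c.b → Ω → Ξ}
  {it : Iterates dx dy p Ω} {x₁ : Vec dx} {y₁ : Vec dy} {lam₁ : Vec p}
  (h : Run Q U V l μ δ c ε P ζ it x₁ y₁ lam₁) [IsProbabilityMeasure P]
include h

theorem integral_track_le (k : ℕ) :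
    ∫ ω, ‖track Q it (k + 1) ω‖ ^ 2 ∂P ≤ 4 * Q.sigmaY ^ 2 :=
  (HasMean.of_integrable (h.integrable_track k)).le (HasMean.const (4 * Q.sigmaY ^ 2)) fun ω => by
    have := pow_le_pow_left₀ (norm_nonneg _) (h.norm_track_le k ω) 2
    linarith

omit [IsProbabilityMeasure P] in
theorem C₂_nonneg : 0 ≤ C₂ c δ := by
  have := h.adm.A₁_pos
  have := h.adm.A₂_pos
  have := h.adm.A₃_pos
  unfold C₂
  positivity

/-- The potential before the first hit. -/
theorem potential_le_of_lt (n : ℕ)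
    (hn : ∀ j, 2 ≤ j → j < n + 2 → ε ^ 2 < meanSqGap Q c P it j) :
    potential Q c l μ ε P it (n + 2) (it.x (n + 2)) (it.y (n + 2)) (it.lam (n + 2)) ≤
      potential Q c l μ ε P it 2 (it.x 2) (it.y 2) (it.lam 2)
      + 16 * (c.α * Q.lip l ^ 2) * Q.sigmaY ^ 2 * (c.eta 1 - c.eta (n + 1))
      - 3 / 4 * ε ^ 2 * (c.D₁ Q l μ * c.A₃) * (cbrt (n + 2) ^ 2 - cbrt 2 ^ 2)
      + C₂ c δ * Real.log ((n : ℝ) + 3) := by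
  have hD := h.D₁_pos
  have hα := h.adm.α_pos
  have hA₃ := h.adm.A₃_pos
  induction n with
  | zero =>
    have : 0 ≤ C₂ c δ * Real.log 3 := mul_nonneg h.C₂_nonneg (Real.log_nonneg (by norm_num))
    simpa using this
  | succ n ih =>
    have ih := ih fun j h2 hj => hn j h2 (by omega)
    have st := h.potential_succ_le (n + 1)
    have hg := hn (n + 2) (by omega) (by omega)
    have hη := h.adm.eta_pos (n + 2)
    -- The tracking error is at most `4 σ_y²`, so these terms telescope to `16 α̃ L² σ_y² (η_1 -
    -- η_{n+2})`.
    have hd := mul_le_mul_of_nonneg_left (h.integral_track_le (n + 1))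
      (by have := h.adm.eta_succ_le (n + 1); have : 0 ≤ c.eta (n + 1) - c.eta (n + 2) := by linarith
          positivity : 0 ≤ 4 * (c.eta (n + 1) - c.eta (n + 2)) * (c.α * Q.lip l ^ 2))
    have hgap : c.eta (n + 2) * (c.D₁ Q l μ * ε ^ 2) ≤
        c.eta (n + 2) * (c.D₁ Q l μ * meanSqGap Q c P it (n + 2)) := by gcongr
    -- Of the gain `η D₁ ε²` half is lost to smoothing; the remaining half is bounded below by an
    -- increment of the squared cube root.
    have hcb : 3 / 4 * ε ^ 2 * (c.D₁ Q l μ * c.A₃) * (cbrt (n + 3) ^ 2 - cbrt (n + 2) ^ 2) ≤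
        c.eta (n + 2) * (1 / 2 * ε ^ 2 * c.D₁ Q l μ) := by
      have h1 := cbrt_sq_succ_sub_le (n + 2)
      have h2 : 1 / 2 * ε ^ 2 * (c.D₁ Q l μ * c.A₃) *
          (3 / 2 * (cbrt (n + 2 + 1) ^ 2 - cbrt (n + 2) ^ 2)) ≤
          1 / 2 * ε ^ 2 * (c.D₁ Q l μ * c.A₃) * (1 / cbrt (n + 2)) := by gcongr
      have e : c.eta (n + 2) * (1 / 2 * ε ^ 2 * c.D₁ Q l μ) =
          1 / 2 * ε ^ 2 * (c.D₁ Q l μ * c.A₃) * (1 / cbrt (n + 2)) := by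
        rw [c.eta_eq]
        ring
      rw [e]
      linarith
    have hlog : C₂ c δ / (((n + 1 : ℕ) : ℝ) + 3) ≤
        C₂ c δ * (Real.log ((n : ℝ) + 3 + 1) - Real.log ((n : ℝ) + 3)) := by
      have := mul_le_mul_of_nonneg_left
        (one_div_le_log_sub (by positivity : 0 < (n : ℝ) + 3)) h.C₂_nonneg
      refine le_trans (le_of_eq ?_) this
      push_cast
      ring
    have e1 : (((n + 1 : ℕ) : ℝ) + 3) = (n : ℝ) + 3 + 1 := by
      push_cast
      ring
    rw [e1] at hlog st ⊢
    change potential Q c l μ ε P it (n + 1 + 1 + 1) (it.x (n + 1 + 1 + 1)) (it.y (n + 1 + 1 + 1))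
      (it.lam (n + 1 + 1 + 1)) ≤ _ at st
    change potential Q c l μ ε P it (n + 1 + 1 + 1) (it.x (n + 1 + 1 + 1)) (it.y (n + 1 + 1 + 1))
      (it.lam (n + 1 + 1 + 1)) ≤ _
    refine st.trans ?_
    change potential Q c l μ ε P it (n + 2) (it.x (n + 2)) (it.y (n + 2)) (it.lam (n + 2))
      + 4 * (c.eta (n + 1) - c.eta (n + 2)) * (c.α * Q.lip l ^ 2)
        * (∫ ω, ‖track Q it (n + 1 + 1) ω‖ ^ 2 ∂P)
      - c.eta (n + 2) * (c.D₁ Q l μ * meanSqGap Q c P it (n + 2))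
      + c.eta (n + 2) * (1 / 2 * ε ^ 2 * c.D₁ Q l μ) + C₂ c δ / ((n : ℝ) + 3 + 1) ≤
      potential Q c l μ ε P it 2 (it.x 2) (it.y 2) (it.lam 2)
      + 16 * (c.α * Q.lip l ^ 2) * Q.sigmaY ^ 2 * (c.eta 1 - c.eta (n + 2))
      - 3 / 4 * ε ^ 2 * (c.D₁ Q l μ * c.A₃) * (cbrt (n + 3) ^ 2 - cbrt 2 ^ 2)
      + C₂ c δ * Real.log ((n : ℝ) + 3 + 1)
    linarith

theorem mem_potentialValues (n : ℕ) :
    potential Q c l μ ε P it (n + 2) (it.x (n + 2)) (it.y (n + 2)) (it.lam (n + 2)) ∈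
      potentialValues Q c l μ ε P it := by
  obtain ⟨R, hR⟩ := h.exists_norm_lam_le (n + 1)
  exact ⟨n + 2, by omega, _, _, _, h.measurable_x (n + 1), h.measurable_y (n + 1),
    h.measurable_lam (n + 1), MemLp.of_bound (h.measurable_lam (n + 1)).aestronglyMeasurable R
      (Filter.Eventually.of_forall hR), h.x_mem (n + 1), h.y_mem (n + 1), h.lam_mem (n + 1), rfl⟩

theorem bddBelow_potentialValues (hf : Q.Feasible) :
    BddBelow (potentialValues Q c l μ ε P it) := by
  obtain ⟨C, hC0, hC⟩ := h.reg.exists_abs_g_le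
  exact ⟨_, fun s hs => le_of_mem_potentialValues h.reg h.adm hf hC0 hC hs⟩

/-- The master inequality before the first hit. -/
theorem mul_cbrt_sq_sub_le (hf : Q.Feasible) (n : ℕ)
    (hn : ∀ j, 2 ≤ j → j < n + 2 → ε ^ 2 < meanSqGap Q c P it j) :
    3 / 4 * ε ^ 2 * (c.D₁ Q l μ * c.A₃) * (cbrt (n + 2) ^ 2 - cbrt 2 ^ 2) ≤
      C₁ Q c l μ ε P it + C₂ c δ * Real.log ((n : ℝ) + 4) := by
  have h1 := h.potential_le_of_lt n hn
  have h2 := csInf_le (h.bddBelow_potentialValues hf) (h.mem_potentialValues n)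
  have hα := h.adm.α_pos
  have hη := h.adm.eta_pos (n + 1)
  have h3 : 0 ≤ 16 * (c.α * Q.lip l ^ 2) * Q.sigmaY ^ 2 * c.eta (n + 1) := by positivity
  -- With `T = n + 2` the enlarged argument is `T + 2`, which is also the cube of `cbrt (n + 2)`.
  have h4 : C₂ c δ * Real.log ((n : ℝ) + 3) ≤ C₂ c δ * Real.log ((n : ℝ) + 4) :=
    mul_le_mul_of_nonneg_left (Real.log_le_log (by positivity) (by linarith)) h.C₂_nonneg
  rw [C₁]
  linarith

end Run


/-! ### Inversion of the growth bound -/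

theorem log_cube_le {w : ℝ} (hw : 0 < w) : Real.log (w ^ 3) ≤ 3 * w := by
  have := Real.log_le_sub_one_of_pos hw
  rw [Real.log_pow]
  push_cast
  linarith

/-- A crude inversion: the logarithm of `w³` is at most `3 w`, and `w ≥ 1` lets the constants be
multiplied by `w`, after which one factor `w` cancels. -/
theorem le_of_sq_sub_le {κ s C C' w : ℝ} (hκ : 0 < κ) (hs : 0 ≤ s) (hC : 0 ≤ C) (hC' : 0 ≤ C')
    (hw : 1 ≤ w) (h : κ * (w ^ 2 - s) ≤ C + C' * Real.log (w ^ 3)) :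
    w ≤ s + (C + 3 * C') / κ := by
  have h1 := mul_le_mul_of_nonneg_left (log_cube_le (by linarith : 0 < w)) hC'
  have h2 : κ * w * w ≤ (κ * s + C + 3 * C') * w := by
    have h3 : 0 ≤ (κ * s + C) * (w - 1) := mul_nonneg (by positivity) (by linarith)
    nlinarith
  have h4 := le_of_mul_le_mul_right h2 (by linarith)
  have e : s + (C + 3 * C') / κ = (κ * s + C + 3 * C') / κ := by
    field_simp
    ring
  rw [e, le_div_iff₀ hκ]
  linarith

/-- Bootstrapping. The crude inversion gives `w ≤ K₁ ε⁻²`, hence `log (w³)` is at most a multiple of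
`log ε⁻¹`. Reinserting this gives `w² ≤ K₃ ε⁻² log ε⁻¹`, and the power `3/2` finishes. The condition
`ε ≤ 1/2` keeps `log ε⁻¹ ≥ log 2`, so constants can be absorbed into it. -/
theorem exists_cube_le (s C C' κ : ℝ) (hs : 0 ≤ s) (hC : 0 ≤ C) (hC' : 0 ≤ C') (hκ : 0 < κ) :
    ∃ K : ℝ, ∀ ε : ℝ, 0 < ε → ε ≤ 1 / 2 → ∀ w : ℝ, 1 ≤ w →
      κ * ε ^ 2 * (w ^ 2 - s) ≤ C + C' * Real.log (w ^ 3) →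
      w ^ 3 ≤ K * ε⁻¹ ^ 3 * Real.log ε⁻¹ ^ (3 / 2 : ℝ) := by
  have hlog2 : 0 < Real.log 2 := Real.log_pos (by norm_num)
  set K₁ := s + (C + 3 * C') / κ + 1 with hK₁
  have hK₁1 : 1 ≤ K₁ := by
    have : 0 ≤ s + (C + 3 * C') / κ := by positivity
    linarith
  have hlK₁ : 0 ≤ Real.log K₁ := Real.log_nonneg hK₁1
  set K₂ := 3 * (Real.log K₁ / Real.log 2 + 2) with hK₂
  have hK₂0 : 0 ≤ K₂ := by positivity
  set K₃ := s / Real.log 2 + (C / Real.log 2 + C' * K₂) / κ with hK₃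
  have hK₃0 : 0 ≤ K₃ := by positivity
  refine ⟨K₃ ^ (3 / 2 : ℝ), fun ε hε hε2 w hw h => ?_⟩
  set r := ε⁻¹ with hr
  have hr2 : 2 ≤ r := by
    rw [hr, le_inv_comm₀ two_pos hε]
    linarith
  have hr0 : 0 < r := by linarith
  have hr1 : 1 ≤ r ^ 2 := one_le_pow₀ (by linarith)
  have hl : Real.log 2 ≤ Real.log r := Real.log_le_log two_pos hr2
  have hl0 : 0 < Real.log r := by linarith
  have hεr : ε ^ 2 * r ^ 2 = 1 := by
    rw [hr, ← mul_pow, mul_inv_cancel₀ hε.ne', one_pow]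
  have hw1 : w ≤ K₁ * r ^ 2 := by
    have h1 := le_of_sq_sub_le (by positivity) hs hC hC' hw h
    have e : (C + 3 * C') / (κ * ε ^ 2) = (C + 3 * C') / κ * r ^ 2 := by
      rw [hr]
      field_simp
    rw [e] at h1
    have h2 : s ≤ s * r ^ 2 := le_mul_of_one_le_right hs hr1
    rw [hK₁]
    linarith
  have hw2 : Real.log (w ^ 3) ≤ K₂ * Real.log r := by
    have h1 := Real.log_le_log (by linarith) hw1
    rw [Real.log_mul (by linarith) (by positivity), Real.log_pow] at h1
    have h2 : Real.log K₁ ≤ Real.log K₁ / Real.log 2 * Real.log r := by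
      rw [div_mul_eq_mul_div, le_div_iff₀ hlog2]
      gcongr
    rw [Real.log_pow, hK₂]
    push_cast at h1 ⊢
    linarith
  have hw3 : w ^ 2 ≤ K₃ * (r ^ 2 * Real.log r) := by
    have h1 : κ * ε ^ 2 * (w ^ 2 - s) ≤ C + C' * (K₂ * Real.log r) :=
      h.trans (by gcongr)
    have h2 : w ^ 2 - s ≤ (C + C' * (K₂ * Real.log r)) / κ * r ^ 2 := by
      have h3 := mul_le_mul_of_nonneg_right h1 (by positivity : 0 ≤ r ^ 2 / κ)
      have e1 : κ * ε ^ 2 * (w ^ 2 - s) * (r ^ 2 / κ) = ε ^ 2 * r ^ 2 * (w ^ 2 - s) := by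
        field_simp
      rw [e1, hεr] at h3
      have e2 : (C + C' * (K₂ * Real.log r)) * (r ^ 2 / κ) =
          (C + C' * (K₂ * Real.log r)) / κ * r ^ 2 := by ring
      linarith
    have h4 : ∀ {t : ℝ}, 0 ≤ t → t ≤ t / Real.log 2 * Real.log r := fun {t} ht => by
      rw [div_mul_eq_mul_div, le_div_iff₀ hlog2]
      gcongr
    have h5 : s ≤ s / Real.log 2 * Real.log r * r ^ 2 :=
      (h4 hs).trans (le_mul_of_one_le_right (by positivity) hr1)
    have h6 : (C + C' * (K₂ * Real.log r)) / κ * r ^ 2 ≤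
        (C / Real.log 2 * Real.log r + C' * (K₂ * Real.log r)) / κ * r ^ 2 := by
      gcongr
      exact h4 hC
    have e3 : K₃ * (r ^ 2 * Real.log r) = s / Real.log 2 * Real.log r * r ^ 2 +
        (C / Real.log 2 * Real.log r + C' * (K₂ * Real.log r)) / κ * r ^ 2 := by
      rw [hK₃]
      ring
    linarith
  have e1 : w ^ 3 = (w ^ 2) ^ (3 / 2 : ℝ) := by
    rw [← Real.rpow_natCast w 2, ← Real.rpow_mul (by linarith)]
    norm_num
  have e2 : K₃ ^ (3 / 2 : ℝ) * r ^ 3 * Real.log r ^ (3 / 2 : ℝ) =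
      (K₃ * (r ^ 2 * Real.log r)) ^ (3 / 2 : ℝ) := by
    rw [Real.mul_rpow hK₃0 (by positivity), Real.mul_rpow (by positivity) hl0.le,
      ← Real.rpow_natCast r 2, ← Real.rpow_mul hr0.le, mul_assoc]
    norm_num
  rw [e1, e2]
  exact Real.rpow_le_rpow (by positivity) hw3 (by norm_num)

/-! ### Constraint violation -/

namespace Problem

variable {dx dy p : ℕ} {Ξ : Type*} [MeasurableSpace Ξ] {Q : Problem dx dy p Ξ}

theorem add_single_mem_mult {lam : Vec p} (hlam : lam ∈ Q.mult) (i : Fin p) :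
    lam + EuclideanSpace.single i (1 : ℝ) ∈ Q.mult := by
  unfold mult at hlam ⊢
  split at hlam
  · intro j
    have := hlam j
    by_cases hj : j = i
    · subst hj
      simp
      linarith
    · simpa [hj] using this
  · trivial

/-- Both kinds of multiplier set are closed under adding a unit vector, and the variational
inequality tested at the projection plus that vector is the claim. Applied to `λ + γ r`, it bounds
each `r i` by the displacement of the multiplier divided by `γ`. -/
theorem le_proj_mult_apply (u : Vec p) (i : Fin p) : u i ≤ proj Q.mult u i := by
  have hm := (proj_spec Q.mult_nonempty Q.mult_isClosed u).1
  have h := inner_proj_le Q.mult_nonempty Q.mult_isClosed Q.mult_convex u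
    (add_single_mem_mult hm i)
  rw [add_sub_cancel_left, EuclideanSpace.inner_single_right] at h
  simpa using h

theorem max_resid_le {γ : ℝ} (hγ : 0 < γ) (x : Vec dx) (y : Vec dy) (lam : Vec p) (i : Fin p) :
    max 0 (Q.resid x y i) ≤ 1 / γ * ‖lam - proj Q.mult (lam + γ • Q.resid x y)‖ := by
  refine max_le (by positivity) ?_
  have h1 := Q.le_proj_mult_apply (lam + γ • Q.resid x y) i
  have h2 := PiLp.norm_apply_le (lam - proj Q.mult (lam + γ • Q.resid x y)) i
  have h3 := neg_abs_le ((lam - proj Q.mult (lam + γ • Q.resid x y)) i)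
  rw [Real.norm_eq_abs] at h2
  simp only [PiLp.add_apply, PiLp.smul_apply, smul_eq_mul] at h1
  rw [PiLp.sub_apply] at h2 h3
  rw [div_mul_eq_mul_div, one_mul, le_div_iff₀ hγ]
  linarith

theorem Regular.max_resid_sq_le {U : Set (Vec dx)} {V : Set (Vec dy)} {l μ : ℝ}
    (h : Q.Regular U V l μ) {α β γ : ℝ} (hα : 0 < α) (hβ : 0 < β) (hγ : 0 < γ) {x : Vec dx}
    (hx : x ∈ Q.X) {y : Vec dy} (hy : y ∈ Q.Y) (lam : Vec p) (i : Fin p) :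
    max 0 (Q.resid x y i) ^ 2 ≤ ‖Q.gap α β γ x y lam‖ ^ 2 := by
  rw [h.norm_gap_sq hx hy lam hα hβ hγ]
  have h1 := pow_le_pow_left₀ (le_max_left _ _) (Q.max_resid_le hγ x y lam i) 2
  have h2 := sq_nonneg (1 / α * ‖x - proj Q.X (x - α • Q.lagrX x y lam)‖)
  have h3 := sq_nonneg (1 / β * ‖y - proj Q.Y (y + β • Q.lagrY x y lam)‖)
  linarith

end Problem

namespace Run

variable {dx dy p : ℕ} {Ξ : Type*} [MeasurableSpace Ξ] {Q : Problem dx dy p Ξ}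
  {U : Set (Vec dx)} {V : Set (Vec dy)} {l μ δ : ℝ} {c : Params} {ε : ℝ} {Ω : Type*}
  [mΩ : MeasurableSpace Ω] {P : Measure Ω} {ζ : ℕ → Fin c.b → Ω → Ξ}
  {it : Iterates dx dy p Ω} {x₁ : Vec dx} {y₁ : Vec dy} {lam₁ : Vec p}
  (h : Run Q U V l μ δ c ε P ζ it x₁ y₁ lam₁) [IsProbabilityMeasure P]
include h

theorem violation_le {k : ℕ} (hk : k ∈ hitSet Q c P it ε) (i : Fin p) :
    Integrable (fun ω => (max 0 (Q.resid (it.x k ω) (it.y k ω) i)) ^ 2) P ∧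
    ∫ ω, (max 0 (Q.resid (it.x k ω) (it.y k ω) i)) ^ 2 ∂P ≤ ε ^ 2 ∧
    ∫ ω, max 0 (Q.resid (it.x k ω) (it.y k ω) i) ∂P ≤ ε := by
  obtain ⟨hk1, hgap⟩ := hk
  obtain ⟨k, rfl⟩ : ∃ j, k = j + 1 := ⟨k - 1, by omega⟩
  have hε := h.ε_pos
  have hr : Measurable fun ω => Q.resid (it.x (k + 1) ω) (it.y (k + 1) ω) :=
    ((Q.A.continuous.measurable.comp (h.measurable_x k)).add
      (Q.B.continuous.measurable.comp (h.measurable_y k))).sub_const _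
  have hm : Measurable fun ω => max 0 (Q.resid (it.x (k + 1) ω) (it.y (k + 1) ω) i) :=
    measurable_const.max ((EuclideanSpace.proj (𝕜 := ℝ) i).continuous.measurable.comp hr)
  obtain ⟨i2, b2⟩ := (HasMean.of_integrable (h.integrable_gap_and_le k).1).dominated
    (hm.pow_const 2) (fun ω => sq_nonneg _) fun ω =>
      h.reg.max_resid_sq_le h.adm.α_pos h.adm.β_pos h.adm.γ_pos (h.x_mem k ω) (h.y_mem k ω) _ i
  have b2' := b2.trans hgap
  refine ⟨i2, b2', ?_⟩
  -- The first moment follows from the second through `t ≤ t² / (2 ε) + ε / 2`.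
  have key := ((HasMean.of_integrable i2).const_mul (1 / (2 * ε))).add
    (HasMean.const (P := P) (ε / 2))
  refine (key.dominated hm (fun ω => le_max_left _ _) fun ω => ?_).2.trans ?_
  · set t := max 0 (Q.resid (it.x (k + 1) ω) (it.y (k + 1) ω) i)
    have e : 1 / (2 * ε) * t ^ 2 + ε / 2 - t = (t - ε) ^ 2 / (2 * ε) := by
      field_simp
      ring
    have : 0 ≤ (t - ε) ^ 2 / (2 * ε) := by positivity
    linarith
  · have h1 := mul_le_mul_of_nonneg_left b2' (by positivity : 0 ≤ 1 / (2 * ε))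
    have e : 1 / (2 * ε) * ε ^ 2 + ε / 2 = ε := by
      field_simp
      ring
    linarith

/-! ### The potential at index two -/

/-- The bound is uniform in `ε ≤ 1`: the displacements are controlled by the sizes of the compact
sets and the smoothing error by its value at `ε = 1`. -/
theorem integral_errX_two_le (hε1 : ε ≤ 1) {R : ℝ} (hR : ∀ x ∈ Q.X, ‖x‖ ≤ R) :
    ∫ ω, ‖errX Q c l μ ε it 2 ω‖ ^ 2 ∂P ≤ 2 * δ ^ 2 / c.b + 1 / (c.b : ℝ) *
      (2 * δ ^ 2 + 2 * (9 * l ^ 2 * (R + R) ^ 2 + 9 / 2 * l ^ 2 * (2 * Q.sigmaY) ^ 2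
        + 6 * (1 / 4 * (c.D₁ Q l μ / c.W₁ Q l μ)))) := by
  have h1 := (h.integral_errX_succ_le 0 (h.integrable_errX 0)).2
  have h0 := h.integral_errX_one_le.2
  have hϱ0 := h.adm.varrho_nonneg 0
  have hϱ1 := h.adm.varrho_le 1 le_rfl
  have hr2 : (1 - c.varrho 1) ^ 2 ≤ 1 := by
    have : 0 ≤ c.varrho 1 := hϱ0
    nlinarith
  have hϱ2 : c.varrho 1 ^ 2 ≤ 1 := pow_le_one₀ hϱ0 hϱ1
  have hX : ∫ ω, ‖it.x (0 + 1 + 1) ω - it.x (0 + 1) ω‖ ^ 2 ∂P ≤ (R + R) ^ 2 :=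
    (HasMean.of_integrable (h.integrable_norm_sub_x 0 1)).le (HasMean.const _) fun ω =>
      pow_le_pow_left₀ (norm_nonneg _) ((norm_sub_le _ _).trans
        (add_le_add (hR _ (h.x_mem 1 ω)) (hR _ (h.x_mem 0 ω)))) 2
  have hY : ∫ ω, ‖it.y (0 + 1 + 1) ω - it.y (0 + 1) ω‖ ^ 2 ∂P ≤ (2 * Q.sigmaY) ^ 2 :=
    (HasMean.of_integrable (h.integrable_norm_sub_y 0 1)).le (HasMean.const _) fun ω =>
      pow_le_pow_left₀ (norm_nonneg _) (Q.norm_sub_le_of_mem_Y (h.y_mem 1 ω) (h.y_mem 0 ω)) 2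
  have hD := h.D₁_pos
  have hW := h.W₁_pos
  have hS : (√dx * (l * c.theta₁ Q l μ ε (0 + 1) / 2)) ^ 2 ≤
      1 / 4 * (c.D₁ Q l μ / c.W₁ Q l μ) := by
    have hε2 : ε ^ 2 ≤ 1 := pow_le_one₀ h.ε_pos.le hε1
    refine (h.smoothing₁_sq_le (0 + 1)).trans ((div_le_self (by positivity)
      (one_le_pow₀ (one_le_cbrt _))).trans ?_)
    calc 1 / 4 * ε ^ 2 * (c.D₁ Q l μ / c.W₁ Q l μ)
        ≤ 1 / 4 * 1 * (c.D₁ Q l μ / c.W₁ Q l μ) := by gcongr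
      _ = _ := by ring
  have nX : 0 ≤ ∫ ω, ‖it.x (0 + 1 + 1) ω - it.x (0 + 1) ω‖ ^ 2 ∂P :=
    integral_nonneg fun _ => sq_nonneg _
  have nY : 0 ≤ ∫ ω, ‖it.y (0 + 1 + 1) ω - it.y (0 + 1) ω‖ ^ 2 ∂P :=
    integral_nonneg fun _ => sq_nonneg _
  have nE : 0 ≤ ∫ ω, ‖errX Q c l μ ε it (0 + 1) ω‖ ^ 2 ∂P := integral_nonneg fun _ => sq_nonneg _
  refine h1.trans (add_le_add ?_ ?_)
  · exact (mul_le_of_le_one_left nE hr2).trans h0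
  · calc _ ≤ 1 / (c.b : ℝ) * (2 * 1 * δ ^ 2 + 2 * 1 * (9 * l ^ 2 * (R + R) ^ 2
          + 9 / 2 * l ^ 2 * (2 * Q.sigmaY) ^ 2 + 6 * (1 / 4 * (c.D₁ Q l μ / c.W₁ Q l μ)))) := by
          gcongr
      _ = _ := by ring

theorem integral_errY_two_le (hε1 : ε ≤ 1) {R : ℝ} (hR : ∀ x ∈ Q.X, ‖x‖ ≤ R) :
    ∫ ω, ‖errY Q c l μ ε it 2 ω‖ ^ 2 ∂P ≤ 2 * δ ^ 2 / c.b + 1 / (c.b : ℝ) *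
      (2 * δ ^ 2 + 2 * (9 / 2 * l ^ 2 * (2 * Q.sigmaY) ^ 2 + 9 * l ^ 2 * (R + R) ^ 2
        + 6 * (1 / 4 * (c.D₁ Q l μ / c.W₂ Q l μ)))) := by
  have h1 := (h.integral_errY_succ_le 0 (h.integrable_errY 0)).2
  have h0 := h.integral_errY_one_le.2
  have hι0 := h.adm.iota_nonneg h.reg.μ_pos 0
  have hι1 := h.adm.iota_le 1 le_rfl
  have hr2 : (1 - c.iota 1) ^ 2 ≤ 1 := by
    have : 0 ≤ c.iota 1 := hι0
    nlinarith
  have hι2 : c.iota 1 ^ 2 ≤ 1 := pow_le_one₀ hι0 hι1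
  have hX : ∫ ω, ‖it.x (0 + 1 + 1) ω - it.x (0 + 1) ω‖ ^ 2 ∂P ≤ (R + R) ^ 2 :=
    (HasMean.of_integrable (h.integrable_norm_sub_x 0 1)).le (HasMean.const _) fun ω =>
      pow_le_pow_left₀ (norm_nonneg _) ((norm_sub_le _ _).trans
        (add_le_add (hR _ (h.x_mem 1 ω)) (hR _ (h.x_mem 0 ω)))) 2
  have hY : ∫ ω, ‖it.y (0 + 1 + 1) ω - it.y (0 + 1) ω‖ ^ 2 ∂P ≤ (2 * Q.sigmaY) ^ 2 :=
    (HasMean.of_integrable (h.integrable_norm_sub_y 0 1)).le (HasMean.const _) fun ω =>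
      pow_le_pow_left₀ (norm_nonneg _) (Q.norm_sub_le_of_mem_Y (h.y_mem 1 ω) (h.y_mem 0 ω)) 2
  have hD := h.D₁_pos
  have hW := h.W₂_pos
  have hS : (√dy * (l * c.theta₂ Q l μ ε (0 + 1) / 2)) ^ 2 ≤
      1 / 4 * (c.D₁ Q l μ / c.W₂ Q l μ) := by
    have hε2 : ε ^ 2 ≤ 1 := pow_le_one₀ h.ε_pos.le hε1
    refine (h.smoothing₂_sq_le (0 + 1)).trans ((div_le_self (by positivity)
      (one_le_pow₀ (one_le_cbrt _))).trans ?_)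
    calc 1 / 4 * ε ^ 2 * (c.D₁ Q l μ / c.W₂ Q l μ)
        ≤ 1 / 4 * 1 * (c.D₁ Q l μ / c.W₂ Q l μ) := by gcongr
      _ = _ := by ring
  have nX : 0 ≤ ∫ ω, ‖it.x (0 + 1 + 1) ω - it.x (0 + 1) ω‖ ^ 2 ∂P :=
    integral_nonneg fun _ => sq_nonneg _
  have nY : 0 ≤ ∫ ω, ‖it.y (0 + 1 + 1) ω - it.y (0 + 1) ω‖ ^ 2 ∂P :=
    integral_nonneg fun _ => sq_nonneg _
  have nE : 0 ≤ ∫ ω, ‖errY Q c l μ ε it (0 + 1) ω‖ ^ 2 ∂P := integral_nonneg fun _ => sq_nonneg _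
  refine h1.trans (add_le_add ?_ ?_)
  · exact (mul_le_of_le_one_left nE hr2).trans h0
  · calc _ ≤ 1 / (c.b : ℝ) * (2 * 1 * δ ^ 2 + 2 * 1 * (9 / 2 * l ^ 2 * (2 * Q.sigmaY) ^ 2
          + 9 * l ^ 2 * (R + R) ^ 2 + 6 * (1 / 4 * (c.D₁ Q l μ / c.W₂ Q l μ)))) := by
          gcongr
      _ = _ := by ring

/-- The smoothing parameters, the iterates and hence `C₁` depend on `ε`, but the right-hand side
does not. This is what allows the constant in the rate to be chosen before `ε`. -/
theorem C₁_le (hf : Q.Feasible) (hε1 : ε ≤ 1) {R Rr C Cφ : ℝ} (hR : ∀ x ∈ Q.X, ‖x‖ ≤ R)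
    (hRr : ∀ x ∈ Q.X, ∀ y ∈ Q.Y, ‖Q.resid x y‖ ≤ Rr) (hC0 : 0 ≤ C)
    (hC : ∀ x ∈ Q.X, ∀ y ∈ Q.Y, |Q.g x y| ≤ C)
    (hφ : ∀ x ∈ Q.X, ∀ lam : Vec p, ‖lam‖ ≤ ‖lam₁‖ + c.γ * Rr → |Q.Phi x lam| ≤ Cφ) :
    C₁ Q c l μ ε P it ≤ Cφ + 32 * c.α * Q.lip l ^ 2 / (c.β * μ) * (4 * Q.sigmaY ^ 2)
      + c.A₁ / c.eta 1 * (2 * δ ^ 2 / c.b + 1 / (c.b : ℝ) *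
      (2 * δ ^ 2 + 2 * (9 * l ^ 2 * (R + R) ^ 2 + 9 / 2 * l ^ 2 * (2 * Q.sigmaY) ^ 2
        + 6 * (1 / 4 * (c.D₁ Q l μ / c.W₁ Q l μ)))))
      + c.A₂ / c.eta 1 * (2 * δ ^ 2 / c.b + 1 / (c.b : ℝ) *
      (2 * δ ^ 2 + 2 * (9 / 2 * l ^ 2 * (2 * Q.sigmaY) ^ 2 + 9 * l ^ 2 * (R + R) ^ 2
        + 6 * (1 / 4 * (c.D₁ Q l μ / c.W₂ Q l μ)))))
      + (C + 16 * (c.α * Q.lip l ^ 2) * Q.sigmaY ^ 2)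
      + 16 * c.α * Q.lip l ^ 2 * c.eta 1 * Q.sigmaY ^ 2 := by
  have hα := h.adm.α_pos
  have hβ := h.adm.β_pos
  have hμ := h.reg.μ_pos
  have hη := h.adm.eta_pos 1
  have hA₁ := h.adm.A₁_pos
  have hA₂ := h.adm.A₂_pos
  have h1 : -C - 16 * (c.α * Q.lip l ^ 2) * Q.sigmaY ^ 2 ≤
      sInf (potentialValues Q c l μ ε P it) :=
    le_csInf ⟨_, h.mem_potentialValues 0⟩ fun s hs =>
      le_of_mem_potentialValues h.reg h.adm hf hC0 hC hs
  have h2 : ∫ ω, Q.Phi (it.x (1 + 1) ω) (it.lam (1 + 1) ω) ∂P ≤ Cφ :=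
    (HasMean.of_integrable (h.integrable_Phi 1)).le (HasMean.const _) fun ω =>
      (le_abs_self _).trans (hφ _ (h.x_mem 1 ω) _
        ((h.norm_lam_le hRr 1 ω).trans_eq (by rw [Nat.cast_one, one_mul])))
  have h3 := mul_le_mul_of_nonneg_left (h.integral_track_le 1)
    (by positivity : 0 ≤ 32 * c.α * Q.lip l ^ 2 / (c.β * μ))
  have h4 := mul_le_mul_of_nonneg_left (h.integral_errX_two_le hε1 hR)
    (by positivity : 0 ≤ c.A₁ / c.eta 1)
  have h5 := mul_le_mul_of_nonneg_left (h.integral_errY_two_le hε1 hR)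
    (by positivity : 0 ≤ c.A₂ / c.eta 1)
  have h6 : 0 ≤ 4 * c.eta 1 * c.α * Q.lip l ^ 2 * ∫ ω, ‖track Q it (1 + 1) ω‖ ^ 2 ∂P :=
    mul_nonneg (by positivity) (integral_nonneg fun _ => sq_nonneg _)
  have h7 := h.potential_eq 1
  rw [C₁]
  change potential Q c l μ ε P it 2 (it.x 2) (it.y 2) (it.lam 2) = _ at h7
  rw [h7]
  linarith

omit h [IsProbabilityMeasure P] in
/-- Before the first hit the gap is large. -/
theorem lt_meanSqGap_of_lt_T₂ {j : ℕ} (h2 : 2 ≤ j) (hj : j < T₂ Q c P it ε) :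
    ε ^ 2 < meanSqGap Q c P it j := by
  by_contra hle
  exact Nat.notMem_of_lt_sInf hj ⟨by omega, not_lt.1 hle⟩

/-- If no index were hit, the master inequality would hold for every `n` and bound `cbrt (n + 2)` by
a fixed number `B`. The absolute value of `C₁` makes its sign irrelevant. -/
theorem hitSet_nonempty (hf : Q.Feasible) : (hitSet Q c P it ε).Nonempty := by
  by_contra hne
  have hD := h.D₁_pos
  have hA₃ := h.adm.A₃_pos
  have hε := h.ε_pos
  set κ := 3 / 4 * ε ^ 2 * (c.D₁ Q l μ * c.A₃)
  have hκ : 0 < κ := by positivity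
  set B := cbrt 2 ^ 2 + (|C₁ Q c l μ ε P it| + 3 * C₂ c δ) / κ
  obtain ⟨n, hn⟩ := exists_nat_gt (B ^ 3)
  have h1 := h.mul_cbrt_sq_sub_le hf n fun j h2 _ => by
    by_contra hle
    exact hne ⟨j, by omega, not_lt.1 hle⟩
  have h3 := cbrt_pow_three (n + 2)
  have e : ((n : ℝ) + 4) = cbrt (n + 2) ^ 3 := by
    rw [h3]
    push_cast
    ring
  rw [e] at h1
  have h4 := le_of_sq_sub_le hκ (sq_nonneg _) (abs_nonneg _) h.C₂_nonneg (one_le_cbrt (n + 2))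
    (h1.trans (by gcongr; exact le_abs_self _))
  have h5 := pow_le_pow_left₀ (cbrt_pos (n + 2)).le h4 3
  rw [← e] at h5
  linarith

/-- The bound for the first hitting index. -/
theorem sq_div_four_le (hf : Q.Feasible) (hT : 3 ≤ T₂ Q c P it ε) :
    ε ^ 2 / 4 ≤
      (C₁ Q c l μ ε P it + C₂ c δ * Real.log ((T₂ Q c P it ε : ℝ) + 2)) /
        (c.D₁ Q l μ * c.A₃ *
          (3 / 2 * ((T₂ Q c P it ε : ℝ) + 3) ^ (2 / 3 : ℝ)
            - 3 * (4 : ℝ) ^ (2 / 3 : ℝ) / 2)) := by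
  obtain ⟨n, hn⟩ : ∃ n, T₂ Q c P it ε = n + 1 + 2 := ⟨T₂ Q c P it ε - 3, by omega⟩
  have h1 := h.mul_cbrt_sq_sub_le hf (n + 1) fun j h2 hj =>
    lt_meanSqGap_of_lt_T₂ h2 (hj.trans_eq hn.symm)
  have hD := h.D₁_pos
  have hA₃ := h.adm.A₃_pos
  have hε := h.ε_pos
  have h2 := cbrt_sq_add_le n
  have e1 : ((T₂ Q c P it ε : ℝ) + 3) ^ (2 / 3 : ℝ) = cbrt (n + 1 + 3) ^ 2 := by
    rw [cbrt_pow_two, hn]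
    push_cast
    ring_nf
  have e2 : (4 : ℝ) ^ (2 / 3 : ℝ) = cbrt 2 ^ 2 := by
    rw [cbrt_pow_two]
    norm_num
  have e3 : (T₂ Q c P it ε : ℝ) + 2 = ((n + 1 : ℕ) : ℝ) + 4 := by
    rw [hn]
    push_cast
    ring
  have h3 : cbrt 2 < cbrt (n + 1 + 3) := by
    refine lt_of_pow_lt_pow_left₀ 3 (cbrt_pos _).le ?_
    rw [cbrt_pow_three, cbrt_pow_three]
    push_cast
    linarith [(Nat.cast_nonneg n : (0 : ℝ) ≤ n)]
  have h4 : cbrt 2 ^ 2 < cbrt (n + 1 + 3) ^ 2 :=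
    pow_lt_pow_left₀ h3 (cbrt_pos 2).le two_ne_zero
  rw [e1, e2, e3, le_div_iff₀ (mul_pos (mul_pos hD hA₃) (by linarith))]
  refine le_trans ?_ h1
  have h5 : 0 ≤ 3 / 4 * ε ^ 2 * (c.D₁ Q l μ * c.A₃) := by positivity
  have h6 := mul_le_mul_of_nonneg_left h2 h5
  linarith

end Run

end ZORMPDPG

/-! ### The main theorem -/

open ZORMPDPG in
theorem mainTheorem3 {dx dy p : ℕ} {Ξ : Type*} [MeasurableSpace Ξ] (Q : Problem dx dy p Ξ)
    (U : Set (Vec dx)) (V : Set (Vec dy)) (l μ δ : ℝ) (c : Params)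
    (hl : 0 < l) (hμ : 0 < μ) (hμL : μ ≤ Q.lip l) (hδ : 0 < δ)
    (hfeas : Q.Feasible) (hsmooth : Q.Smooth U V l) (hconc : Q.StronglyConcave μ)
    (hc : c.Admissible Q l μ)
    (x₁ : Vec dx) (hx₁ : x₁ ∈ Q.X) (y₁ : Vec dy) (hy₁ : y₁ ∈ Q.Y)
    (lam₁ : Vec p) (hlam₁ : lam₁ ∈ Q.mult) :
    ∃ K : ℝ, ∀ ε : ℝ, 0 < ε →
      Q.Stencil U V (c.theta₁ Q l μ ε) (c.theta₂ Q l μ ε) →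
      Q.BoundedVariance δ (c.theta₁ Q l μ ε) (c.theta₂ Q l μ ε) →
      ∀ (Ω : Type*) [MeasurableSpace Ω] (P : Measure Ω) [IsProbabilityMeasure P]
        (ζ : ℕ → Fin c.b → Ω → Ξ) (it : Iterates dx dy p Ω),
        IsSample Q.D P ζ →
        IsGenerated Q c (c.theta₁ Q l μ ε) (c.theta₂ Q l μ ε) ζ x₁ y₁ lam₁ it →
        -- the quantities below are well defined
        (∀ k, 1 ≤ k → Integrable (fun ω =>
          ‖Q.gap c.α c.β c.γ (it.x k ω) (it.y k ω) (it.lam k ω)‖ ^ 2) P) ∧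
        BddBelow (potentialValues Q c l μ ε P it) ∧
        (hitSet Q c P it ε).Nonempty ∧
        -- the inequality for the first index
        (3 ≤ T₂ Q c P it ε →
          ε ^ 2 / 4 ≤
            (C₁ Q c l μ ε P it + C₂ c δ * Real.log ((T₂ Q c P it ε : ℝ) + 2)) /
              (c.D₁ Q l μ * c.A₃ *
                (3 / 2 * ((T₂ Q c P it ε : ℝ) + 3) ^ (2 / 3 : ℝ)
                  - 3 * (4 : ℝ) ^ (2 / 3 : ℝ) / 2))) ∧
        -- the rate in the accuracy, with a constant that does not depend on it
        (ε ≤ 1 / 2 →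
          (T₂ Q c P it ε : ℝ) ≤ K * ε⁻¹ ^ 3 * Real.log ε⁻¹ ^ (3 / 2 : ℝ)) ∧
        -- the constraint violation at the first index
        (∀ i : Fin p,
          Integrable (fun ω =>
            (max 0 (Q.resid (it.x (T₂ Q c P it ε) ω) (it.y (T₂ Q c P it ε) ω) i)) ^ 2) P ∧
          ∫ ω, (max 0 (Q.resid (it.x (T₂ Q c P it ε) ω) (it.y (T₂ Q c P it ε) ω) i)) ^ 2 ∂P
            ≤ ε ^ 2 ∧
          ∫ ω, max 0 (Q.resid (it.x (T₂ Q c P it ε) ω) (it.y (T₂ Q c P it ε) ω) i) ∂P ≤ ε) := by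
  have hreg := hsmooth.regular hl hμ hμL hconc
  obtain ⟨R, hR⟩ := Q.X_compact.isBounded.exists_norm_le
  obtain ⟨Rr, -, hRr⟩ := Q.exists_resid_bound
  obtain ⟨C, hC0, hC⟩ := hreg.exists_abs_g_le
  obtain ⟨Cφ, hCφ0, hCφ⟩ := hreg.exists_abs_Phi_le (‖lam₁‖ + c.γ * Rr)
  have hL : 0 < Q.lip l := hl.trans_le (Q.l_le l)
  have hD := hc.D₁_pos hμ hL
  have hW₁ := hc.W₁_pos hμ hL
  have hW₂ := hc.W₂_pos hμ hL
  have hα := hc.α_pos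
  have hβ := hc.β_pos
  have hη := hc.eta_pos 1
  have hA₁ := hc.A₁_pos
  have hA₂ := hc.A₂_pos
  have hA₃ := hc.A₃_pos
  have hC₂ : 0 ≤ C₂ c δ := by
    unfold C₂
    positivity
  -- The constant is fixed here, before `ε`, the probability space and the run; its second argument
  -- is the uniform bound for `C₁`.
  obtain ⟨K, hK⟩ := exists_cube_le (cbrt 2 ^ 2)
    (Cφ + 32 * c.α * Q.lip l ^ 2 / (c.β * μ) * (4 * Q.sigmaY ^ 2)
      + c.A₁ / c.eta 1 * (2 * δ ^ 2 / c.b + 1 / (c.b : ℝ) *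
      (2 * δ ^ 2 + 2 * (9 * l ^ 2 * (R + R) ^ 2 + 9 / 2 * l ^ 2 * (2 * Q.sigmaY) ^ 2
        + 6 * (1 / 4 * (c.D₁ Q l μ / c.W₁ Q l μ)))))
      + c.A₂ / c.eta 1 * (2 * δ ^ 2 / c.b + 1 / (c.b : ℝ) *
      (2 * δ ^ 2 + 2 * (9 / 2 * l ^ 2 * (2 * Q.sigmaY) ^ 2 + 9 * l ^ 2 * (R + R) ^ 2
        + 6 * (1 / 4 * (c.D₁ Q l μ / c.W₂ Q l μ)))))
      + (C + 16 * (c.α * Q.lip l ^ 2) * Q.sigmaY ^ 2)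
      + 16 * c.α * Q.lip l ^ 2 * c.eta 1 * Q.sigmaY ^ 2)
    (C₂ c δ) (3 / 4 * (c.D₁ Q l μ * c.A₃)) (sq_nonneg _) (by positivity) hC₂ (by positivity)
  refine ⟨K, fun ε hε hst hvar Ω _ P _ ζ it hsam hgen => ?_⟩
  have h : Run Q U V l μ δ c ε P ζ it x₁ y₁ lam₁ :=
    ⟨hreg, hsmooth, hc, hε, hst, hvar, hsam, hgen, hx₁, hy₁, hlam₁⟩
  refine ⟨fun k hk => ?_, h.bddBelow_potentialValues hfeas, h.hitSet_nonempty hfeas,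
    h.sq_div_four_le hfeas, fun hε2 => ?_,
    h.violation_le (Nat.sInf_mem (h.hitSet_nonempty hfeas))⟩
  · obtain ⟨j, rfl⟩ : ∃ j, k = j + 1 := ⟨k - 1, by omega⟩
    exact (h.integrable_gap_and_le j).1
  -- Truncated subtraction: for a first index below `2` this is `n = 0`, the hypothesis on earlier
  -- indices is vacuous, and `T₂ ≤ n + 2` still holds.
  · set n := T₂ Q c P it ε - 2 with hn
    have h1 := h.mul_cbrt_sq_sub_le hfeas n fun j h2 hj =>
      Run.lt_meanSqGap_of_lt_T₂ h2 (by omega)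
    have h2 := h.C₁_le hfeas (hε2.trans (by norm_num)) hR hRr hC0 hC hCφ
    have e : (n : ℝ) + 4 = cbrt (n + 2) ^ 3 := by
      rw [cbrt_pow_three]
      push_cast
      ring
    rw [e] at h1
    have h3 := hK ε hε hε2 (cbrt (n + 2)) (one_le_cbrt _) (le_trans (le_of_eq (by ring))
      (h1.trans (by gcongr)))
    rw [← e] at h3
    have h4 : (T₂ Q c P it ε : ℝ) ≤ (n : ℝ) + 2 := by
      exact_mod_cast (by omega : T₂ Q c P it ε ≤ n + 2)
    linarith
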